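/- All graphs are finite, simple and connected. For a vertex $v$, a \emph{thread} hanging at $v$ is a path $u_1\cdots u_k$ ($k\ge 1$) such that $\deg(u_1)=1$, $\deg(u_2)=\dots=\deg(u_k)=2$, $u_k$ is adjacent to $v$ and $\deg(v)\ge 3$; its length is $k$, the distance from $v$ to $u_1$. Let $\ell(v)$ be the number of threads hanging at $v$ and $L(G)=\sum_{v:\,\ell(v)>1}(\ell(v)-1)$. The metric dimension $\dim(G)$ is the least size of a set $S\subseteq V(G)$ such that any two distinct vertices $x,x'$ satisfy $d(s,x)\ne d(s,x')$ for some $s\in S$. A \emph{cactus} is a connected graph whose cycles are pairwise edge-disjoint. For a cycle $C$ of a cactus $G$ and $v\in V(C)$, let $G_v(C)$ be the component of $G-E(C)$ containing $v$. The vertex $v$ is \emph{branch-active} on $C$ if $\deg(v)\ge 4$ or $G_v(C)$ contains a vertex of degree at least $3$ other than $v$; $C$ is an \emph{end-cycle} if it has exactly one branch-active vertex. Let $S\subseteq V(G)$. A vertex $v\in V(C)$ is \emph{$S$-active} on $C$ if $G_v(C)$ contains a vertex of $S$; $a_S(C)$ is the number of such vertices. A thread is \emph{$S$-free} if it contains no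 vertex of $S$. The set $S$ is a \emph{BBR set} if $a_S(C)\ge 2$ for every cycle $C$ and no two $S$-free threads hang at the same vertex; it is a \emph{smallest} BBR set if no BBR set has fewer elements. Given a BBR set $S$ and a cycle $C$ of length $g$, label the vertices of $C$ in cyclic order as $v_0,\dots,v_{g-1}$ so that $v_0$ is $S$-active and $k=\max\{i: v_i\text{ is }S\text{-active}\}$ is as small as possible. The path $v_0v_1\cdots v_k$, of length $k$, is the \emph{$S$-path} of $C$. With respect to $S$, the cycle $C$ contains configuration \begin{itemize} \item $\mathcal A$ if $a_S(C)=2$, $g$ is even and $k=g/2$; \item $\mathcal B$ if $k\le\lfloor g/2\rfloor-1$ and an $S$-free thread hangs at $v_i$ for some $i\in[k,\lfloor g/2\rfloor-1]\cup[\lceil g/2\rceil+k+1,g-1]\cup\{0\}$; \item $\mathcal C$ if $a_S(C)=2$, $g$ is even, $k\le g/2$ and an $S$-free thread of length at least $g/2-k$ hangs at $v_i$ for some $i\in[0,k]$. \end{itemize} A cycle is \emph{$\mathcal{ABC}$-negative} if for some smallest BBR set $S$ it contains none of $\mathcal A,\mathcal B,\mathcal C$ with respect to $S$, and \emph{$\mathcal{ABC}$-positive}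 otherwise. A vertex is \emph{vertex-critical} on $C$ with respect to $S$ if it is an end-vertex of the $S$-path of $C$ and that path has length at most $\lfloor g/2\rfloor-1$; two distinct cycles are \emph{vertex-critically incident} with respect to $S$ if they share a vertex that is vertex-critical on both. A smallest BBR set $S$ is \emph{nice} if no $\mathcal{ABC}$-negative cycle contains $\mathcal A$, $\mathcal B$ or $\mathcal C$ with respect to $S$ and, among all smallest BBR sets with this property, the number of pairs of cycles that are vertex-critically incident with respect to $S$ is the least possible. \textbf{Proposition.} Let $G$ be a cactus with $c\ge 2$ cycles. Then $G$ has a nice BBR set, and for every nice BBR set $S$ we have $\dim(G)=L(G)+2c-1$ if and only if one of the following holds: \begin{enumerate} \item every cycle of $G$ is an end-cycle, at most $c-1$ cycles are $\mathcal{ABC}$-positive, and the remaining (that is, $\mathcal{ABC}$-negative) cycles are pairwise vertex-critically incident with respect to $S$ (a void condition if there is only one such cycle); \item exactly $c-1$ cycles of $G$ are end-cycles and every cycle of $G$ is $\mathcal{ABC}$-positive. \end{enumerate} -/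

import Mathlib

namespace CactusDim

variable {V : Type*}

/-! ### Metric dimension -/

/-- `S` is a (vertex) metric generator: every two distinct vertices are distinguished by the
distance to some vertex of `S`. -/
def IsMetricGenerator (G : SimpleGraph V) (S : Finset V) : Prop :=
  ∀ x y : V, x ≠ y → ∃ s ∈ S, G.dist s x ≠ G.dist s y

/-- The (vertex) metric dimension: the least cardinality of a metric generator. -/
noncomputable def metricDim (G : SimpleGraph V) : ℕ :=
  sInf {n | ∃ S : Finset V, IsMetricGenerator G S ∧ S.card = n}

/-! ### Cycles and cacti -/

/-- The cycles of `G`, as subgraphs. -/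
def cycles (G : SimpleGraph V) : Set G.Subgraph :=
  {C | ∃ (u : V) (p : G.Walk u u), p.IsCycle ∧ p.toSubgraph = C}

/-- A cactus is a connected graph whose cycles are pairwise edge-disjoint. -/
def IsCactus (G : SimpleGraph V) : Prop :=
  G.Connected ∧ ∀ C ∈ cycles G, ∀ D ∈ cycles G, C ≠ D → Disjoint C.edgeSet D.edgeSet

/-- The number of cycles of `G`. -/
noncomputable def numCycles (G : SimpleGraph V) : ℕ := (cycles G).ncard

/-- The vertices of `G_v(C)`, the connected component of `G - E(C)` containing `v`. -/
def branch {G : SimpleGraph V} (C : G.Subgraph) (v : V) : Set V :=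
  {w | (G.deleteEdges C.edgeSet).Reachable v w}

/-! ### Threads and `L(G)` -/

/-- `T` is the vertex set of a thread hanging at `v`: a path `u₁ … u_k` (`k ≥ 1`) in which `u₁` is
a leaf and `u₂, …, u_k` have degree two, with `u_k` adjacent to `v` and `deg v ≥ 3`. The length of
the thread is `k = T.ncard`, the distance from `v` to the leaf `u₁`. -/
def IsThread (G : SimpleGraph V) [G.LocallyFinite] (v : V) (T : Set V) : Prop :=
  3 ≤ G.degree v ∧ ∃ (u w : V) (p : G.Walk u w), p.IsPath ∧ G.degree u = 1 ∧
    (∀ x ∈ p.support, x ≠ u → G.degree x = 2) ∧ G.Adj w v ∧ T = {x | x ∈ p.support}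

/-- `ℓ(v)`, the number of threads hanging at `v`. -/
noncomputable def numThreads (G : SimpleGraph V) [G.LocallyFinite] (v : V) : ℕ :=
  {T | IsThread G v T}.ncard

/-- `L(G)`, the sum of `ℓ(v) - 1` over the vertices `v` with `ℓ(v) > 1`. -/
noncomputable def leafNumber (G : SimpleGraph V) [Fintype V] [G.LocallyFinite] : ℕ :=
  ∑ v : V with 1 < numThreads G v, (numThreads G v - 1)

/-- `T` is an `S`-free thread hanging at `v`. -/
def IsFreeThread (G : SimpleGraph V) [G.LocallyFinite] (S : Finset V) (v : V) (T : Set V) : Prop :=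
  IsThread G v T ∧ ∀ s ∈ S, s ∉ T

/-! ### End-cycles -/

/-- The vertex `v` of the cycle `C` is branch-active: it has degree at least four, or `G_v(C)`
contains a vertex other than `v` of degree at least three. -/
def IsBranchActive {G : SimpleGraph V} [G.LocallyFinite] (C : G.Subgraph) (v : V) : Prop :=
  v ∈ C.verts ∧ (4 ≤ G.degree v ∨ ∃ w ∈ branch C v, w ≠ v ∧ 3 ≤ G.degree w)

/-- `C` is an end-cycle: exactly one vertex on it is branch-active. -/
def IsEndCycle {G : SimpleGraph V} [G.LocallyFinite] (C : G.Subgraph) : Prop :=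
  C ∈ cycles G ∧ {v | IsBranchActive C v}.ncard = 1

/-! ### BBR sets -/

/-- The vertex `v` of the cycle `C` is `S`-active: `G_v(C)` contains a vertex of `S`. -/
def IsActive {G : SimpleGraph V} (S : Finset V) (C : G.Subgraph) (v : V) : Prop :=
  v ∈ C.verts ∧ ∃ s ∈ S, s ∈ branch C v

/-- `a_S(C)`, the number of `S`-active vertices on `C`. -/
noncomputable def numActive {G : SimpleGraph V} (S : Finset V) (C : G.Subgraph) : ℕ :=
  {v | IsActive S C v}.ncard

/-- Every cycle contains at least two `S`-active vertices. -/
def IsBiactive (G : SimpleGraph V) (S : Finset V) : Prop :=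
  ∀ C ∈ cycles G, 2 ≤ numActive S C

/-- No two `S`-free threads hang at the same vertex. -/
def IsBranchResolving (G : SimpleGraph V) [G.LocallyFinite] (S : Finset V) : Prop :=
  ∀ (v : V) (T T' : Set V), IsFreeThread G S v T → IsFreeThread G S v T' → T = T'

/-- Biactive branch-resolving sets. -/
def IsBBR (G : SimpleGraph V) [G.LocallyFinite] (S : Finset V) : Prop :=
  IsBiactive G S ∧ IsBranchResolving G S

/-- Biactive branch-resolving sets of least cardinality. -/
def IsSmallestBBR (G : SimpleGraph V) [G.LocallyFinite] (S : Finset V) : Prop :=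
  IsBBR G S ∧ ∀ S' : Finset V, IsBBR G S' → S.card ≤ S'.card

/-! ### Canonical labellings and configurations

A closed walk `p : G.Walk u u` going once round `C` labels the vertices of `C` as
`v_i = p.getVert i` for `0 ≤ i < g`, where `g = p.length`. -/

/-- The walk `p` goes once round `C`, it starts at an `S`-active vertex, and `k` is the largest
index below `g` of an `S`-active vertex. -/
def HasSpan {G : SimpleGraph V} (S : Finset V) (C : G.Subgraph) {u : V} (p : G.Walk u u)
    (k : ℕ) : Prop :=
  p.IsCycle ∧ p.toSubgraph = C ∧ IsActive S C u ∧
    IsGreatest {i | i < p.length ∧ IsActive S C (p.getVert i)} k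

/-- The labelling by `p` is canonical: its last active index `k` is the smallest possible.
The `S`-path of `C` is then `v_0 v_1 … v_k`; it has length `k` and end-vertices `v_0`, `v_k`. -/
def IsCanonical {G : SimpleGraph V} (S : Finset V) (C : G.Subgraph) {u : V} (p : G.Walk u u)
    (k : ℕ) : Prop :=
  HasSpan S C p k ∧ ∀ (u' : V) (p' : G.Walk u' u') (k' : ℕ), HasSpan S C p' k' → k ≤ k'

/-- Configuration `𝒜` in the labelling by `p`. -/
def ConfigA {G : SimpleGraph V} (S : Finset V) (C : G.Subgraph) {u : V} (p : G.Walk u u)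
    (k : ℕ) : Prop :=
  numActive S C = 2 ∧ Even p.length ∧ k = p.length / 2

/-- Configuration `ℬ` in the labelling by `p`; `(p.length + 1) / 2` is `⌈g / 2⌉`. -/
def ConfigB {G : SimpleGraph V} [G.LocallyFinite] (S : Finset V) {u : V} (p : G.Walk u u)
    (k : ℕ) : Prop :=
  k ≤ p.length / 2 - 1 ∧
    ∃ i ∈ Set.Icc k (p.length / 2 - 1) ∪ Set.Icc ((p.length + 1) / 2 + k + 1) (p.length - 1) ∪ {0},
      ∃ T, IsFreeThread G S (p.getVert i) T

/-- Configuration `𝒞` in the labelling by `p`. -/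
def ConfigC {G : SimpleGraph V} [G.LocallyFinite] (S : Finset V) (C : G.Subgraph) {u : V}
    (p : G.Walk u u) (k : ℕ) : Prop :=
  numActive S C = 2 ∧ Even p.length ∧ k ≤ p.length / 2 ∧
    ∃ i ∈ Set.Icc 0 k, ∃ T, IsFreeThread G S (p.getVert i) T ∧ p.length / 2 - k ≤ T.ncard

/-- `C` contains one of the configurations `𝒜`, `ℬ`, `𝒞` with respect to `S`. This does not depend
on the canonical labelling: if `2k < g` it is unique up to reversal, under which the configurations
are invariant; if `2k ≥ g` then `ℬ` is impossible, and `𝒜` and `𝒞` need `2k = g`, `a_S(C) = 2`,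
which is `𝒜` in every canonical labelling. -/
def ContainsABC {G : SimpleGraph V} [G.LocallyFinite] (S : Finset V) (C : G.Subgraph) : Prop :=
  ∃ (u : V) (p : G.Walk u u) (k : ℕ), IsCanonical S C p k ∧
    (ConfigA S C p k ∨ ConfigB S p k ∨ ConfigC S C p k)

/-- The cycle `C` is `𝒜ℬ𝒞`-negative. -/
def IsABCNegative {G : SimpleGraph V} [G.LocallyFinite] (C : G.Subgraph) : Prop :=
  C ∈ cycles G ∧ ∃ S : Finset V, IsSmallestBBR G S ∧ ¬ ContainsABC S C

/-- The cycle `C` is `𝒜ℬ𝒞`-positive. -/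
def IsABCPositive {G : SimpleGraph V} [G.LocallyFinite] (C : G.Subgraph) : Prop :=
  C ∈ cycles G ∧ ¬ IsABCNegative C

/-! ### Vertex-critical incidence and nice sets -/

/-- `v` is vertex-critical on the cycle `C` with respect to `S`: it is an end-vertex of the
`S`-path of `C`, and the length of that path is at most `⌊g / 2⌋ - 1`. -/
def IsVertexCritical {G : SimpleGraph V} (S : Finset V) (C : G.Subgraph) (v : V) : Prop :=
  ∃ (u : V) (p : G.Walk u u) (k : ℕ), IsCanonical S C p k ∧
    (v = p.getVert 0 ∨ v = p.getVert k) ∧ k ≤ p.length / 2 - 1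

/-- The distinct cycles `C` and `D` are vertex-critically incident with respect to `S`. -/
def VertexCriticallyIncident {G : SimpleGraph V} (S : Finset V) (C D : G.Subgraph) : Prop :=
  C ∈ cycles G ∧ D ∈ cycles G ∧ C ≠ D ∧ ∃ v, IsVertexCritical S C v ∧ IsVertexCritical S D v

/-- The number of unordered pairs of vertex-critically incident cycles with respect to `S`. -/
noncomputable def numIncidentPairs (G : SimpleGraph V) (S : Finset V) : ℕ :=
  {e : Sym2 G.Subgraph | ∃ C D, e = s(C, D) ∧ VertexCriticallyIncident S C D}.ncard

/-- `S` is a smallest BBR set with respect to which no `𝒜ℬ𝒞`-negative cycle contains one of the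
configurations `𝒜`, `ℬ`, `𝒞`. -/
def IsABCAdmissible (G : SimpleGraph V) [G.LocallyFinite] (S : Finset V) : Prop :=
  IsSmallestBBR G S ∧ ∀ C : G.Subgraph, IsABCNegative C → ¬ ContainsABC S C

/-- `S` is nice: among the admissible sets it minimizes the number of pairs of vertex-critically
incident cycles. -/
def IsNice (G : SimpleGraph V) [G.LocallyFinite] (S : Finset V) : Prop :=
  IsABCAdmissible G S ∧
    ∀ S' : Finset V, IsABCAdmissible G S' → numIncidentPairs G S ≤ numIncidentPairs G S'

end CactusDim

namespace CactusDim

open SimpleGraph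

/-! ### Distances, labelled cycles and gates -/

section

variable {V : Type*} {G : SimpleGraph V}

/-! ### Reachability and separating vertices -/

/-! Let e be the number of end-cycles. Two facts carry the proof. First, metric generators are
exactly the BBR sets for which no cycle contains a configuration and no two cycles are
vertex-critically incident: each of these defects produces two undistinguished vertices, and
conversely two undistinguished vertices, studied at the middle of a geodesic between them, exhibit a
defect (`IsMetricGenerator.not_containsABC`, `IsMetricGenerator.not_incident`,
`IsBBR.isMetricGenerator`). Second, a branch-resolving set is BBR as soon as it meets the periphery
of every end-cycle (`IsCactus.isBBR_iff`). These peripheries are disjoint from each other and from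
all threads that have a rival at the same vertex, so every inclusion-minimal BBR set has L(G) + e
elements and is a smallest one.

From above, one well-chosen extra vertex on a cycle removes its configurations and critical vertices
without disturbing the other cycles. Hence dim(G) ≤ |S| + c - |A| whenever the cycles of A are free
of configurations and pairwise non-incident for the BBR set S (`IsBBR.metricDim_add_le`). From
below, a minimum generator R contains a minimal BBR set, and each cycle with a configuration for
that set costs an element of R of its own (`IsMetricGenerator.card_add_le`); positive cycles always
cost one.

So dim(G) is at most L(G) + e + c, with equality exactly when all cycles are positive. As e ≤ c, the
value L(G) + 2c - 1 means either e = c - 1 with equality, or e = c with exactly one vertex saved. A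
second vertex can be saved if two negative cycles are not incident. Niceness gives the converse: if
R saves on two incident negative cycles, its traces on their peripheries can be transplanted into S.
By minimality of the number of incident pairs, both cycles are still critical at the common vertex
with respect to R, and R is no generator (`IsNice.isVertexCritical`,
`IsNice.card_add_numCycles_le`). -/

lemma mem_of_reachable_of_closed {H : SimpleGraph V} {A : Set V}
    (hA : ∀ a ∈ A, ∀ b, H.Adj a b → b ∈ A) {x y : V} (h : H.Reachable x y) (hx : x ∈ A) :
    y ∈ A := by
  obtain ⟨p⟩ := h
  induction p with
  | nil => exact hx
  | cons hadj _ ih => exact ih (hA _ hx _ hadj)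

lemma exists_exit_edge {H : SimpleGraph V} {A : Set V} {x y : V} (h : H.Reachable x y)
    (hx : x ∈ A) (hy : y ∉ A) : ∃ a ∈ A, ∃ b ∉ A, H.Adj a b ∧ H.Reachable x a := by
  by_contra! hcon
  have : y ∈ {a | a ∈ A ∧ H.Reachable x a} := by
    refine mem_of_reachable_of_closed ?_ h ⟨hx, Reachable.refl _⟩
    rintro a ⟨ha, hxa⟩ b hab
    refine ⟨?_, hxa.trans hab.reachable⟩
    by_contra hb
    exact hcon a ha b hb hab hxa
  exact hy this.1

lemma mem_support_of_exit {A : Set V} {v : V}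
    (hA : ∀ a ∈ A, ∀ b ∉ A, G.Adj a b → a = v ∨ b = v) {x y : V} (p : G.Walk x y)
    (hx : x ∈ A) (hy : y ∉ A) : v ∈ p.support := by
  induction p with
  | nil => exact absurd hx hy
  | @cons a b c hadj q ih =>
    rw [Walk.support_cons, List.mem_cons]
    by_cases hb : b ∈ A
    · exact Or.inr (ih hb hy)
    · rcases hA _ hx _ hb hadj with h | h
      · exact Or.inl h.symm
      · right
        rw [← h]
        exact q.start_mem_support

lemma dist_add_le_length {v x y : V} (p : G.Walk x y) (hv : v ∈ p.support) :
    G.dist x v + G.dist v y ≤ p.length := by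
  classical
  rw [← p.take_spec hv, Walk.length_append]
  exact add_le_add (dist_le _) (dist_le _)

/-- If every edge leaving `A` is incident with `v`, then `v` separates `A` from the rest. -/
lemma dist_eq_of_exit (hG : G.Connected) {A : Set V} {v x y : V}
    (hA : ∀ a ∈ A, ∀ b ∉ A, G.Adj a b → a = v ∨ b = v) (hx : x ∈ A) (hy : y ∉ A ∨ y = v) :
    G.dist x y = G.dist x v + G.dist v y := by
  rcases hy with hy | rfl
  · obtain ⟨p, hp⟩ := hG.exists_walk_length_eq_dist x y
    apply le_antisymm hG.dist_triangle
    rw [← hp]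
    exact dist_add_le_length p (mem_support_of_exit hA p hx hy)
  · simp

lemma reachable_of_exit {H : SimpleGraph V} {A : Set V} {v x y : V}
    (hA : ∀ a ∈ A, ∀ b ∉ A, H.Adj a b → a = v ∨ b = v) (hx : x ∈ A) (hy : y ∉ A)
    (h : H.Reachable x y) : H.Reachable x v ∧ H.Reachable v y := by
  classical
  obtain ⟨p⟩ := h
  have := mem_support_of_exit hA p hx hy
  exact ⟨⟨p.takeUntil v this⟩, ⟨p.dropUntil v this⟩⟩

/-- A function changing by at most one along each edge bounds the distance from below. -/
lemma le_add_dist_of_lipschitz (hG : G.Connected) (f : V → ℕ)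
    (hf : ∀ a b, G.Adj a b → f b ≤ f a + 1) (x y : V) : f y ≤ f x + G.dist x y := by
  obtain ⟨p, hp⟩ := hG.exists_walk_length_eq_dist x y
  rw [← hp]
  clear hp
  induction p with
  | nil => simp
  | cons hadj q ih =>
    have := hf _ _ hadj
    rw [Walk.length_cons]
    omega

lemma dist_getVert_add_le (hG : G.Connected) {x y : V} (p : G.Walk x y) (i n : ℕ) :
    i + n ≤ p.length → G.dist (p.getVert i) (p.getVert (i + n)) ≤ n := by
  induction n with
  | zero => simp
  | succ n ih =>
    intro hle
    have h1 := ih (by omega)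
    have h2 : G.dist (p.getVert (i + n)) (p.getVert (i + n + 1)) = 1 :=
      dist_eq_one_iff_adj.2 (p.adj_getVert_succ (by omega))
    have h3 := hG.dist_triangle (u := p.getVert i) (v := p.getVert (i + n))
      (w := p.getVert (i + n + 1))
    rw [← add_assoc]
    omega

lemma dist_getVert_of_geodesic (hG : G.Connected) {x y : V} {p : G.Walk x y}
    (hp : p.length = G.dist x y) {i : ℕ} (hi : i ≤ p.length) :
    G.dist x (p.getVert i) = i ∧ G.dist (p.getVert i) y + i = G.dist x y := by
  have h1 := dist_getVert_add_le hG p 0 i (by omega)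
  have h2 := dist_getVert_add_le hG p i (p.length - i) (by omega)
  rw [show i + (p.length - i) = p.length by omega, Walk.getVert_length] at h2
  rw [zero_add, Walk.getVert_zero] at h1
  have h3 := hG.dist_triangle (u := x) (v := p.getVert i) (w := y)
  omega

/-! ### Labellings of a cycle -/

/-- The closed walk `p` goes once round `C`. -/
def IsLabelling (C : G.Subgraph) {u : V} (p : G.Walk u u) : Prop :=
  p.IsCycle ∧ p.toSubgraph = C

/-- The distance between the positions `i` and `j` on a cycle of length `g`. -/
def cycDist (g i j : ℕ) : ℕ := min ((i - j) + (j - i)) (g - ((i - j) + (j - i)))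

section labelling

variable {C : G.Subgraph} {u : V} {p : G.Walk u u}

lemma IsLabelling.mem_cycles (h : IsLabelling C p) : C ∈ cycles G := ⟨u, p, h⟩

lemma exists_labelling (hC : C ∈ cycles G) {w : V} (hw : w ∈ C.verts) :
    ∃ p : G.Walk w w, IsLabelling C p := by
  classical
  obtain ⟨u, p, hp, rfl⟩ := hC
  rw [Walk.mem_verts_toSubgraph] at hw
  exact ⟨p.rotate w hw, hp.rotate hw, p.toSubgraph_rotate hw⟩

lemma exists_mem_verts (hC : C ∈ cycles G) : ∃ w, w ∈ C.verts := by
  obtain ⟨u, p, hp, rfl⟩ := hC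
  exact ⟨u, by simp⟩

lemma IsLabelling.reverse (h : IsLabelling C p) : IsLabelling C p.reverse :=
  ⟨h.1.reverse, by rw [Walk.toSubgraph_reverse, h.2]⟩

lemma IsLabelling.three_le (h : IsLabelling C p) : 3 ≤ p.length := h.1.isCircuit.three_le_length

lemma IsLabelling.getVert_mem (h : IsLabelling C p) (i : ℕ) : p.getVert i ∈ C.verts := by
  rw [← h.2, Walk.mem_verts_toSubgraph]
  exact p.getVert_mem_support i

lemma IsLabelling.exists_index (h : IsLabelling C p) {w : V} (hw : w ∈ C.verts) :
    ∃ i < p.length, p.getVert i = w := by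
  rw [← h.2, Walk.mem_verts_toSubgraph, Walk.mem_support_iff_exists_getVert] at hw
  obtain ⟨n, hn, hle⟩ := hw
  rcases hle.lt_or_eq with hlt | rfl
  · exact ⟨n, hlt, hn⟩
  · refine ⟨0, by have := h.three_le; omega, ?_⟩
    rw [← hn, Walk.getVert_length, Walk.getVert_zero]

lemma IsLabelling.inj (h : IsLabelling C p) {i j : ℕ} (hi : i < p.length) (hj : j < p.length)
    (hij : p.getVert i = p.getVert j) : i = j :=
  h.1.getVert_injOn' (show i ≤ p.length - 1 by omega) (show j ≤ p.length - 1 by omega) hij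

lemma IsLabelling.edge_mem (h : IsLabelling C p) {i : ℕ} (hi : i < p.length) :
    s(p.getVert i, p.getVert (i + 1)) ∈ C.edgeSet := by
  rw [← h.2]
  exact p.toSubgraph_adj_getVert hi

lemma IsLabelling.exists_of_edge_mem (h : IsLabelling C p) {a b : V} (hab : s(a, b) ∈ C.edgeSet) :
    ∃ i < p.length, (p.getVert i = a ∧ p.getVert (i + 1) = b) ∨
      (p.getVert i = b ∧ p.getVert (i + 1) = a) := by
  rw [← h.2, Subgraph.mem_edgeSet, Walk.toSubgraph_adj_iff] at hab
  obtain ⟨i, hi, hlt⟩ := hab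
  exact ⟨i, hlt, by simpa using hi⟩

/-- A match with reversed ends would force j = i + 1 and then equality of the positions i and i + 2,
which a length of at least three forbids. -/
lemma IsLabelling.edge_ne (h : IsLabelling C p) {i j : ℕ} (hij : i < j) (hj : j < p.length) :
    s(p.getVert i, p.getVert (i + 1)) ≠ s(p.getVert j, p.getVert (j + 1)) := by
  have h3 := h.three_le
  intro heq
  rw [Sym2.eq_iff] at heq
  rcases heq with ⟨h1, -⟩ | ⟨h1, h2⟩
  · have := h.inj (by omega) hj h1
    omega
  · have := h.inj (by omega) hj h2
    subst this
    rcases Nat.lt_or_ge (i + 1 + 1) p.length with hlt | hge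
    · have := h.inj (by omega) hlt h1
      omega
    · rw [Walk.getVert_of_length_le _ hge] at h1
      have := h.inj (i := i) (j := 0) (by omega) (by omega) (by simpa using h1)
      omega

lemma mem_verts_of_edge_mem {a b : V} (h : s(a, b) ∈ C.edgeSet) : a ∈ C.verts ∧ b ∈ C.verts := by
  rw [Subgraph.mem_edgeSet] at h
  exact ⟨h.fst_mem, h.snd_mem⟩

lemma dist_getVert_le_cycDist (hG : G.Connected) {i j : ℕ}
    (hi : i ≤ p.length) (hj : j ≤ p.length) :
    G.dist (p.getVert i) (p.getVert j) ≤ cycDist p.length i j := by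
  wlog hij : i ≤ j generalizing i j
  · rw [dist_comm]
    refine (this hj hi (by omega)).trans ?_
    unfold cycDist
    omega
  · have h1 := dist_getVert_add_le hG p i (j - i) (by omega)
    have h2 := dist_getVert_add_le hG p 0 i (by omega)
    have h3 := dist_getVert_add_le hG p j (p.length - j) (by omega)
    rw [show i + (j - i) = j by omega] at h1
    rw [show j + (p.length - j) = p.length by omega, Walk.getVert_length] at h3
    rw [zero_add, Walk.getVert_zero] at h2
    have h4 := hG.dist_triangle (u := p.getVert i) (v := u) (w := p.getVert j)
    rw [dist_comm (u := p.getVert i) (v := u), dist_comm (u := u) (v := p.getVert j)] at h4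
    unfold cycDist
    omega

end labelling

/-! ### Gates -/

/-- A connection from x to y avoiding both edges would close up with xy to a cycle through xy that
misses e: a second cycle sharing an edge with C. -/
lemma IsCactus.not_reachable_deleteEdges_pair (hG : IsCactus G) {C : G.Subgraph}
    (hC : C ∈ cycles G) {x y : V} {e : Sym2 V} (hxy : s(x, y) ∈ C.edgeSet) (he : e ∈ C.edgeSet)
    (hne : s(x, y) ≠ e) : ¬ (G.deleteEdges {s(x, y), e}).Reachable x y := by
  intro h
  have hadj : (G.deleteEdges {e}).Adj x y := by
    rw [deleteEdges_adj]
    exact ⟨C.adj_sub hxy, hne⟩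
  have hr : ((G.deleteEdges {e}).deleteEdges {s(x, y)}).Reachable x y := by
    rw [deleteEdges_deleteEdges]
    refine h.mono (deleteEdges_anti ?_)
    rintro f (hf | hf)
    · exact Or.inr hf
    · exact Or.inl hf
  obtain ⟨u, p, hp, hmem⟩ := adj_and_reachable_delete_edges_iff_exists_cycle.1 ⟨hadj, hr⟩
  have hle : G.deleteEdges {e} ≤ G := deleteEdges_le _
  set q := p.mapLe hle with hq
  have hqc : q.IsCycle := hp.mapLe hle
  have hedges : q.edges = p.edges := Walk.edges_mapLe_eq_edges hle p
  have hD : q.toSubgraph ∈ cycles G := ⟨u, q, hqc, rfl⟩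
  have h1 : s(x, y) ∈ q.toSubgraph.edgeSet := by
    rw [Walk.mem_edges_toSubgraph, hedges]
    exact hmem
  have h2 : e ∉ q.toSubgraph.edgeSet := by
    rw [Walk.mem_edges_toSubgraph, hedges]
    intro h'
    have := p.edges_subset_edgeSet h'
    rw [edgeSet_deleteEdges] at this
    exact this.2 rfl
  have hCD : C ≠ q.toSubgraph := by
    rintro rfl
    exact h2 he
  exact Set.disjoint_left.1 (hG.2 C hC _ hD hCD) hxy h1

/-- If v = v_0 and v' = v_j were joined outside C, then after deleting v_0v_1 and v_jv_{j+1} the arc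
from v_1 to v_j would still connect the ends of v_0v_1. -/
lemma IsCactus.gate_unique (hG : IsCactus G) {C : G.Subgraph} (hC : C ∈ cycles G) {v v' : V}
    (hv : v ∈ C.verts) (hv' : v' ∈ C.verts) (h : v' ∈ branch C v) : v = v' := by
  by_contra hne
  obtain ⟨p, hp⟩ := exists_labelling hC hv
  obtain ⟨j, hj, rfl⟩ := hp.exists_index hv'
  have hj0 : 0 < j := by
    rcases Nat.eq_zero_or_pos j with rfl | h0
    · simp at hne
    · exact h0
  have e0 := hp.edge_mem (i := 0) (by omega)
  have ej := hp.edge_mem hj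
  have hne' := hp.edge_ne hj0 hj
  rw [zero_add] at e0 hne'
  refine hG.not_reachable_deleteEdges_pair hC e0 ej hne' ?_
  rw [Walk.getVert_zero] at *
  have h1 : (G.deleteEdges {s(v, p.getVert 1), s(p.getVert j, p.getVert (j + 1))}).Reachable
      v (p.getVert j) := by
    refine Reachable.mono (deleteEdges_anti ?_) h
    rintro f (rfl | rfl)
    · exact e0
    · exact ej
  refine h1.trans (Reachable.symm ?_)
  have key : ∀ n, 1 + n ≤ j → (G.deleteEdges {s(v, p.getVert 1),
      s(p.getVert j, p.getVert (j + 1))}).Reachable (p.getVert 1) (p.getVert (1 + n)) := by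
    intro n
    induction n with
    | zero => intro; exact Reachable.refl _
    | succ n ih =>
      intro hle
      refine (ih (by omega)).trans (Adj.reachable ?_)
      rw [deleteEdges_adj]
      refine ⟨p.adj_getVert_succ (by omega), ?_⟩
      rintro (hf | hf)
      · refine hp.edge_ne (i := 0) (j := 1 + n) (by omega) (by omega) ?_
        rw [zero_add, Walk.getVert_zero]
        exact hf.symm
      · exact hp.edge_ne (i := 1 + n) (j := j) (by omega) (by omega) hf
  have := key (j - 1) (by omega)
  rwa [show 1 + (j - 1) = j by omega] at this

lemma self_mem_branch (C : G.Subgraph) (v : V) : v ∈ branch C v := Reachable.refl _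

lemma mem_branch_of_adj {C : G.Subgraph} {v a b : V} (ha : a ∈ branch C v) (hab : G.Adj a b)
    (he : s(a, b) ∉ C.edgeSet) : b ∈ branch C v :=
  Reachable.trans ha (Adj.reachable (by rw [deleteEdges_adj]; exact ⟨hab, he⟩))

lemma exists_gate (hG : G.Connected) {C : G.Subgraph} (hC : C ∈ cycles G) (w : V) :
    ∃ v ∈ C.verts, w ∈ branch C v := by
  obtain ⟨u, hu⟩ := exists_mem_verts hC
  by_contra hcon
  obtain ⟨a, ha, b, hb, hab, -⟩ := exists_exit_edge (H := G)
    (A := {w | ∃ v ∈ C.verts, w ∈ branch C v}) (hG.preconnected u w)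
    ⟨u, hu, self_mem_branch C u⟩ hcon
  obtain ⟨v, hv, hav⟩ := ha
  by_cases he : s(a, b) ∈ C.edgeSet
  · exact hb ⟨b, (mem_verts_of_edge_mem he).2, self_mem_branch C b⟩
  · exact hb ⟨v, hv, mem_branch_of_adj hav hab he⟩

lemma IsCactus.gate_eq (hG : IsCactus G) {C : G.Subgraph} (hC : C ∈ cycles G) {v v' w : V}
    (hv : v ∈ C.verts) (hv' : v' ∈ C.verts) (h : w ∈ branch C v) (h' : w ∈ branch C v') :
    v = v' :=
  hG.gate_unique hC hv hv' (Reachable.trans h (Reachable.symm h'))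

lemma IsCactus.eq_of_mem_branch (hG : IsCactus G) {C : G.Subgraph} (hC : C ∈ cycles G) {v w : V}
    (hv : v ∈ C.verts) (hw : w ∈ C.verts) (h : w ∈ branch C v) : w = v :=
  (hG.gate_unique hC hv hw h).symm

/-- Every edge leaving a branch starts at its root. -/
lemma IsCactus.branch_exit (hG : IsCactus G) {C : G.Subgraph} (hC : C ∈ cycles G) {v : V}
    (hv : v ∈ C.verts) : ∀ a ∈ branch C v, ∀ b ∉ branch C v, G.Adj a b → a = v := by
  intro a ha b hb hab
  have he : s(a, b) ∈ C.edgeSet := by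
    by_contra he
    exact hb (mem_branch_of_adj ha hab he)
  exact hG.eq_of_mem_branch hC hv (mem_verts_of_edge_mem he).1 ha

lemma IsCactus.dist_branch (hG : IsCactus G) {C : G.Subgraph} (hC : C ∈ cycles G) {v w y : V}
    (hv : v ∈ C.verts) (hw : w ∈ branch C v) (hy : y ∉ branch C v ∨ y = v) :
    G.dist w y = G.dist w v + G.dist v y :=
  dist_eq_of_exit hG.1 (fun a ha b hb hab => Or.inl (hG.branch_exit hC hv a ha b hb hab)) hw hy

lemma IsCactus.dist_gate (hG : IsCactus G) {C : G.Subgraph} (hC : C ∈ cycles G) {v w y : V}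
    (hv : v ∈ C.verts) (hw : w ∈ branch C v) (hy : y ∈ C.verts) :
    G.dist w y = G.dist w v + G.dist v y := by
  refine hG.dist_branch hC hv hw ?_
  by_cases h : y ∈ branch C v
  · exact Or.inr (hG.eq_of_mem_branch hC hv hy h)
  · exact Or.inl h

lemma IsCactus.dist_gates (hG : IsCactus G) {C : G.Subgraph} (hC : C ∈ cycles G) {v v' w y : V}
    (hv : v ∈ C.verts) (hv' : v' ∈ C.verts) (hw : w ∈ branch C v) (hy : y ∈ branch C v')
    (hne : v ≠ v') : G.dist w y = G.dist w v + G.dist v v' + G.dist v' y := by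
  rw [hG.dist_branch hC hv hw (Or.inl fun h => hne (hG.gate_eq hC hv hv' h hy)), dist_comm (u := v),
    hG.dist_gate hC hv' hy hv, dist_comm (u := y), dist_comm (u := v') (v := v)]
  omega

/-- No shortcut leaves the cycle: the cyclic distance from i to the index of the gate of w is a
function of w that changes by at most one along every edge, since edges off C preserve the gate. -/
lemma IsCactus.dist_getVert (hG : IsCactus G) {C : G.Subgraph} {u : V} {p : G.Walk u u}
    (hp : IsLabelling C p) {i j : ℕ} (hi : i < p.length) (hj : j < p.length) :
    G.dist (p.getVert i) (p.getVert j) = cycDist p.length i j := by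
  have hC := hp.mem_cycles
  apply le_antisymm (dist_getVert_le_cycDist hG.1 hi.le hj.le)
  have hex : ∀ w, ∃ n < p.length, w ∈ branch C (p.getVert n) := by
    intro w
    obtain ⟨v, hv, hw⟩ := exists_gate hG.1 hC w
    obtain ⟨n, hn, rfl⟩ := hp.exists_index hv
    exact ⟨n, hn, hw⟩
  choose idx hlt hidx using hex
  have huniq : ∀ n < p.length, ∀ w, w ∈ branch C (p.getVert n) → idx w = n := by
    intro n hn w hw
    exact hp.inj (hlt w) hn (hG.gate_eq hC (hp.getVert_mem _) (hp.getVert_mem _) (hidx w) hw)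
  have hself : ∀ n < p.length, idx (p.getVert n) = n := fun n hn =>
    huniq n hn _ (self_mem_branch _ _)
  -- The closing edge of the labelling returns to position 0, not to position `p.length`.
  have hl : idx (p.getVert p.length) = 0 := by
    have := hself 0 (by omega)
    rwa [Walk.getVert_zero, ← p.getVert_length] at this
  have := le_add_dist_of_lipschitz hG.1 (fun w => cycDist p.length i (idx w)) ?_
    (p.getVert i) (p.getVert j)
  · simp only [hself i hi, hself j hj] at this
    unfold cycDist at *
    omega
  · intro a b hab
    by_cases he : s(a, b) ∈ C.edgeSet
    · have key : ∀ n < p.length, cycDist p.length i (idx (p.getVert n)) ≤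
          cycDist p.length i (idx (p.getVert (n + 1))) + 1 ∧
          cycDist p.length i (idx (p.getVert (n + 1))) ≤
          cycDist p.length i (idx (p.getVert n)) + 1 := by
        intro n hn
        rw [hself n hn]
        rcases Nat.lt_or_ge (n + 1) p.length with h | h
        · rw [hself _ h]
          unfold cycDist
          omega
        · have : n + 1 = p.length := by omega
          rw [this, hl]
          unfold cycDist
          omega
      obtain ⟨n, hn, ⟨rfl, rfl⟩ | ⟨rfl, rfl⟩⟩ := hp.exists_of_edge_mem he
      · exact (key n hn).2
      · exact (key n hn).1
    · have : idx b = idx a := huniq _ (hlt a) _ (mem_branch_of_adj (hidx a) hab he)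
      rw [this]
      omega

end

/-! ### Degrees on cycles, pairs of cycles, threads -/

section

variable {V : Type*} {G : SimpleGraph V}

/-! ### Degrees and neighbours on cycles -/

section degree

variable [G.LocallyFinite]

lemma card_le_degree {x : V} (s : Finset V) (hs : ∀ a ∈ s, G.Adj x a) : s.card ≤ G.degree x := by
  rw [← card_neighborFinset_eq_degree]
  exact Finset.card_le_card fun a ha => by simpa using hs a ha

lemma degree_le_card {x : V} (s : Finset V) (hs : ∀ a, G.Adj x a → a ∈ s) :
    G.degree x ≤ s.card := by
  rw [← card_neighborFinset_eq_degree]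
  exact Finset.card_le_card fun a ha => hs a (by simpa using ha)

lemma three_le_degree {x a b c : V} (ha : G.Adj x a) (hb : G.Adj x b) (hc : G.Adj x c)
    (hab : a ≠ b) (hac : a ≠ c) (hbc : b ≠ c) : 3 ≤ G.degree x := by
  classical
  have h : ({a, b, c} : Finset V).card = 3 := Finset.card_eq_three.2 ⟨a, b, c, hab, hac, hbc, rfl⟩
  rw [← h]
  refine card_le_degree _ fun y hy => ?_
  simp only [Finset.mem_insert, Finset.mem_singleton] at hy
  rcases hy with rfl | rfl | rfl <;> assumption

lemma eq_or_eq_of_degree_le_two {x a b y : V} (hd : G.degree x ≤ 2) (ha : G.Adj x a)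
    (hb : G.Adj x b) (hab : a ≠ b) (hy : G.Adj x y) : y = a ∨ y = b := by
  by_contra! h
  have := three_le_degree ha hb hy hab h.1.symm h.2.symm
  omega

lemma eq_of_degree_eq_one {x a b : V} (hd : G.degree x = 1) (ha : G.Adj x a) (hb : G.Adj x b) :
    a = b := by
  classical
  by_contra h
  have := card_le_degree {a, b} (x := x) (G := G) (by
    intro y hy
    simp only [Finset.mem_insert, Finset.mem_singleton] at hy
    rcases hy with rfl | rfl <;> assumption)
  rw [Finset.card_pair h] at this
  omega

end degree

lemma exists_cycle_nbrs {C : G.Subgraph} (hC : C ∈ cycles G) {v : V} (hv : v ∈ C.verts) :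
    ∃ a b, a ≠ b ∧ s(v, a) ∈ C.edgeSet ∧ s(v, b) ∈ C.edgeSet ∧
      ∀ x, s(v, x) ∈ C.edgeSet → x = a ∨ x = b := by
  obtain ⟨p, hp⟩ := exists_labelling hC hv
  have h3 := hp.three_le
  have hl := p.getVert_length
  have h0 := p.getVert_zero
  refine ⟨p.getVert 1, p.getVert (p.length - 1), fun h => ?_, ?_, ?_, fun x hx => ?_⟩
  · have := hp.inj (by omega) (by omega) h
    omega
  · simpa using hp.edge_mem (i := 0) (by omega)
  · have := hp.edge_mem (i := p.length - 1) (by omega)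
    rwa [show p.length - 1 + 1 = p.length by omega, hl, Sym2.eq_swap] at this
  · obtain ⟨i, hi, ⟨h1, h2⟩ | ⟨h1, h2⟩⟩ := hp.exists_of_edge_mem hx
    · have : i = 0 := hp.inj hi (by omega) (by rw [h1, h0])
      subst this
      exact Or.inl h2.symm
    · rcases Nat.lt_or_ge (i + 1) p.length with h | h
      · have := hp.inj h (j := 0) (by omega) (by rw [h2, h0])
        omega
      · right
        rw [← h1]
        congr 1
        omega

lemma exists_labelling_of_edge {C : G.Subgraph} (hC : C ∈ cycles G) {v a : V}
    (h : s(v, a) ∈ C.edgeSet) : ∃ p : G.Walk v v, IsLabelling C p ∧ p.getVert 1 = a := by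
  obtain ⟨p, hp⟩ := exists_labelling hC (mem_verts_of_edge_mem h).1
  have h3 := hp.three_le
  have h0 := p.getVert_zero
  obtain ⟨i, hi, ⟨h1, h2⟩ | ⟨h1, h2⟩⟩ := hp.exists_of_edge_mem h
  · have : i = 0 := hp.inj hi (by omega) (by rw [h1, h0])
    subst this
    exact ⟨p, hp, h2⟩
  · refine ⟨p.reverse, hp.reverse, ?_⟩
    rw [Walk.getVert_reverse, ← h1]
    congr 1
    rcases Nat.lt_or_ge (i + 1) p.length with h | h
    · have := hp.inj h (j := 0) (by omega) (by rw [h2, h0])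
      omega
    · omega

/-! ### Two cycles -/

lemma IsCactus.edge_notMem (hG : IsCactus G) {C D : G.Subgraph} (hC : C ∈ cycles G)
    (hD : D ∈ cycles G) (hne : C ≠ D) {e : Sym2 V} (he : e ∈ D.edgeSet) : e ∉ C.edgeSet :=
  fun h => Set.disjoint_left.1 (hG.2 C hC D hD hne) h he

lemma IsCactus.cycle_subset_branch (hG : IsCactus G) {C D : G.Subgraph} (hC : C ∈ cycles G)
    (hD : D ∈ cycles G) (hne : C ≠ D) {v w : V} (hw : w ∈ D.verts) (hwv : w ∈ branch C v) :
    D.verts ⊆ branch C v := by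
  obtain ⟨p, hp⟩ := exists_labelling hD hw
  have key : ∀ i, i ≤ p.length → p.getVert i ∈ branch C v := by
    intro i
    induction i with
    | zero => intro; simpa using hwv
    | succ i ih =>
      intro hi
      exact mem_branch_of_adj (ih (by omega)) (p.adj_getVert_succ (by omega))
        (hG.edge_notMem hC hD hne (hp.edge_mem (by omega)))
  intro x hx
  obtain ⟨i, hi, rfl⟩ := hp.exists_index hx
  exact key i hi.le

lemma exists_ne_cycle (hc : 2 ≤ numCycles G) (C : G.Subgraph) : ∃ D ∈ cycles G, C ≠ D := by
  by_contra! h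
  have : (cycles G).ncard ≤ ({C} : Set G.Subgraph).ncard :=
    Set.ncard_le_ncard (fun D hD => (h D hD).symm) (Set.finite_singleton C)
  rw [Set.ncard_singleton] at this
  unfold numCycles at hc
  omega

section active

variable [G.LocallyFinite]

lemma IsCactus.four_le_degree (hG : IsCactus G) {C D : G.Subgraph} (hC : C ∈ cycles G)
    (hD : D ∈ cycles G) (hne : C ≠ D) {v : V} (hvC : v ∈ C.verts) (hvD : v ∈ D.verts) :
    4 ≤ G.degree v := by
  classical
  obtain ⟨a, b, hab, ha, hb, -⟩ := exists_cycle_nbrs hC hvC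
  obtain ⟨c, d, hcd, hc, hd, -⟩ := exists_cycle_nbrs hD hvD
  have hx : ∀ x y, s(v, x) ∈ C.edgeSet → s(v, y) ∈ D.edgeSet → x ≠ y := by
    rintro x y hx hy rfl
    exact hG.edge_notMem hC hD hne hy hx
  have h4 : ({a, b, c, d} : Finset V).card = 4 := by
    rw [Finset.card_insert_of_notMem, Finset.card_insert_of_notMem, Finset.card_pair hcd]
    · simp [hx b c hb hc, hx b d hb hd]
    · simp [hab, hx a c ha hc, hx a d ha hd]
  rw [← h4]
  refine card_le_degree _ fun y hy => ?_
  simp only [Finset.mem_insert, Finset.mem_singleton] at hy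
  rcases hy with rfl | rfl | rfl | rfl
  exacts [C.adj_sub ha, C.adj_sub hb, D.adj_sub hc, D.adj_sub hd]

lemma IsCactus.isBranchActive_of_mem_two (hG : IsCactus G) {C D : G.Subgraph} (hC : C ∈ cycles G)
    (hD : D ∈ cycles G) (hne : C ≠ D) {v : V} (hvC : v ∈ C.verts) (hvD : v ∈ D.verts) :
    IsBranchActive C v :=
  ⟨hvC, Or.inl (hG.four_le_degree hC hD hne hvC hvD)⟩

/-- If v is off D, a path from D to v leaves D at a vertex with two neighbours on D and one outside,
hence of degree at least three. -/
lemma IsCactus.isBranchActive_of_cycle_subset (hG : IsCactus G) {C D : G.Subgraph}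
    (hC : C ∈ cycles G) (hD : D ∈ cycles G) (hne : C ≠ D) {v : V} (hv : v ∈ C.verts)
    (hDv : D.verts ⊆ branch C v) : IsBranchActive C v := by
  by_cases hvD : v ∈ D.verts
  · exact hG.isBranchActive_of_mem_two hC hD hne hv hvD
  refine ⟨hv, Or.inr ?_⟩
  obtain ⟨w, hw⟩ := exists_mem_verts hD
  obtain ⟨a, ha, b, hb, hab, hra⟩ := exists_exit_edge (A := (D.verts)ᶜ) (hDv hw) hvD
    (fun h => h hw)
  rw [Set.mem_compl_iff, not_not] at hb
  have hab' := deleteEdges_le (s := C.edgeSet) (G := G) hab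
  obtain ⟨c, d, hcd, hc, hd, -⟩ := exists_cycle_nbrs hD hb
  refine ⟨b, hDv hb, fun h => hvD (h ▸ hb), ?_⟩
  refine three_le_degree (D.adj_sub hc) (D.adj_sub hd) hab'.symm hcd ?_ ?_
  · rintro rfl
    exact ha (mem_verts_of_edge_mem hc).2
  · rintro rfl
    exact ha (mem_verts_of_edge_mem hd).2

lemma IsCactus.exists_branch_of_ne (hG : IsCactus G) {C D : G.Subgraph}
    (hC : C ∈ cycles G) (hD : D ∈ cycles G) (hne : C ≠ D) :
    ∃ v ∈ C.verts, D.verts ⊆ branch C v ∧ IsBranchActive C v := by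
  obtain ⟨w, hw⟩ := exists_mem_verts hD
  obtain ⟨v, hv, hwv⟩ := exists_gate hG.1 hC w
  have := hG.cycle_subset_branch hC hD hne hw hwv
  exact ⟨v, hv, this, hG.isBranchActive_of_cycle_subset hC hD hne hv this⟩

lemma IsCactus.exists_branchActive (hG : IsCactus G) (hc : 2 ≤ numCycles G) {C : G.Subgraph}
    (hC : C ∈ cycles G) : ∃ v, IsBranchActive C v := by
  obtain ⟨D, hD, hne⟩ := exists_ne_cycle hc C
  obtain ⟨v, -, -, h⟩ := hG.exists_branch_of_ne hC hD hne
  exact ⟨v, h⟩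

end active

/-! ### Pendant paths and threads -/

lemma ncard_support {u a : V} {p : G.Walk u a} (hp : p.IsPath) :
    {x | x ∈ p.support}.ncard = p.length + 1 := by
  classical
  have : {x | x ∈ p.support} = (p.support.toFinset : Set V) := by ext; simp
  rw [this, Set.ncard_coe_finset, List.toFinset_card_of_nodup hp.support_nodup, Walk.length_support]

section threads

variable [G.LocallyFinite]

/-- `T` is the vertex set of a path from a leaf to `a`, all of whose other vertices have degree
two, and `a` is adjacent to `c`. -/
def IsPendantPath (G : SimpleGraph V) [G.LocallyFinite] (a c : V) (T : Set V) : Prop :=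
  ∃ (u : V) (p : G.Walk u a), p.IsPath ∧ G.degree u = 1 ∧
    (∀ x ∈ p.support, x ≠ u → G.degree x = 2) ∧ G.Adj a c ∧ T = {x | x ∈ p.support}

lemma IsPendantPath.isThread {a c : V} {T : Set V} (h : IsPendantPath G a c T)
    (hc : 3 ≤ G.degree c) : IsThread G c T := by
  obtain ⟨u, p, h1, h2, h3, h4, h5⟩ := h
  exact ⟨hc, u, a, p, h1, h2, h3, h4, h5⟩

lemma IsThread.exists_isPendantPath {v : V} {T : Set V} (h : IsThread G v T) :
    ∃ a, IsPendantPath G a v T := by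
  obtain ⟨-, u, a, p, h⟩ := h
  exact ⟨a, u, p, h⟩

lemma IsPendantPath.degree_le {a c x : V} {T : Set V} (h : IsPendantPath G a c T) (hx : x ∈ T) :
    G.degree x ≤ 2 := by
  obtain ⟨u, p, h1, h2, h3, h4, rfl⟩ := h
  by_cases hxu : x = u
  · rw [hxu, h2]
    omega
  · exact (h3 x hx hxu).le

lemma IsPendantPath.adj {a c : V} {T : Set V} (h : IsPendantPath G a c T) : G.Adj a c := by
  obtain ⟨u, p, h1, h2, h3, h4, rfl⟩ := h
  exact h4

lemma IsPendantPath.mem {a c : V} {T : Set V} (h : IsPendantPath G a c T) : a ∈ T := by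
  obtain ⟨u, p, h1, h2, h3, h4, rfl⟩ := h
  exact p.end_mem_support

/-- The degree conditions leave no room for neighbours other than the predecessor, the successor
and, at the last vertex, c. -/
lemma pendant_nbr {u a c : V} {p : G.Walk u a} (hp : p.IsPath) (hu : G.degree u = 1)
    (hd : ∀ x ∈ p.support, x ≠ u → G.degree x = 2) (hac : G.Adj a c) (hc : c ∉ p.support) {i : ℕ}
    (hi : i ≤ p.length) {y : V} (hy : G.Adj (p.getVert i) y) :
    (i < p.length ∧ y = p.getVert (i + 1)) ∨ (0 < i ∧ y = p.getVert (i - 1)) ∨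
      (i = p.length ∧ y = c) := by
  have hdeg : 0 < i → G.degree (p.getVert i) ≤ 2 := by
    intro h0
    refine (hd _ (p.getVert_mem_support i) fun h => ?_).le
    have := hp.getVert_injOn (show i ≤ p.length from hi) (show 0 ≤ p.length by omega)
      (by rw [h, Walk.getVert_zero])
    omega
  have hnext : ∃ z, G.Adj (p.getVert i) z ∧
      (i < p.length ∧ z = p.getVert (i + 1) ∨ i = p.length ∧ z = c) := by
    rcases hi.lt_or_eq with h | h
    · exact ⟨_, p.adj_getVert_succ h, Or.inl ⟨h, rfl⟩⟩
    · refine ⟨c, ?_, Or.inr ⟨h, rfl⟩⟩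
      rw [h, Walk.getVert_length]
      exact hac
  obtain ⟨z, hz, hz'⟩ := hnext
  rcases Nat.eq_zero_or_pos i with rfl | h0
  · rw [Walk.getVert_zero] at hz hy
    obtain rfl := eq_of_degree_eq_one hu hz hy
    tauto
  · have hprev : G.Adj (p.getVert i) (p.getVert (i - 1)) := by
      have := p.adj_getVert_succ (i := i - 1) (by omega)
      rw [show i - 1 + 1 = i by omega] at this
      exact this.symm
    have hne : z ≠ p.getVert (i - 1) := by
      rintro rfl
      rcases hz' with ⟨h, h'⟩ | ⟨h, h'⟩
      · have := hp.getVert_injOn (show i - 1 ≤ p.length by omega) (show i + 1 ≤ p.length by omega) h'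
        omega
      · exact hc (h' ▸ p.getVert_mem_support _)
    rcases eq_or_eq_of_degree_le_two (hdeg h0) hz hprev hne hy with rfl | rfl <;> tauto

lemma IsPendantPath.closed {a c : V} {T : Set V} (h : IsPendantPath G a c T) (hc : c ∉ T) {x y : V}
    (hx : x ∈ T) (hxy : G.Adj x y) : y ∈ T ∨ y = c := by
  obtain ⟨u, p, h1, h2, h3, h4, rfl⟩ := h
  obtain ⟨i, rfl, hi⟩ := Walk.mem_support_iff_exists_getVert.1 (show x ∈ p.support from hx)
  rcases pendant_nbr h1 h2 h3 h4 hc hi hxy with ⟨-, rfl⟩ | ⟨-, rfl⟩ | ⟨-, rfl⟩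
  · exact Or.inl (p.getVert_mem_support _)
  · exact Or.inl (p.getVert_mem_support _)
  · exact Or.inr rfl

lemma IsPendantPath.eq_of_adj {a c : V} {T : Set V} (h : IsPendantPath G a c T) (hc : c ∉ T) {x : V}
    (hx : x ∈ T) (hxc : G.Adj x c) : x = a := by
  obtain ⟨u, p, h1, h2, h3, h4, rfl⟩ := h
  obtain ⟨i, rfl, hi⟩ := Walk.mem_support_iff_exists_getVert.1 (show x ∈ p.support from hx)
  rcases pendant_nbr h1 h2 h3 h4 hc hi hxc with ⟨-, h⟩ | ⟨-, h⟩ | ⟨rfl, -⟩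
  · exact absurd (h ▸ p.getVert_mem_support _) hc
  · exact absurd (h ▸ p.getVert_mem_support _) hc
  · exact p.getVert_length

/-- No vertex of a pendant path lies on a cycle. -/
lemma IsPendantPath.notMem_cycle {a c : V} {T : Set V} (h : IsPendantPath G a c T) {C : G.Subgraph}
    (hC : C ∈ cycles G) {x : V} (hx : x ∈ T) : x ∉ C.verts := by
  obtain ⟨u, p, h1, h2, h3, h4, rfl⟩ := h
  obtain ⟨i, rfl, hi⟩ := Walk.mem_support_iff_exists_getVert.1 (show x ∈ p.support from hx)
  clear hx
  induction i with
  | zero =>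
    intro hv
    rw [Walk.getVert_zero] at hv
    obtain ⟨b, d, hbd, hb, hd, -⟩ := exists_cycle_nbrs hC hv
    exact hbd (eq_of_degree_eq_one h2 (C.adj_sub hb) (C.adj_sub hd))
  | succ i ih =>
    intro hv
    obtain ⟨b, d, hbd, hb, hd, -⟩ := exists_cycle_nbrs hC hv
    have hdeg : G.degree (p.getVert (i + 1)) ≤ 2 := by
      refine (h3 _ (p.getVert_mem_support _) fun h => ?_).le
      have := h1.getVert_injOn (show i + 1 ≤ p.length from hi) (show 0 ≤ p.length by omega)
        (by rw [h, Walk.getVert_zero])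
      omega
    refine ih (by omega) ?_
    rcases eq_or_eq_of_degree_le_two hdeg (C.adj_sub hb) (C.adj_sub hd) hbd
      (p.adj_getVert_succ (by omega)).symm with h | h <;> rw [h]
    exacts [(mem_verts_of_edge_mem hb).2, (mem_verts_of_edge_mem hd).2]

/-- A set closed under adjacency, apart from a vertex of degree at least three, contains every
pendant path that it meets. -/
lemma IsPendantPath.subset_of_closed {a c : V} {T A : Set V} (h : IsPendantPath G a c T)
    (hA : ∀ x ∈ A, ∀ y, G.Adj x y → y ∈ A ∨ 3 ≤ G.degree y) {t : V} (ht : t ∈ T) (htA : t ∈ A) :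
    T ⊆ A := by
  have hdeg := fun x (hx : x ∈ T) => h.degree_le hx
  obtain ⟨u, p, h1, h2, h3, h4, rfl⟩ := h
  obtain ⟨j, rfl, hj⟩ := Walk.mem_support_iff_exists_getVert.1 (show t ∈ p.support from ht)
  have step : ∀ x y, x ∈ A → G.Adj x y → y ∈ p.support → y ∈ A := by
    intro x y hx hxy hy
    rcases hA x hx y hxy with h | h
    · exact h
    · have := hdeg y hy
      omega
  have up : ∀ n, j + n ≤ p.length → p.getVert (j + n) ∈ A := by
    intro n
    induction n with
    | zero => intro; exact htA
    | succ n ih =>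
      intro hn
      exact step _ _ (ih (by omega)) (p.adj_getVert_succ (by omega)) (p.getVert_mem_support _)
  have down : ∀ n, n ≤ j → p.getVert (j - n) ∈ A := by
    intro n
    induction n with
    | zero => intro; exact htA
    | succ n ih =>
      intro hn
      refine step _ _ (ih (by omega)) ?_ (p.getVert_mem_support _)
      have := p.adj_getVert_succ (i := j - (n + 1)) (by omega)
      rw [show j - (n + 1) + 1 = j - n by omega] at this
      exact this.symm
  intro x hx
  obtain ⟨i, rfl, hi⟩ := Walk.mem_support_iff_exists_getVert.1 (show x ∈ p.support from hx)
  rcases le_total j i with h | h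
  · have := up (i - j) (by omega)
    rwa [show j + (i - j) = i by omega] at this
  · have := down (j - i) (by omega)
    rwa [show j - (j - i) = i by omega] at this

lemma IsThread.degree_le {v x : V} {T : Set V} (h : IsThread G v T) (hx : x ∈ T) :
    G.degree x ≤ 2 := by
  obtain ⟨a, ha⟩ := h.exists_isPendantPath
  exact ha.degree_le hx

lemma IsThread.notMem {v : V} {T : Set V} (h : IsThread G v T) : v ∉ T := by
  intro hv
  have := h.degree_le hv
  have := h.1
  omega

lemma IsThread.nonempty {v : V} {T : Set V} (h : IsThread G v T) : T.Nonempty := by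
  obtain ⟨a, ha⟩ := h.exists_isPendantPath
  exact ⟨a, ha.mem⟩

lemma IsThread.closed {v x y : V} {T : Set V} (h : IsThread G v T) (hx : x ∈ T)
    (hxy : G.Adj x y) : y ∈ T ∨ y = v := by
  obtain ⟨a, ha⟩ := h.exists_isPendantPath
  exact ha.closed h.notMem hx hxy

lemma IsThread.notMem_cycle {v x : V} {T : Set V} (h : IsThread G v T) {C : G.Subgraph}
    (hC : C ∈ cycles G) (hx : x ∈ T) : x ∉ C.verts := by
  obtain ⟨a, ha⟩ := h.exists_isPendantPath
  exact ha.notMem_cycle hC hx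

lemma IsThread.subset {v v' t : V} {T T' : Set V} (h : IsThread G v T) (h' : IsThread G v' T')
    (ht : t ∈ T) (ht' : t ∈ T') : T ⊆ T' := by
  obtain ⟨a, ha⟩ := h.exists_isPendantPath
  refine ha.subset_of_closed (fun x hx y hxy => ?_) ht ht'
  rcases h'.closed hx hxy with h1 | rfl
  exacts [Or.inl h1, Or.inr h'.1]

/-- Distinct threads are disjoint. -/
lemma IsThread.eq_of_mem {v v' t : V} {T T' : Set V} (h : IsThread G v T) (h' : IsThread G v' T')
    (ht : t ∈ T) (ht' : t ∈ T') : T = T' ∧ v = v' := by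
  have hT : T = T' := (h.subset h' ht ht').antisymm (h'.subset h ht' ht)
  refine ⟨hT, ?_⟩
  obtain ⟨a, ha⟩ := h.exists_isPendantPath
  rcases h'.closed (hT ▸ ha.mem) ha.adj with h1 | h1
  · exact absurd (hT ▸ h1) h.notMem
  · exact h1

lemma IsThread.dist_eq (hG : G.Connected) {v s t : V} {T : Set V} (h : IsThread G v T)
    (hs : s ∉ T) (ht : t ∈ T) : G.dist s t = G.dist s v + G.dist v t := by
  have : G.dist t s = G.dist t v + G.dist v s := by
    refine dist_eq_of_exit hG (A := T) (v := v) ?_ ht (Or.inl hs)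
    intro a ha b hb hab
    exact Or.inr ((h.closed ha hab).resolve_left hb)
  rw [dist_comm (u := s) (v := t), this, dist_comm (u := t), dist_comm (u := v) (v := s), add_comm]

lemma IsThread.exists_adj {v : V} {T : Set V} (h : IsThread G v T) : ∃ a ∈ T, G.Adj v a := by
  obtain ⟨a, ha⟩ := h.exists_isPendantPath
  exact ⟨a, ha.mem, ha.adj.symm⟩

/-- A thread has a vertex at each distance from `1` to its length. -/
lemma IsThread.exists_dist_eq (hG : G.Connected) {v : V} {T : Set V} (h : IsThread G v T) {n : ℕ}
    (h1 : 1 ≤ n) (hn : n ≤ T.ncard) : ∃ t ∈ T, G.dist v t = n := by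
  classical
  have hv := h.notMem
  obtain ⟨-, u, a, p, hp, hu, hd, hac, rfl⟩ := h
  rw [ncard_support hp] at hn
  refine ⟨p.getVert (p.length + 1 - n), p.getVert_mem_support _, le_antisymm ?_ ?_⟩
  · have key : ∀ m, m ≤ p.length → G.dist v (p.getVert (p.length - m)) ≤ m + 1 := by
      intro m
      induction m with
      | zero =>
        intro
        rw [Nat.sub_zero, Walk.getVert_length, dist_eq_one_iff_adj.2 hac.symm]
      | succ m ih =>
        intro hm
        have := p.adj_getVert_succ (i := p.length - (m + 1)) (by omega)
        rw [show p.length - (m + 1) + 1 = p.length - m by omega] at this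
        have h2 := dist_eq_one_iff_adj.2 this.symm
        have h3 := hG.dist_triangle (u := v) (v := p.getVert (p.length - m))
          (w := p.getVert (p.length - (m + 1)))
        have := ih (by omega)
        omega
    have := key (n - 1) (by omega)
    rw [show p.length - (n - 1) = p.length + 1 - n by omega] at this
    omega
  -- The depth in the thread, extended by 0 to the rest of the graph, changes by at most one along
  -- edges and so bounds the distance from v from below.
  · have hex : ∀ y, ∃ m : ℕ, (y ∉ p.support ∧ m = 0) ∨
        ∃ i ≤ p.length, p.getVert i = y ∧ m = p.length + 1 - i := by
      intro y
      by_cases hy : y ∈ p.support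
      · obtain ⟨i, rfl, hi⟩ := Walk.mem_support_iff_exists_getVert.1 hy
        exact ⟨_, Or.inr ⟨i, hi, rfl, rfl⟩⟩
      · exact ⟨0, Or.inl ⟨hy, rfl⟩⟩
    choose f hf using hex
    have hfi : ∀ i ≤ p.length, f (p.getVert i) = p.length + 1 - i := by
      intro i hi
      rcases hf (p.getVert i) with ⟨h, -⟩ | ⟨j, hj, hij, h⟩
      · exact absurd (p.getVert_mem_support i) h
      · rw [h, hp.getVert_injOn hj hi hij]
    have hfv : f v = 0 := by
      rcases hf v with ⟨-, h⟩ | ⟨j, hj, hij, h⟩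
      · exact h
      · exact absurd (show v ∈ p.support from hij ▸ p.getVert_mem_support _) hv
    have := le_add_dist_of_lipschitz hG f ?_ v (p.getVert (p.length + 1 - n))
    · rw [hfv, hfi _ (by omega)] at this
      omega
    · intro x y hxy
      rcases hf y with ⟨-, h⟩ | ⟨j, hj, rfl, h⟩
      · omega
      · rcases pendant_nbr hp hu hd hac hv hj hxy.symm with ⟨hlt, rfl⟩ | ⟨hlt, rfl⟩ | ⟨rfl, rfl⟩
        · rw [h, hfi _ (by omega)]
          omega
        · rw [h, hfi _ (by omega)]
          omega
        · rw [h]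
          omega

lemma IsThread.dist_le_ncard (hG : G.Connected) {v : V} {T : Set V} (h : IsThread G v T) {t : V}
    (ht : t ∈ T) : G.dist v t ≤ T.ncard := by
  obtain ⟨-, u, a, p, hp, hu, hd, hac, rfl⟩ := h
  classical
  rw [ncard_support hp]
  have := p.length_dropUntil_le_length ht
  have h1 := dist_le (p.dropUntil t ht)
  have h2 := hG.dist_triangle (u := v) (v := a) (w := t)
  rw [dist_eq_one_iff_adj.2 hac.symm, dist_comm (u := a)] at h2
  omega

lemma IsThread.subset_branch {v : V} {T : Set V} (h : IsThread G v T) {C : G.Subgraph}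
    (hC : C ∈ cycles G) : T ⊆ branch C v := by
  obtain ⟨a, ha⟩ := h.exists_isPendantPath
  have hav : a ∈ branch C v := mem_branch_of_adj (self_mem_branch C v) ha.adj.symm
    fun he => ha.notMem_cycle hC ha.mem (mem_verts_of_edge_mem he).2
  have hle : T ⊆ T ∩ branch C v := by
    refine ha.subset_of_closed ?_ ha.mem ⟨ha.mem, hav⟩
    rintro x ⟨hx, hx'⟩ y hxy
    rcases h.closed hx hxy with hy | rfl
    · exact Or.inl ⟨hy, mem_branch_of_adj hx' hxy
        fun he => ha.notMem_cycle hC hx (mem_verts_of_edge_mem he).1⟩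
    · exact Or.inr h.1
  exact fun x hx => (hle hx).2

end threads

end

/-! ### Peripheries, and the reduction of BBR sets to local conditions -/

section

variable {V : Type*} {G : SimpleGraph V} [G.LocallyFinite]

/-! ### The periphery of a cycle -/

/-- The union of the branches of the vertices of `C` that are not branch-active. -/
def periphery (C : G.Subgraph) : Set V :=
  {w | ∃ u ∈ C.verts, ¬ IsBranchActive C u ∧ w ∈ branch C u}

/-- Each cycle lies in a branch of the other whose root is branch-active. With y in the inactive
branches at u on C and at w on D, w is outside the branch at u, so the connection from y to w
avoiding E(D) passes through u. Then u lies in the branch at w, which must be the active one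
containing C. -/
lemma IsCactus.periphery_disjoint (hG : IsCactus G) {C D : G.Subgraph} (hC : C ∈ cycles G)
    (hD : D ∈ cycles G) (hne : C ≠ D) {y : V} (hyC : y ∈ periphery C) (hyD : y ∈ periphery D) :
    False := by
  obtain ⟨u, hu, hua, hyu⟩ := hyC
  obtain ⟨w, hw, hwa, hyw⟩ := hyD
  obtain ⟨u₀, hu₀, hDu, hu₀a⟩ := hG.exists_branch_of_ne hC hD hne
  obtain ⟨w₀, hw₀, hCw, hw₀a⟩ := hG.exists_branch_of_ne hD hC hne.symm
  have h1 : w ∉ branch C u := by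
    intro h
    have := hG.gate_eq hC hu hu₀ h (hDu hw)
    exact hua (this ▸ hu₀a)
  have h2 := reachable_of_exit (H := G.deleteEdges D.edgeSet) (A := branch C u) (v := u)
    (fun a ha b hb hab => Or.inl (hG.branch_exit hC hu a ha b hb (deleteEdges_le _ hab)))
    hyu h1 (Reachable.symm hyw)
  have h3 : w = w₀ := hG.gate_eq hD hw hw₀ (Reachable.trans hyw h2.1) (hCw hu)
  exact hwa (h3 ▸ hw₀a)

/-- The thread is attached to a vertex of degree at least three; were it another vertex of the
branch, u would be branch-active. -/
lemma IsThread.eq_of_mem_branch {v t u : V} {T : Set V} (h : IsThread G v T) {C : G.Subgraph}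
    (hC : C ∈ cycles G) (ht : t ∈ T) (hu : u ∈ C.verts) (hua : ¬ IsBranchActive C u)
    (htu : t ∈ branch C u) : u = v := by
  have huT : u ∉ T := fun h' => h.notMem_cycle hC h' hu
  have h2 := reachable_of_exit (H := G.deleteEdges C.edgeSet) (A := T) (v := v)
    (fun a ha b hb hab => Or.inr ((h.closed ha (deleteEdges_le _ hab)).resolve_left hb))
    ht huT (Reachable.symm htu)
  by_contra hne
  exact hua ⟨hu, Or.inr ⟨v, Reachable.symm h2.2, Ne.symm hne, h.1⟩⟩

lemma IsThread.of_mem_periphery {v t : V} {T : Set V} (h : IsThread G v T) {C : G.Subgraph}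
    (hC : C ∈ cycles G) (ht : t ∈ T) (htC : t ∈ periphery C) :
    v ∈ C.verts ∧ ¬ IsBranchActive C v := by
  obtain ⟨u, hu, hua, htu⟩ := htC
  rw [← h.eq_of_mem_branch hC ht hu hua htu]
  exact ⟨hu, hua⟩

/-- Otherwise v would be a vertex of C that is not branch-active, but two threads and two cycle
edges give it degree at least four. This keeps the two tasks of a BBR set independent. -/
lemma IsThread.notMem_periphery {v t : V} {T T' : Set V} (h : IsThread G v T)
    (h' : IsThread G v T') (hne : T ≠ T') {C : G.Subgraph} (hC : C ∈ cycles G) (ht : t ∈ T) :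
    t ∉ periphery C := by
  classical
  intro htC
  obtain ⟨hv, hva⟩ := h.of_mem_periphery hC ht htC
  obtain ⟨a, haT, hva'⟩ := h.exists_adj
  obtain ⟨b, hbT, hvb⟩ := h'.exists_adj
  obtain ⟨c, d, hcd, hc, hd, -⟩ := exists_cycle_nbrs hC hv
  have hab : a ≠ b := by
    rintro rfl
    exact hne (h.eq_of_mem h' haT hbT).1
  have hcC := (mem_verts_of_edge_mem hc).2
  have hdC := (mem_verts_of_edge_mem hd).2
  have haC := h.notMem_cycle hC haT
  have hbC := h'.notMem_cycle hC hbT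
  have hac : a ≠ c := fun h => haC (h ▸ hcC)
  have had : a ≠ d := fun h => haC (h ▸ hdC)
  have hbc : b ≠ c := fun h => hbC (h ▸ hcC)
  have hbd : b ≠ d := fun h => hbC (h ▸ hdC)
  have h4 : ({a, b, c, d} : Finset V).card = 4 := by
    rw [Finset.card_insert_of_notMem, Finset.card_insert_of_notMem, Finset.card_pair hcd]
    · simp [hbc, hbd]
    · simp [hab, hac, had]
  refine hva ⟨hv, Or.inl ?_⟩
  rw [← h4]
  refine card_le_degree _ fun y hy => ?_
  simp only [Finset.mem_insert, Finset.mem_singleton] at hy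
  rcases hy with rfl | rfl | rfl | rfl
  exacts [hva', hvb, C.adj_sub hc, C.adj_sub hd]

/-! ### A local description of biactive branch-resolving sets -/

/-- A branch-resolving set meeting the periphery of every end-cycle. -/
def IsLocallyBBR (G : SimpleGraph V) [G.LocallyFinite] (S : Finset V) : Prop :=
  (∀ C : G.Subgraph, IsEndCycle C → ∃ s ∈ S, s ∈ periphery C) ∧ IsBranchResolving G S

lemma IsBranchResolving.pendant_unique {S : Finset V} (hS : IsBranchResolving G S) {c a b : V}
    {T T' : Set V} (hc : 3 ≤ G.degree c) (h : IsPendantPath G a c T) (h' : IsPendantPath G b c T')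
    (hT : ∀ s ∈ S, s ∉ T) (hT' : ∀ s ∈ S, s ∉ T') : a = b := by
  have ht := h.isThread hc
  have hTT : T = T' := hS c T T' ⟨ht, hT⟩ ⟨h'.isThread hc, hT'⟩
  subst hTT
  exact h'.eq_of_adj ht.notMem h.mem h.adj

/-- Branch-resolution permits only one S-free pendant path at v, so the branch is v alone or v with
one thread. -/
lemma not_isBranchActive_of_pendant {S : Finset V} (hS : IsBranchResolving G S) {C : G.Subgraph}
    (hC : C ∈ cycles G) {v : V} (hv : v ∈ C.verts)
    (hp : ∀ a ∈ branch C v, G.Adj v a → ∃ T, T ⊆ branch C v \ {v} ∧ IsPendantPath G a v T)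
    (hfree : ∀ s ∈ S, s ∈ branch C v → s = v) : ¬ IsBranchActive C v := by
  classical
  obtain ⟨a, b, hab, ha, hb, honly⟩ := exists_cycle_nbrs hC hv
  by_cases hoff : ∃ d, G.Adj v d ∧ s(v, d) ∉ C.edgeSet
  · obtain ⟨d, hvd, hd⟩ := hoff
    have hdb : d ∈ branch C v := mem_branch_of_adj (self_mem_branch C v) hvd hd
    obtain ⟨T, hT, hpd⟩ := hp d hdb hvd
    have hda : d ≠ a := by rintro rfl; exact hd ha
    have hdb' : d ≠ b := by rintro rfl; exact hd hb
    have h3 : 3 ≤ G.degree v :=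
      three_le_degree (C.adj_sub ha) (C.adj_sub hb) hvd hab hda.symm hdb'.symm
    have hvT : v ∉ T := fun h => (hT h).2 rfl
    have huniq : ∀ x, G.Adj v x → s(v, x) ∉ C.edgeSet → x = d := by
      intro x hvx hx
      have hxb : x ∈ branch C v := mem_branch_of_adj (self_mem_branch C v) hvx hx
      obtain ⟨T', hT', hpx⟩ := hp x hxb hvx
      exact hS.pendant_unique h3 hpx hpd (fun s hs h => (hT' h).2 (hfree s hs (hT' h).1))
        (fun s hs h => (hT h).2 (hfree s hs (hT h).1))
    rintro ⟨-, h4 | ⟨w, hw, hwv, hw3⟩⟩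
    · have : G.degree v ≤ ({a, b, d} : Finset V).card := by
        refine degree_le_card _ fun x hx => ?_
        by_cases hxe : s(v, x) ∈ C.edgeSet
        · rcases honly x hxe with rfl | rfl <;> simp
        · simp [huniq x hx hxe]
      have := Finset.card_le_three (a := a) (b := b) (c := d)
      omega
    · have : w ∈ insert v T := by
        refine mem_of_reachable_of_closed (H := G.deleteEdges C.edgeSet) ?_ hw
          (Set.mem_insert v T)
        rintro x (rfl | hx) y hxy
        · rw [deleteEdges_adj] at hxy
          rw [huniq y hxy.1 hxy.2]
          exact Or.inr hpd.mem
        · rcases hpd.closed hvT hx (deleteEdges_le _ hxy) with h | rfl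
          exacts [Or.inr h, Or.inl rfl]
      have := hpd.degree_le (this.resolve_left hwv)
      omega
  · push Not at hoff
    rintro ⟨-, h4 | ⟨w, hw, hwv, hw3⟩⟩
    · have : G.degree v ≤ ({a, b} : Finset V).card := by
        refine degree_le_card _ fun x hx => ?_
        rcases honly x (hoff x hx) with rfl | rfl <;> simp
      have := Finset.card_le_two (a := a) (b := b)
      omega
    · have : w ∈ ({v} : Set V) := by
        refine mem_of_reachable_of_closed (H := G.deleteEdges C.edgeSet) ?_ hw rfl
        rintro x rfl y hxy
        rw [deleteEdges_adj] at hxy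
        exact absurd (hoff y hxy.1) hxy.2
      exact hwv this

/-- Let `X` be a set that can only be left through `r`. If `X` contains no vertex of `S` other than
`r`, then every neighbour of `r` in `X` is the end of a pendant path in `X`. -/
theorem IsCactus.exists_pendantPath [Finite V] (hG : IsCactus G) (hc : 2 ≤ numCycles G)
    {S : Finset V} (hS : IsLocallyBBR G S) (n : ℕ) : ∀ (X : Set V) (r : V), X.ncard = n → r ∈ X →
    (∀ y ∈ X, y ≠ r → ∀ z, G.Adj y z → z ∈ X) → (∀ s ∈ S, s ∈ X → s = r) →
    ∀ a ∈ X, G.Adj r a → ∃ T, T ⊆ X \ {r} ∧ IsPendantPath G a r T := by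
  classical
  induction n using Nat.strong_induction_on with
  | _ n ih =>
  intro X r hn hr hX hXS a ha hra
  by_cases hcyc : ∃ D ∈ cycles G, s(r, a) ∈ D.edgeSet
  -- Then D lies in X, and the branches at its vertices other than r lie in X without r. By
  -- induction they are at most single threads, so r is the only branch-active vertex: D is an
  -- end-cycle whose periphery misses S.
  · exfalso
    obtain ⟨D, hD, hraD⟩ := hcyc
    have hrD := (mem_verts_of_edge_mem hraD).1
    obtain ⟨p, hp, hp1⟩ := exists_labelling_of_edge hD hraD
    have h3 := hp.three_le
    have hpX : ∀ i, 1 + i < p.length → p.getVert (1 + i) ∈ X := by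
      intro i
      induction i with
      | zero => intro; rwa [add_zero, hp1]
      | succ i ihi =>
        intro hi
        refine hX _ (ihi (by omega)) ?_ _ (p.adj_getVert_succ (by omega))
        intro h
        have := hp.inj (i := 1 + i) (j := 0) (by omega) (by omega) (by simpa using h)
        omega
    have hDX : ∀ v ∈ D.verts, v ∈ X := by
      intro v hv
      obtain ⟨i, hi, rfl⟩ := hp.exists_index hv
      rcases Nat.eq_zero_or_pos i with rfl | h0
      · simpa using hr
      · have := hpX (i - 1) (by omega)
        rwa [show 1 + (i - 1) = i by omega] at this
    have hbr : ∀ v ∈ D.verts, v ≠ r → branch D v ⊆ X \ {r} := by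
      intro v hv hvr x hx
      have hxA : x ∈ {y | y ∈ X ∧ y ≠ r ∧ y ∈ branch D v} := by
        refine mem_of_reachable_of_closed (H := G.deleteEdges D.edgeSet) ?_ hx
          ⟨hDX v hv, hvr, self_mem_branch D v⟩
        rintro y ⟨hyX, hyr, hy⟩ z hyz
        have hz : z ∈ branch D v := Reachable.trans hy hyz.reachable
        refine ⟨hX y hyX hyr z (deleteEdges_le _ hyz), ?_, hz⟩
        rintro rfl
        exact hvr (hG.eq_of_mem_branch hD hv hrD hz).symm
      exact ⟨hxA.1, hxA.2.1⟩
    have hnot : ∀ v ∈ D.verts, v ≠ r → ¬ IsBranchActive D v := by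
      intro v hv hvr
      have hsub := hbr v hv hvr
      have hfree : ∀ s ∈ S, s ∈ branch D v → s = v := fun s hs h =>
        absurd (hXS s hs (hsub h).1) (hsub h).2
      refine not_isBranchActive_of_pendant hS.2 hD hv ?_ hfree
      refine ih (branch D v).ncard ?_ (branch D v) v rfl (self_mem_branch D v) ?_ hfree
      · rw [← hn]
        refine Set.ncard_lt_ncard ⟨fun x hx => (hsub hx).1, fun h => ?_⟩ (Set.toFinite _)
        exact (hsub (h hr)).2 rfl
      · intro y hy hyv z hyz
        by_contra hz
        exact hyv (hG.branch_exit hD hv y hy z hz hyz)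
    obtain ⟨v, hva⟩ := hG.exists_branchActive hc hD
    have hvr : v = r := by
      by_contra h
      exact hnot v hva.1 h hva
    have hend : IsEndCycle D := by
      refine ⟨hD, Set.ncard_eq_one.2 ⟨r, ?_⟩⟩
      ext w
      constructor
      · intro hw
        by_contra h
        exact hnot w hw.1 h hw
      · rintro rfl
        exact hvr ▸ hva
    obtain ⟨s, hs, u, hu, hua, hsu⟩ := hS.1 D hend
    have hur : u ≠ r := by
      rintro rfl
      exact hua (hvr ▸ hva)
    have := hbr u hu hur hsu
    exact this.2 (hXS s hs this.1)
  -- Now ra is a bridge, and its far side A contains no vertex of S. By induction every edge from a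
  -- into A starts a pendant path; branch-resolution leaves at most one, and appending a prolongs
  -- it.
  · have hbridge : ¬ (G.deleteEdges {s(r, a)}).Reachable r a := by
      intro h
      obtain ⟨u, p, hp, hmem⟩ := adj_and_reachable_delete_edges_iff_exists_cycle.1 ⟨hra, h⟩
      exact hcyc ⟨p.toSubgraph, ⟨u, p, hp, rfl⟩, p.mem_edges_toSubgraph.2 hmem⟩
    set A : Set V := {y | (G.deleteEdges {s(r, a)}).Reachable a y} with hA
    have hrA : r ∉ A := fun h => hbridge (Reachable.symm h)
    have haA : a ∈ A := Reachable.refl _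
    have har : a ≠ r := hra.ne'
    have hAadj : ∀ y ∈ A, ∀ z, z ≠ r → G.Adj y z → z ∈ A := by
      intro y hy z hz hyz
      refine Reachable.trans hy (Adj.reachable ?_)
      rw [deleteEdges_adj]
      refine ⟨hyz, fun h => ?_⟩
      rcases Sym2.eq_iff.1 h with ⟨rfl, -⟩ | ⟨-, rfl⟩
      · exact hrA hy
      · exact hz rfl
    have hAX : A ⊆ X \ {r} := by
      intro x hx
      have hxA : x ∈ {y | y ∈ X ∧ y ≠ r ∧ y ∈ A} := by
        refine mem_of_reachable_of_closed (H := G.deleteEdges {s(r, a)}) ?_ hx ⟨ha, har, haA⟩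
        rintro y ⟨hyX, hyr, hy⟩ z hyz
        have hz : z ∈ A := Reachable.trans hy hyz.reachable
        refine ⟨hX y hyX hyr z (deleteEdges_le _ hyz), ?_, hz⟩
        rintro rfl
        exact hrA hz
      exact ⟨hxA.1, hxA.2.1⟩
    have hfree : ∀ s ∈ S, s ∉ A := fun s hs h => (hAX h).2 (hXS s hs (hAX h).1)
    have hpend : ∀ b ∈ A, G.Adj a b → ∃ T, T ⊆ A \ {a} ∧ IsPendantPath G b a T := by
      refine ih A.ncard ?_ A a rfl haA ?_ (fun s hs h => absurd h (hfree s hs))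
      · rw [← hn]
        refine Set.ncard_lt_ncard ⟨fun x hx => (hAX hx).1, fun h => ?_⟩ (Set.toFinite _)
        exact hrA (h hr)
      · intro y hy hya z hyz
        refine hAadj y hy z ?_ hyz
        rintro rfl
        have : (G.deleteEdges {s(z, a)}).Adj y z := by
          rw [deleteEdges_adj]
          refine ⟨hyz, fun h => ?_⟩
          rcases Sym2.eq_iff.1 h with ⟨h1, -⟩ | ⟨h1, -⟩
          · exact hrA (h1 ▸ hy)
          · exact hya h1
        exact hrA (Reachable.trans hy this.reachable)
    by_cases hnb : ∃ b, b ≠ r ∧ G.Adj a b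
    · obtain ⟨b, hbr, hab⟩ := hnb
      obtain ⟨T, hT, hpb⟩ := hpend b (hAadj a haA b hbr hab) hab
      have huniq : ∀ d, G.Adj a d → d = r ∨ d = b := by
        intro d had
        by_contra! h
        obtain ⟨T', hT', hpd⟩ := hpend d (hAadj a haA d h.1 had) had
        have h3 := three_le_degree hra.symm hab had hbr.symm h.1.symm h.2.symm
        exact h.2 (hS.2.pendant_unique h3 hpd hpb (fun s hs h => hfree s hs (hT' h).1)
          (fun s hs h => hfree s hs (hT h).1))
      have hdeg : G.degree a = 2 := by
        apply le_antisymm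
        · refine (degree_le_card {r, b} fun d hd => ?_).trans Finset.card_le_two
          simpa using huniq d hd
        · rw [← Finset.card_pair hbr.symm]
          refine card_le_degree _ fun y hy => ?_
          simp only [Finset.mem_insert, Finset.mem_singleton] at hy
          rcases hy with rfl | rfl
          exacts [hra.symm, hab]
      obtain ⟨u, p, h1, h2, h3, h4, rfl⟩ := hpb
      refine ⟨{x | x ∈ (p.concat h4).support}, ?_, u, p.concat h4, ?_, h2, ?_, hra.symm, rfl⟩
      · intro x hx
        have hx' : x ∈ p.support ∨ x = a := by simpa [Walk.support_concat] using hx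
        rcases hx' with hx' | rfl
        · exact hAX (hT hx').1
        · exact hAX haA
      · exact h1.concat (fun h => (hT h).2 rfl) h4
      · intro x hx hxu
        have hx' : x ∈ p.support ∨ x = a := by simpa [Walk.support_concat] using hx
        rcases hx' with hx' | rfl
        · exact h3 x hx' hxu
        · exact hdeg
    · push Not at hnb
      refine ⟨{a}, ?_, a, Walk.nil, by simp, ?_, ?_, hra.symm, by simp⟩
      · rintro x rfl
        exact ⟨ha, har⟩
      · apply le_antisymm
        · refine (degree_le_card {r} fun d hd => ?_).trans (by simp)
          by_contra h
          exact hnb d (by simpa using h) hd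
        · rw [← Finset.card_singleton r]
          refine card_le_degree _ fun y hy => ?_
          rw [Finset.mem_singleton.1 hy]
          exact hra.symm
      · intro x hx hxa
        simp at hx
        exact absurd hx hxa

lemma IsCactus.exists_pendantPath_branch [Finite V] (hG : IsCactus G) (hc : 2 ≤ numCycles G)
    {S : Finset V} (hS : IsLocallyBBR G S) {C : G.Subgraph} (hC : C ∈ cycles G) {v : V}
    (hv : v ∈ C.verts) (hfree : ∀ s ∈ S, s ∉ branch C v) {a : V} (ha : a ∈ branch C v)
    (hva : G.Adj v a) : ∃ T, T ⊆ branch C v \ {v} ∧ IsPendantPath G a v T := by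
  refine hG.exists_pendantPath hc hS _ (branch C v) v rfl (self_mem_branch C v) ?_
    (fun s hs h => absurd h (hfree s hs)) a ha hva
  intro y hy hyv z hyz
  by_contra hz
  exact hyv (hG.branch_exit hC hv y hy z hz hyz)

lemma IsLocallyBBR.isActive [Finite V] {S : Finset V} (hS : IsLocallyBBR G S) (hG : IsCactus G)
    (hc : 2 ≤ numCycles G) {C : G.Subgraph} (hC : C ∈ cycles G) {v : V}
    (hv : IsBranchActive C v) : IsActive S C v := by
  by_contra hcon
  have hfree : ∀ s ∈ S, s ∉ branch C v := fun s hs h => hcon ⟨hv.1, s, hs, h⟩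
  exact not_isBranchActive_of_pendant hS.2 hC hv.1
    (fun a ha hva => hG.exists_pendantPath_branch hc hS hC hv.1 hfree ha hva)
    (fun s hs h => absurd h (hfree s hs)) hv

/-- Branch-active vertices are active for free and every cycle has one, as there are at least two
cycles. Biactivity thus only demands something of end-cycles, namely an active vertex other than the
root. -/
lemma IsCactus.isBBR_iff [Finite V] (hG : IsCactus G) (hc : 2 ≤ numCycles G) {S : Finset V} :
    IsBBR G S ↔ IsLocallyBBR G S := by
  constructor
  · rintro ⟨hbi, hbr⟩
    refine ⟨fun C hC => ?_, hbr⟩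
    obtain ⟨r, hr⟩ := Set.ncard_eq_one.1 hC.2
    have h2 := hbi C hC.1
    obtain ⟨v, hv, hvr⟩ := Set.exists_ne_of_one_lt_ncard h2 r
    obtain ⟨hvC, s, hs, hsv⟩ := hv
    refine ⟨s, hs, v, hvC, fun h => hvr ?_, hsv⟩
    have : v ∈ {v | IsBranchActive C v} := h
    rw [hr] at this
    exact this
  · intro hS
    refine ⟨fun C hC => ?_, hS.2⟩
    have hsub : {v | IsBranchActive C v} ⊆ {v | IsActive S C v} :=
      fun v hv => hS.isActive hG hc hC hv
    have hpos : 0 < {v | IsBranchActive C v}.ncard :=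
      (Set.ncard_pos (Set.toFinite _)).2 (hG.exists_branchActive hc hC)
    by_cases hend : {v | IsBranchActive C v}.ncard = 1
    · obtain ⟨s, hs, u, hu, hua, hsu⟩ := hS.1 C ⟨hC, hend⟩
      have hlt : {v | IsBranchActive C v} ⊂ {v | IsActive S C v} :=
        ⟨hsub, fun h => hua (h (show IsActive S C u from ⟨hu, s, hs, hsu⟩))⟩
      have := Set.ncard_lt_ncard hlt (Set.toFinite _)
      unfold numActive
      omega
    · have := Set.ncard_le_ncard hsub (Set.toFinite _)
      unfold numActive
      omega

lemma IsBBR.isActive [Finite V] {S : Finset V} (hS : IsBBR G S) (hG : IsCactus G)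
    (hc : 2 ≤ numCycles G) {C : G.Subgraph} (hC : C ∈ cycles G) {v : V}
    (hv : IsBranchActive C v) : IsActive S C v :=
  ((hG.isBBR_iff hc).1 hS).isActive hG hc hC hv

end

/-! ### Necessary conditions for metric generators -/

section

variable {V : Type*} {G : SimpleGraph V}

/-! ### Spans of labellings -/

lemma IsLabelling.length_eq {C : G.Subgraph} {u : V} {p : G.Walk u u} (h : IsLabelling C p) :
    p.length = C.verts.ncard := by
  classical
  have : C.verts = ((Finset.range p.length).image p.getVert : Set V) := by
    ext v
    simp only [Finset.coe_image, Set.mem_image, Finset.mem_coe, Finset.mem_range]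
    constructor
    · exact fun hv => h.exists_index hv
    · rintro ⟨i, -, rfl⟩
      exact h.getVert_mem i
  rw [this, Set.ncard_coe_finset, Finset.card_image_of_injOn, Finset.card_range]
  intro i hi j hj hij
  exact h.inj (by simpa using hi) (by simpa using hj) hij

lemma exists_hasSpan {S : Finset V} {C : G.Subgraph} {u : V} {p : G.Walk u u}
    (hp : IsLabelling C p) (hu : IsActive S C u) : ∃ k, HasSpan S C p k := by
  have h3 := hp.three_le
  have hfin : {i | i < p.length ∧ IsActive S C (p.getVert i)}.Finite :=
    (Set.finite_lt_nat p.length).subset fun i hi => hi.1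
  have hne : {i | i < p.length ∧ IsActive S C (p.getVert i)}.Nonempty :=
    ⟨0, by omega, by simpa using hu⟩
  exact ⟨_, hp.1, hp.2, hu, (hfin.isCompact).isGreatest_sSup hne⟩

section span

variable {S : Finset V} {C : G.Subgraph} {u : V} {p : G.Walk u u} {k : ℕ}

lemma HasSpan.isLabelling (h : HasSpan S C p k) : IsLabelling C p := ⟨h.1, h.2.1⟩

lemma HasSpan.lt (h : HasSpan S C p k) : k < p.length := h.2.2.2.1.1

lemma HasSpan.active (h : HasSpan S C p k) : IsActive S C (p.getVert k) := h.2.2.2.1.2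

lemma HasSpan.active_zero (h : HasSpan S C p k) : IsActive S C (p.getVert 0) := by
  rw [Walk.getVert_zero]
  exact h.2.2.1

lemma HasSpan.le (h : HasSpan S C p k) {i : ℕ} (hi : i < p.length)
    (ha : IsActive S C (p.getVert i)) : i ≤ k := h.2.2.2.2 ⟨hi, ha⟩

lemma HasSpan.exists_index_le (h : HasSpan S C p k) {v : V} (hv : IsActive S C v) :
    ∃ i ≤ k, i < p.length ∧ p.getVert i = v := by
  obtain ⟨i, hi, rfl⟩ := h.isLabelling.exists_index hv.1
  exact ⟨i, h.le hi hv, hi, rfl⟩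

/-- A span of at most half of the cycle is the shortest possible. -/
lemma HasSpan.isCanonical (hG : IsCactus G) (h : HasSpan S C p k) (hk : 2 * k ≤ p.length) :
    IsCanonical S C p k := by
  refine ⟨h, fun u' p' k' h' => ?_⟩
  obtain ⟨i, hik, hi, hi'⟩ := h'.exists_index_le h.active_zero
  obtain ⟨j, hjk, hj, hj'⟩ := h'.exists_index_le h.active
  have h1 := hG.dist_getVert h.isLabelling (i := 0) (j := k) (by have := h.lt; omega) h.lt
  have h2 := hG.dist_getVert h'.isLabelling hi hj
  rw [hi', hj', h1] at h2
  unfold cycDist at h2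
  omega

/-- Distances from an element of `S` to the vertices of a cycle. -/
lemma HasSpan.exists_gate_dist (hG : IsCactus G) (h : HasSpan S C p k) {s : V} (hs : s ∈ S) :
    ∃ j ≤ k, j < p.length ∧ IsActive S C (p.getVert j) ∧
      ∀ m < p.length, G.dist s (p.getVert m) = G.dist s (p.getVert j) + cycDist p.length j m := by
  have hl := h.isLabelling
  obtain ⟨v, hv, hsv⟩ := exists_gate hG.1 hl.mem_cycles s
  obtain ⟨j, hjk, hj, rfl⟩ := h.exists_index_le ⟨hv, s, hs, hsv⟩
  refine ⟨j, hjk, hj, ⟨hv, s, hs, hsv⟩, fun m hm => ?_⟩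
  rw [hG.dist_gate hl.mem_cycles hv hsv (hl.getVert_mem m), hG.dist_getVert hl hj hm]

end span

/-! ### Conditions satisfied by metric generators -/

/-- The index set of configuration ℬ consists of positions with a neighbour i' one step farther from
all of 0, …, k, hence from every active vertex. At position 0 this neighbour is g - 1. -/
lemma exists_shift {g k i : ℕ} (hg : 3 ≤ g) (hk : k ≤ g / 2 - 1)
    (hi : i ∈ Set.Icc k (g / 2 - 1) ∪ Set.Icc ((g + 1) / 2 + k + 1) (g - 1) ∪ {0}) :
    i < g ∧ ∃ i' < g, (i' = i + 1 ∨ i = i' + 1 ∨ (i = 0 ∧ i' = g - 1)) ∧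
      ∀ j ≤ k, cycDist g j i' = cycDist g j i + 1 := by
  unfold cycDist
  rcases hi with (hi | hi) | hi
  · obtain ⟨h1, h2⟩ := Set.mem_Icc.1 hi
    exact ⟨by omega, i + 1, by omega, by omega, fun j hj => by omega⟩
  · obtain ⟨h1, h2⟩ := Set.mem_Icc.1 hi
    exact ⟨by omega, i - 1, by omega, by omega, fun j hj => by omega⟩
  · obtain rfl := Set.mem_singleton_iff.1 hi
    exact ⟨by omega, g - 1, by omega, by omega, fun j hj => by omega⟩

lemma HasSpan.dist_shift (hG : IsCactus G) {S : Finset V} {C : G.Subgraph} {u : V} {p : G.Walk u u}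
    {k i i' : ℕ} (h : HasSpan S C p k) (hi : i < p.length) (hi' : i' < p.length)
    (hd : ∀ j ≤ k, cycDist p.length j i' = cycDist p.length j i + 1) {s : V} (hs : s ∈ S) :
    G.dist s (p.getVert i') = G.dist s (p.getVert i) + 1 := by
  obtain ⟨j, hjk, hj, -, hdist⟩ := h.exists_gate_dist hG hs
  rw [hdist i hi, hdist i' hi', hd j hjk]
  omega

/-- Both ends of a short S-path belong to the index set of ℬ, so the same shift applies. -/
lemma IsVertexCritical.exists_dist (hG : IsCactus G) {S : Finset V} {C : G.Subgraph} {v : V}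
    (h : IsVertexCritical S C v) :
    ∃ x, s(v, x) ∈ C.edgeSet ∧ ∀ s ∈ S, G.dist s x = G.dist s v + 1 := by
  obtain ⟨u, p, k, hcan, hv, hk⟩ := h
  have hsp := hcan.1
  have hl := hsp.isLabelling
  have h3 := hl.three_le
  have : ∃ i, v = p.getVert i ∧
      i ∈ Set.Icc k (p.length / 2 - 1) ∪ Set.Icc ((p.length + 1) / 2 + k + 1) (p.length - 1) ∪ {0} := by
    rcases hv with rfl | rfl
    · exact ⟨0, rfl, Or.inr rfl⟩
    · exact ⟨k, rfl, Or.inl (Or.inl ⟨le_rfl, hk⟩)⟩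
  obtain ⟨i, rfl, hi⟩ := this
  obtain ⟨hig, i', hi'g, hadj, hd⟩ := exists_shift h3 hk hi
  refine ⟨p.getVert i', ?_, fun s hs => hsp.dist_shift hG hig hi'g hd hs⟩
  rcases hadj with rfl | rfl | ⟨rfl, rfl⟩
  · exact hl.edge_mem hig
  · rw [Sym2.eq_swap]
    exact hl.edge_mem hi'g
  · have := hl.edge_mem hi'g
    rw [show p.length - 1 + 1 = p.length by omega, Walk.getVert_length, Sym2.eq_swap] at this
    simpa using this

lemma IsVertexCritical.mem_verts {S : Finset V} {C : G.Subgraph} {v : V}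
    (h : IsVertexCritical S C v) : IsActive S C v := by
  obtain ⟨u, p, k, hcan, rfl | rfl, hk⟩ := h
  exacts [hcan.1.active_zero, hcan.1.active]

/-- If S saw C through a single gate, the two neighbours of that gate on C would be undistinguished.
-/
lemma IsMetricGenerator.isBiactive [Finite V] (hG : IsCactus G) {S : Finset V}
    (hS : IsMetricGenerator G S) : IsBiactive G S := by
  intro C hC
  by_contra! hlt
  have hone : ∀ v w, IsActive S C v → IsActive S C w → v = w := by
    intro v w hv hw
    by_contra hne
    have : 1 < {v | IsActive S C v}.ncard :=
      (Set.one_lt_ncard_iff (Set.toFinite _)).2 ⟨v, w, hv, hw, hne⟩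
    unfold numActive at hlt
    omega
  obtain ⟨w, hw⟩ := exists_mem_verts hC
  obtain ⟨a, b, hab, -⟩ := exists_cycle_nbrs hC hw
  obtain ⟨s, hs, -⟩ := hS a b hab
  obtain ⟨v, hv, hsv⟩ := exists_gate hG.1 hC s
  have hva : IsActive S C v := ⟨hv, s, hs, hsv⟩
  obtain ⟨c, d, hcd, hc, hd, -⟩ := exists_cycle_nbrs hC hv
  obtain ⟨s', hs', hne⟩ := hS c d hcd
  obtain ⟨v', hv', hsv'⟩ := exists_gate hG.1 hC s'
  obtain rfl := hone v v' hva ⟨hv', s', hs', hsv'⟩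
  rw [hG.dist_gate hC hv hsv' (mem_verts_of_edge_mem hc).2,
    hG.dist_gate hC hv hsv' (mem_verts_of_edge_mem hd).2,
    dist_eq_one_iff_adj.2 (C.adj_sub hc), dist_eq_one_iff_adj.2 (C.adj_sub hd)] at hne
  exact hne rfl

lemma IsMetricGenerator.not_incident (hG : IsCactus G) {S : Finset V}
    (hS : IsMetricGenerator G S) (C D : G.Subgraph) : ¬ VertexCriticallyIncident S C D := by
  rintro ⟨hC, hD, hne, v, hvC, hvD⟩
  obtain ⟨x, hx, hdx⟩ := hvC.exists_dist hG
  obtain ⟨y, hy, hdy⟩ := hvD.exists_dist hG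
  have hxy : x ≠ y := by
    rintro rfl
    exact hG.edge_notMem hC hD hne hy hx
  obtain ⟨s, hs, hd⟩ := hS x y hxy
  exact hd ((hdx s hs).trans (hdy s hs).symm)

/-- If exactly two vertices are active, they are the ends of the path. -/
lemma HasSpan.eq_or_eq [Finite V] {S : Finset V} {C : G.Subgraph} {u : V} {p : G.Walk u u}
    {k j : ℕ} (h : HasSpan S C p k) (h2 : numActive S C = 2) (hj : j < p.length)
    (hja : IsActive S C (p.getVert j)) : j = 0 ∨ j = k := by
  have hl := h.isLabelling
  have h0 : 0 < p.length := by have := hl.three_le; omega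
  by_contra! hne
  have hjk := h.le hj hja
  have : 2 < {v | IsActive S C v}.ncard := by
    rw [Set.two_lt_ncard_iff (Set.toFinite _)]
    refine ⟨p.getVert 0, p.getVert j, p.getVert k, h.active_zero, hja, h.active, ?_, ?_, ?_⟩
    · exact fun h' => hne.1 (hl.inj h0 hj h').symm
    · intro h'
      have := hl.inj h0 h.lt h'
      omega
    · exact fun h' => hne.2 (hl.inj hj h.lt h')
  unfold numActive at h2
  omega

/-- With only two active vertices, antipodal to each other, reflection across them exchanges
positions 1 and g - 1. -/
lemma IsMetricGenerator.not_configA [Finite V] (hG : IsCactus G) {S : Finset V}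
    (hS : IsMetricGenerator G S) {C : G.Subgraph} {u : V} {p : G.Walk u u} {k : ℕ}
    (h : HasSpan S C p k) : ¬ ConfigA S C p k := by
  rintro ⟨h2, hev, hk⟩
  have hl := h.isLabelling
  have h3 := hl.three_le
  obtain ⟨m, hm⟩ := hev
  have hne : p.getVert 1 ≠ p.getVert (p.length - 1) := by
    intro h'
    have := hl.inj (by omega) (by omega) h'
    omega
  obtain ⟨s, hs, hd⟩ := hS _ _ hne
  obtain ⟨j, hjk, hj, hja, hdist⟩ := h.exists_gate_dist hG hs
  rw [hdist 1 (by omega), hdist (p.length - 1) (by omega)] at hd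
  unfold cycDist at hd
  rcases h.eq_or_eq h2 hj hja with rfl | rfl <;> omega

variable [G.LocallyFinite]

lemma IsFreeThread.dist_eq (hG : IsCactus G) {S : Finset V} {v s t : V} {T : Set V}
    (h : IsFreeThread G S v T) (hs : s ∈ S) (ht : t ∈ T) :
    G.dist s t = G.dist s v + G.dist v t :=
  h.1.dist_eq hG.1 (h.2 s hs) ht

lemma IsMetricGenerator.isBranchResolving (hG : IsCactus G) {S : Finset V}
    (hS : IsMetricGenerator G S) : IsBranchResolving G S := by
  intro v T T' h h'
  by_contra hne
  obtain ⟨a, ha, hva⟩ := h.1.exists_adj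
  obtain ⟨b, hb, hvb⟩ := h'.1.exists_adj
  have hab : a ≠ b := by
    rintro rfl
    exact hne (h.1.eq_of_mem h'.1 ha hb).1
  obtain ⟨s, hs, hd⟩ := hS a b hab
  rw [h.dist_eq hG hs ha, h'.dist_eq hG hs hb, dist_eq_one_iff_adj.2 hva,
    dist_eq_one_iff_adj.2 hvb] at hd
  exact hd rfl

/-- The first vertex of the free thread and the shifted position i' are both one step farther from S
than position i. -/
lemma IsMetricGenerator.not_configB (hG : IsCactus G) {S : Finset V}
    (hS : IsMetricGenerator G S) {C : G.Subgraph} {u : V} {p : G.Walk u u} {k : ℕ}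
    (h : HasSpan S C p k) : ¬ ConfigB S p k := by
  rintro ⟨hk, i, hi, T, hT⟩
  have hl := h.isLabelling
  obtain ⟨hig, i', hi'g, -, hd⟩ := exists_shift hl.three_le hk hi
  obtain ⟨a, ha, hva⟩ := hT.1.exists_adj
  have hne : a ≠ p.getVert i' := fun h' =>
    hT.1.notMem_cycle hl.mem_cycles ha (h' ▸ hl.getVert_mem i')
  obtain ⟨s, hs, hds⟩ := hS _ _ hne
  rw [hT.dist_eq hG hs ha, dist_eq_one_iff_adj.2 hva, h.dist_shift hG hig hi'g hd hs] at hds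
  exact hds rfl

lemma IsMetricGenerator.not_configC [Finite V] (hG : IsCactus G) {S : Finset V}
    (hS : IsMetricGenerator G S) {C : G.Subgraph} {u : V} {p : G.Walk u u} {k : ℕ}
    (h : HasSpan S C p k) : ¬ ConfigC S C p k := by
  rintro ⟨h2, hev, hk, i, hi, T, hT, hlen⟩
  have hl := h.isLabelling
  have h3 := hl.three_le
  -- The case k = g/2 is 𝒜; excluding it makes the distance g/2 - k used below positive.
  have hkA : k ≠ p.length / 2 := fun h' => hS.not_configA hG h ⟨h2, hev, h'⟩
  obtain ⟨m, hm⟩ := hev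
  have hik : i ≤ k := hi.2
  obtain ⟨t, ht, hdt⟩ := hT.1.exists_dist_eq hG.1 (n := p.length / 2 - k) (by omega) hlen
  -- This position on the long arc is at distance g/2 - k + i from 0 and g/2 - i from k, exactly as
  -- is the thread vertex at distance g/2 - k from position i.
  have hne : t ≠ p.getVert (p.length / 2 + k - i) := fun h' =>
    hT.1.notMem_cycle hl.mem_cycles ht (h' ▸ hl.getVert_mem _)
  obtain ⟨s, hs, hds⟩ := hS _ _ hne
  obtain ⟨j, hjk, hj, hja, hdist⟩ := h.exists_gate_dist hG hs
  rw [hT.dist_eq hG hs ht, hdt, hdist i (by omega), hdist (p.length / 2 + k - i) (by omega)] at hds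
  unfold cycDist at hds
  rcases h.eq_or_eq h2 hj hja with rfl | rfl <;> omega

lemma IsMetricGenerator.not_containsABC [Finite V] (hG : IsCactus G) {S : Finset V}
    (hS : IsMetricGenerator G S) (C : G.Subgraph) : ¬ ContainsABC S C := by
  rintro ⟨u, p, k, hcan, h | h | h⟩
  exacts [hS.not_configA hG hcan.1 h, hS.not_configB hG hcan.1 h, hS.not_configC hG hcan.1 h]

end

/-! ### Sufficient conditions for metric generators -/

section

/-! ### Arithmetic of positions on a cycle -/

lemma cycDist_spec {g i j : ℕ} (hi : i < g) (hj : j < g) :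
    (i ≤ j ∧ 2 * j ≤ g + 2 * i ∧ cycDist g i j + i = j) ∨
    (i ≤ j ∧ g + 2 * i < 2 * j ∧ cycDist g i j + j = g + i) ∨
    (j < i ∧ 2 * i ≤ g + 2 * j ∧ cycDist g i j + j = i) ∨
    (j < i ∧ g + 2 * j < 2 * i ∧ cycDist g i j + i = g + j) := by
  unfold cycDist
  omega

/-- Think of vertices hanging at depths p and q behind α and β. Since the depths differ by less than
the distance of α and β, each of the two arcs between them carries at most one position equidistant
from both; the last two cases are one arc, cut at position 0. -/
lemma cycDist_level {g i α β p q : ℕ} (hi : i < g) (hβ : β < g) (hαβ : α < β)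
    (h1 : p < q + cycDist g α β) (h2 : q < p + cycDist g α β)
    (e : cycDist g i α + p = cycDist g i β + q) :
    (α ≤ i ∧ i ≤ β ∧ 2 * i + p = α + β + q ∧ 2 * i ≤ g + 2 * α ∧ 2 * β ≤ g + 2 * i) ∨
    (β < i ∧ 2 * i + q = α + β + g + p ∧ 2 * i ≤ g + 2 * β) ∨
    (i < α ∧ 2 * i + g + q = α + β + p ∧ 2 * α ≤ g + 2 * i) := by
  have sα := cycDist_spec hi (hαβ.trans hβ)
  have sβ := cycDist_spec hi hβ
  have s := cycDist_spec (hαβ.trans hβ) hβ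
  generalize cycDist g i α = x at *
  generalize cycDist g i β = y at *
  generalize cycDist g α β = z at *
  rcases s with s | s | s | s <;> rcases sα with sα | sα | sα | sα <;>
    rcases sβ with sβ | sβ | sβ | sβ <;> omega

lemma cycDist_at_most_two {g i j α β p q : ℕ} (hi : i < g) (hj : j < g) (hα : α < g) (hβ : β < g)
    (hij : i ≠ j) (hi0 : 0 < i) (hj0 : 0 < j)
    (h1 : p < q + cycDist g α β) (h2 : q < p + cycDist g α β)
    (e0 : cycDist g 0 α + p = cycDist g 0 β + q)
    (ei : cycDist g i α + p = cycDist g i β + q)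
    (ej : cycDist g j α + p = cycDist g j β + q) : False := by
  wlog hαβ : α < β generalizing α β p q
  · have hne : α ≠ β := by
      rintro rfl
      unfold cycDist at h1 h2
      omega
    have hc : cycDist g β α = cycDist g α β := by
      unfold cycDist
      omega
    exact this hβ hα (by omega) (by omega) e0.symm ei.symm ej.symm (by omega)
  · have l0 := cycDist_level (by omega) hβ hαβ h1 h2 e0
    have li := cycDist_level hi hβ hαβ h1 h2 ei
    have lj := cycDist_level hj hβ hαβ h1 h2 ej
    omega

/-- The positions 0 and k lie on different arcs. Combining their level equations shows that the two
depths differ by g/2 - k, the greater one belonging to the point on the short arc from 0 to k. -/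
lemma cycDist_two {g k α β p q : ℕ} (hα : α < g) (hβ : β < g)
    (hk0 : 0 < k) (hk : 2 * k ≤ g)
    (h1 : p < q + cycDist g α β) (h2 : q < p + cycDist g α β)
    (e0 : cycDist g 0 α + p = cycDist g 0 β + q)
    (ek : cycDist g k α + p = cycDist g k β + q) :
    g % 2 = 0 ∧ (k = g / 2 ∨ (α ≤ k ∧ g / 2 - k ≤ p) ∨ (β ≤ k ∧ g / 2 - k ≤ q)) := by
  wlog hαβ : α < β generalizing α β p q
  · have hne : α ≠ β := by
      rintro rfl
      unfold cycDist at h1 h2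
      omega
    have hc : cycDist g β α = cycDist g α β := by
      unfold cycDist
      omega
    have := this hβ hα (by omega) (by omega) e0.symm ek.symm (by omega)
    tauto
  · have l0 := cycDist_level (by omega) hβ hαβ h1 h2 e0
    have lk := cycDist_level (by omega) hβ hαβ h1 h2 ek
    omega

lemma cycDist_span {g t J α : ℕ} (hα : α < g) (ht : t < g) (hJ : 2 * J ≤ g) (hJ0 : 0 < J)
    (hne : α ≠ J) (e0 : cycDist g 0 α = J + cycDist g J α)
    (et : cycDist g t α = cycDist g t J + cycDist g J α) (hm : cycDist g t J ≤ J) : t ≤ J ∧ J ≤ g / 2 - 1 := by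
  have s1 := cycDist_spec (i := 0) (by omega) hα
  have s2 := cycDist_spec (g := g) (i := J) (by omega) hα
  have s3 := cycDist_spec ht hα
  have s4 := cycDist_spec (g := g) (j := J) ht (by omega)
  generalize cycDist g 0 α = x at *
  generalize cycDist g J α = y at *
  generalize cycDist g t α = z at *
  generalize cycDist g t J = w at *
  rcases s1 with s1 | s1 | s1 | s1 <;> rcases s2 with s2 | s2 | s2 | s2 <;>
    rcases s3 with s3 | s3 | s3 | s3 <;> rcases s4 with s4 | s4 | s4 | s4 <;> omega

variable {V : Type*} {G : SimpleGraph V}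

/-! ### Canonical labellings through a given vertex -/

lemma IsCactus.exists_labelling_dist (hG : IsCactus G) {C : G.Subgraph} (hC : C ∈ cycles G)
    {w c : V} (hw : w ∈ C.verts) (hc : c ∈ C.verts) :
    ∃ p : G.Walk w w, IsLabelling C p ∧ p.getVert (G.dist w c) = c ∧
      2 * G.dist w c ≤ p.length := by
  obtain ⟨p, hp⟩ := exists_labelling hC hw
  obtain ⟨i, hi, rfl⟩ := hp.exists_index hc
  have hd := hG.dist_getVert hp (i := 0) (by omega) hi
  rw [Walk.getVert_zero] at hd
  rcases le_or_gt (2 * i) p.length with h | h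
  · have : G.dist w (p.getVert i) = i := by
      rw [hd]
      unfold cycDist
      omega
    exact ⟨p, hp, by rw [this], by omega⟩
  · have : G.dist w (p.getVert i) = p.length - i := by
      rw [hd]
      unfold cycDist
      omega
    refine ⟨p.reverse, hp.reverse, ?_, by rw [Walk.length_reverse]; omega⟩
    rw [this, Walk.getVert_reverse]
    congr 1
    omega

/-- If all active vertices reach `a` through `c`, then `c` lies shortly after the end of a canonical
labelling. -/
lemma IsCactus.exists_isCanonical [Finite V] (hG : IsCactus G) {S : Finset V} {C : G.Subgraph}
    (hC : C ∈ cycles G) (h2 : 2 ≤ numActive S C) {a c : V} (ha : a ∈ C.verts) (hc : c ∈ C.verts)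
    (hne : a ≠ c) (h : ∀ w, IsActive S C w → G.dist w a = G.dist w c + G.dist c a) :
    ∃ (u : V) (p : G.Walk u u) (k J : ℕ), IsCanonical S C p k ∧ k ≤ J ∧ J ≤ p.length / 2 - 1 ∧
      p.getVert J = c := by
  obtain ⟨w₀, hw₀, hw₀c⟩ := Set.exists_ne_of_one_lt_ncard (s := {v | IsActive S C v}) h2 c
  -- Starting the labelling at the active vertex farthest from c makes every active position lie
  -- between 0 and J.
  obtain ⟨w, hw, hmax⟩ := Set.exists_max_image {v | IsActive S C v} (fun v => G.dist v c)
    (Set.toFinite _) ⟨w₀, hw₀⟩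
  have hwa : IsActive S C w := hw
  obtain ⟨p, hp, hpc, hle⟩ := hG.exists_labelling_dist hC hwa.1 hc
  have hpos : 0 < G.dist w c :=
    (hG.1.pos_dist_of_ne hw₀c).trans_le (hmax w₀ hw₀)
  set J := G.dist w c with hJ
  have h3 := hp.three_le
  obtain ⟨k, hk⟩ := exists_hasSpan hp hwa
  obtain ⟨α, hα, rfl⟩ := hp.exists_index ha
  have hαJ : α ≠ J := by
    rintro rfl
    exact hne hpc
  have hJg : J < p.length := by omega
  have e0 := h w hwa
  have ek := h _ hk.active
  have hm := hmax _ hk.active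
  rw [← hpc, hG.dist_getVert hp hk.lt hJg] at hm
  rw [← hJ, ← hpc, hG.dist_getVert hp hJg hα] at e0
  have e0' := hG.dist_getVert hp (i := 0) (by omega) hα
  rw [Walk.getVert_zero] at e0'
  rw [e0'] at e0
  rw [← hpc, hG.dist_getVert hp hk.lt hα, hG.dist_getVert hp hk.lt hJg,
    hG.dist_getVert hp hJg hα] at ek
  have := cycDist_span hα hk.lt hle hpos hαJ e0 ek hm
  exact ⟨w, p, k, J, hk.isCanonical hG (by omega), this.1, this.2, hpc⟩

variable [G.LocallyFinite]

/-! ### Sufficient conditions for a metric generator -/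

lemma IsCactus.exists_freeThread [Finite V] (hG : IsCactus G) (hc : 2 ≤ numCycles G)
    {S : Finset V} (hS : IsBBR G S) {C : G.Subgraph} (hC : C ∈ cycles G) {v x : V}
    (hv : v ∈ C.verts) (hfree : ∀ s ∈ S, s ∉ branch C v) (hx : x ∈ branch C v) (hxv : x ≠ v) :
    ∃ T, IsFreeThread G S v T ∧ x ∈ T := by
  have hL := (hG.isBBR_iff hc).1 hS
  have : x ∈ {y | y = v ∨ ∃ T, IsFreeThread G S v T ∧ y ∈ T} := by
    refine mem_of_reachable_of_closed (H := G.deleteEdges C.edgeSet) ?_ hx (Or.inl rfl)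
    rintro y (rfl | ⟨T, hT, hy⟩) z hyz
    · rw [deleteEdges_adj] at hyz
      have hz := mem_branch_of_adj (self_mem_branch C y) hyz.1 hyz.2
      obtain ⟨T, hT, hp⟩ := hG.exists_pendantPath_branch hc hL hC hv hfree hz hyz.1
      obtain ⟨a, b, hab, ha, hb, -⟩ := exists_cycle_nbrs hC hv
      have h3 : 3 ≤ G.degree y := by
        refine three_le_degree (C.adj_sub ha) (C.adj_sub hb) hyz.1 hab ?_ ?_
        · rintro rfl
          exact hyz.2 ha
        · rintro rfl
          exact hyz.2 hb
      exact Or.inr ⟨T, ⟨hp.isThread h3, fun s hs h => hfree s hs (hT h).1⟩, hp.mem⟩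
    · rcases hT.1.closed hy (deleteEdges_le _ hyz) with h | rfl
      exacts [Or.inr ⟨T, hT, h⟩, Or.inl rfl]
  exact this.resolve_left hxv

/-- Two vertices with different gates on a cycle, neither gate being equidistant from them. -/
lemma IsCactus.false_of_gates [Finite V] (hG : IsCactus G) (hc : 2 ≤ numCycles G)
    {S : Finset V} (hS : IsBBR G S) {C : G.Subgraph} (hC : C ∈ cycles G)
    (hABC : ¬ ContainsABC S C) {x x' a b : V} (heq : ∀ s ∈ S, G.dist s x = G.dist s x')
    (ha : a ∈ C.verts) (hb : b ∈ C.verts) (hxa : x ∈ branch C a) (hxb : x' ∈ branch C b)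
    (h1 : G.dist x a < G.dist x' b + G.dist a b) (h2 : G.dist x' b < G.dist x a + G.dist a b) :
    False := by
  have hab : a ≠ b := by
    rintro rfl
    rw [dist_self] at h1 h2
    omega
  -- An element of S behind a would be strictly closer to x than to x', and likewise with the roles
  -- exchanged. So neither gate is active, and all active vertices satisfy the level equation
  -- `hact`.
  have hfa : ∀ s ∈ S, s ∉ branch C a := by
    intro s hs h
    have e1 := hG.dist_gates hC ha hb h hxb hab
    have e2 := heq s hs
    have e3 := hG.1.dist_triangle (u := s) (v := a) (w := x)
    rw [dist_comm (u := a) (v := x)] at e3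
    rw [dist_comm (u := b) (v := x')] at e1
    omega
  have hfb : ∀ s ∈ S, s ∉ branch C b := by
    intro s hs h
    have e1 := hG.dist_gates hC hb ha h hxa hab.symm
    have e2 := heq s hs
    have e3 := hG.1.dist_triangle (u := s) (v := b) (w := x')
    rw [dist_comm (u := b) (v := x')] at e3
    rw [dist_comm (u := a) (v := x), dist_comm (u := b) (v := a)] at e1
    omega
  have hact : ∀ w, IsActive S C w → G.dist w a + G.dist x a = G.dist w b + G.dist x' b := by
    rintro w ⟨hw, s, hs, hsw⟩
    have hwa : w ≠ a := by
      rintro rfl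
      exact hfa s hs hsw
    have hwb : w ≠ b := by
      rintro rfl
      exact hfb s hs hsw
    have e1 := hG.dist_gates hC hw ha hsw hxa hwa
    have e2 := hG.dist_gates hC hw hb hsw hxb hwb
    have e3 := heq s hs
    rw [dist_comm (u := a) (v := x)] at e1
    rw [dist_comm (u := b) (v := x')] at e2
    omega
  obtain ⟨w₁, w₂, hw₁, hw₂, hne⟩ := (Set.one_lt_ncard_iff (Set.toFinite _)).1 (hS.1 C hC)
  have ha₁ : IsActive S C w₁ := hw₁
  have ha₂ : IsActive S C w₂ := hw₂
  obtain ⟨p, hp, hpk, hle⟩ := hG.exists_labelling_dist hC ha₁.1 ha₂.1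
  have hk0 := hG.1.pos_dist_of_ne hne
  set k := G.dist w₁ w₂ with hk
  have h3 := hp.three_le
  have hkg : k < p.length := by omega
  obtain ⟨α, hα, rfl⟩ := hp.exists_index ha
  obtain ⟨β, hβ, rfl⟩ := hp.exists_index hb
  have hd : G.dist (p.getVert α) (p.getVert β) = cycDist p.length α β := hG.dist_getVert hp hα hβ
  rw [hd] at h1 h2
  have hact' : ∀ i < p.length, IsActive S C (p.getVert i) →
      cycDist p.length i α + G.dist x (p.getVert α) =
        cycDist p.length i β + G.dist x' (p.getVert β) := by
    intro i hi hia
    have := hact _ hia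
    rwa [hG.dist_getVert hp hi hα, hG.dist_getVert hp hi hβ] at this
  have e0 := hact' 0 (by omega) (by simpa using ha₁)
  have hka : IsActive S C (p.getVert k) := hpk ▸ ha₂
  have ek := hact' k hkg hka
  have honly : ∀ i < p.length, IsActive S C (p.getVert i) → i = 0 ∨ i = k := by
    intro i hi hia
    by_contra! hcon
    exact cycDist_at_most_two hi hkg hα hβ hcon.2 (by omega) hk0 h1 h2 e0 (hact' i hi hia) ek
  have hspan : HasSpan S C p k := by
    refine ⟨hp.1, hp.2, ha₁, ⟨hkg, hka⟩, ?_⟩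
    rintro i ⟨hi, hia⟩
    rcases honly i hi hia with rfl | rfl <;> omega
  have hnum : numActive S C = 2 := by
    unfold numActive
    rw [Set.ncard_eq_two]
    refine ⟨w₁, w₂, hne, ?_⟩
    ext w
    constructor
    · intro hw
      obtain ⟨i, hi, rfl⟩ := hp.exists_index hw.1
      rcases honly i hi hw with rfl | rfl
      · exact Or.inl p.getVert_zero
      · exact Or.inr hpk
    · rintro (rfl | rfl)
      exacts [hw₁, hw₂]
  obtain ⟨hev, hcase⟩ := cycDist_two hα hβ hk0 hle h1 h2 e0 ek
  rw [← Nat.even_iff] at hev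
  apply hABC
  refine ⟨w₁, p, k, hspan.isCanonical hG hle, ?_⟩
  by_cases hkA : k = p.length / 2
  · exact Or.inl ⟨hnum, hev, hkA⟩
  · right
    -- The gate on the short arc is inactive, so its vertex x or x' lies in a free thread that is
    -- long enough for 𝒞.
    right
    refine ⟨hnum, hev, by omega, ?_⟩
    have key : ∀ y i, i < p.length → i ≤ k → (∀ s ∈ S, s ∉ branch C (p.getVert i)) →
        y ∈ branch C (p.getVert i) → p.length / 2 - k ≤ G.dist y (p.getVert i) →
        ∃ i ∈ Set.Icc 0 k, ∃ T, IsFreeThread G S (p.getVert i) T ∧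
          p.length / 2 - k ≤ T.ncard := by
      intro y i hi hik hfree hy hdy
      have hyi : y ≠ p.getVert i := by
        rintro rfl
        rw [dist_self] at hdy
        omega
      obtain ⟨T, hT, hyT⟩ := hG.exists_freeThread hc hS hC (hp.getVert_mem i) hfree hy hyi
      refine ⟨i, ⟨Nat.zero_le _, hik⟩, T, hT, hdy.trans ?_⟩
      rw [dist_comm]
      exact hT.1.dist_le_ncard hG.1 hyT
    rcases hcase with h | ⟨h, h'⟩ | ⟨h, h'⟩
    · exact absurd h hkA
    · exact key x α hα h hfa hxa h'
    · exact key x' β hβ h hfb hxb h'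

/-- The part of the graph behind the first edge `cy`, a bridge, of a geodesic from `c` to `x`. -/
lemma IsCactus.exists_pendantPath_of_bridge [Finite V] (hG : IsCactus G) (hc : 2 ≤ numCycles G)
    {S : Finset V} (hS : IsBBR G S) {x x' c y : V} (heq : ∀ s ∈ S, G.dist s x = G.dist s x')
    (hcy : G.Adj c y) (hyx : G.dist y x + 1 = G.dist c x) (hyx' : G.dist y x' = G.dist c x' + 1)
    (hxx : G.dist c x = G.dist c x') (hno : ∀ C ∈ cycles G, s(c, y) ∉ C.edgeSet) :
    ∃ T, c ∉ T ∧ (∀ s ∈ S, s ∉ T) ∧ IsPendantPath G y c T := by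
  have hbridge : ¬ (G.deleteEdges {s(c, y)}).Reachable c y := by
    intro h
    obtain ⟨u, p, hp, hmem⟩ := adj_and_reachable_delete_edges_iff_exists_cycle.1 ⟨hcy, h⟩
    exact hno p.toSubgraph ⟨u, p, hp, rfl⟩ (p.mem_edges_toSubgraph.2 hmem)
  set Y : Set V := {z | (G.deleteEdges {s(c, y)}).Reachable y z} with hY
  have hcY : c ∉ Y := fun h => hbridge (Reachable.symm h)
  have hyY : y ∈ Y := Reachable.refl _
  have hexit : ∀ a ∈ Y, ∀ b ∉ Y, G.Adj a b → a = y ∧ b = c := by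
    intro a ha b hb hab
    have he : s(a, b) = s(c, y) := by
      by_contra he
      exact hb (Reachable.trans ha (Adj.reachable (by rw [deleteEdges_adj]; exact ⟨hab, he⟩)))
    rcases Sym2.eq_iff.1 he with ⟨rfl, -⟩ | h
    · exact absurd ha hcY
    · exact h
  have h1 := dist_eq_one_iff_adj.2 hcy
  have hx'Y : x' ∉ Y := by
    intro h
    have := dist_eq_of_exit hG.1 (v := y) (fun a ha b hb hab => Or.inl (hexit a ha b hb hab).1) h
      (Or.inl hcY)
    rw [dist_comm (u := x'), dist_comm (u := x'), dist_comm (u := y) (v := c)] at this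
    omega
  have hSY : ∀ s ∈ S, s ∉ Y := by
    intro s hs h
    have e1 := dist_eq_of_exit hG.1 (v := y) (fun a ha b hb hab => Or.inl (hexit a ha b hb hab).1) h
      (Or.inl hx'Y)
    have e2 := heq s hs
    have e3 := hG.1.dist_triangle (u := s) (v := y) (w := x)
    omega
  have hclosed : ∀ a ∈ insert c Y, a ≠ c → ∀ b, G.Adj a b → b ∈ insert c Y := by
    rintro a (rfl | ha) hac b hab
    · exact absurd rfl hac
    · by_cases hb : b ∈ Y
      · exact Or.inr hb
      · exact Or.inl (hexit a ha b hb hab).2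
  have hfree : ∀ s ∈ S, s ∈ insert c Y → s = c := fun s hs h => h.resolve_right (hSY s hs)
  obtain ⟨T, hT, hp⟩ := hG.exists_pendantPath hc ((hG.isBBR_iff hc).1 hS) _ (insert c Y) c rfl
    (Set.mem_insert c Y) hclosed hfree y (Or.inr hyY) hcy
  exact ⟨T, fun h => (hT h).2 rfl, fun s hs h => hSY s hs ((hT h).1.resolve_left (hT h).2), hp⟩

/-- The cycle through the first edge `cy` of a geodesic from `c` to `x`. -/
lemma IsCactus.exists_isCanonical_of_mid [Finite V] (hG : IsCactus G)
    {S : Finset V} (hS : IsBBR G S) {x x' c y z : V} (heq : ∀ s ∈ S, G.dist s x = G.dist s x')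
    (hcz : G.Adj c z) (hyx : G.dist y x + 1 = G.dist c x)
    (hzx' : G.dist z x' + 1 = G.dist c x') (hxx : G.dist c x = G.dist c x')
    {C : G.Subgraph} (hC : C ∈ cycles G) (hyC : s(c, y) ∈ C.edgeSet) (hzC : s(c, z) ∉ C.edgeSet) :
    ∃ (u : V) (p : G.Walk u u) (k J : ℕ), IsCanonical S C p k ∧ k ≤ J ∧ J ≤ p.length / 2 - 1 ∧
      p.getVert J = c := by
  have hcC := (mem_verts_of_edge_mem hyC).1
  have hyC' := (mem_verts_of_edge_mem hyC).2
  obtain ⟨a, ha, hxa⟩ := exists_gate hG.1 hC x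
  obtain ⟨b, hb, hxb⟩ := exists_gate hG.1 hC x'
  have hzb : z ∈ branch C c := mem_branch_of_adj (self_mem_branch C c) hcz hzC
  -- A gate of x' other than c would make the step from c to z lead away from x'.
  have hbc : b = c := by
    by_contra hbc
    have := hG.dist_branch hC hcC hzb (y := x')
      (Or.inl fun h => hbc (hG.gate_eq hC hb hcC hxb h))
    omega
  subst hbc
  have e1 := hG.dist_gate hC ha hxa hcC
  have e2 := hG.dist_gate hC ha hxa hyC'
  rw [dist_comm (u := x) (v := b)] at e1
  rw [dist_comm (u := x) (v := y)] at e2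
  have hac : a ≠ b := by
    rintro rfl
    rw [dist_self] at e1
    omega
  -- If an active w had a way to a shorter than through c, the element of S behind w would be closer
  -- to x than to x'.
  refine hG.exists_isCanonical hC (hS.1 C hC) ha hcC hac ?_
  rintro w ⟨hw, s, hs, hsw⟩
  have e3 := heq s hs
  by_cases hwb : w = b
  · subst hwb
    rw [dist_self, zero_add]
  · have e4 := hG.dist_gates hC hw hcC hsw hxb hwb
    rw [dist_comm (u := a) (v := b)] at e1
    by_cases hwa : w = a
    · subst hwa
      have e5 := hG.1.dist_triangle (u := s) (v := w) (w := x)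
      rw [dist_comm (u := w) (v := x)] at e5
      rw [dist_comm (u := w) (v := b)] at e4
      omega
    · have e5 := hG.dist_gates hC hw ha hsw hxa hwa
      rw [dist_comm (u := a) (v := x)] at e5
      omega

lemma IsBBR.nonempty (hG : IsCactus G) {S : Finset V} (hS : IsBBR G S) {C : G.Subgraph}
    (hC : C ∈ cycles G) (c : V) : ∃ s ∈ S, s ≠ c := by
  by_contra! h
  obtain ⟨v, hv, hcv⟩ := exists_gate hG.1 hC c
  obtain ⟨w, hw, hwv⟩ := Set.exists_ne_of_one_lt_ncard (s := {v | IsActive S C v}) (hS.1 C hC) v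
  obtain ⟨hwC, s, hs, hsw⟩ := hw
  rw [h s hs] at hsw
  exact hwv (hG.gate_eq hC hwC hv hsw hcv)

/-- Let x and x' be undistinguished and consider the middle of a geodesic: a vertex c with
neighbours y, z, or an edge yz. If the middle runs along a single cycle, `IsCactus.false_of_gates`
gives 𝒜 or 𝒞. A middle bridge is impossible, since any element of S is closer to the end on its own
side. Otherwise each side of c is an S-free pendant path or a cycle whose S-path ends at c or
shortly before. Two cycles are vertex-critically incident, a cycle and a path give ℬ, and two paths
contradict branch-resolution. -/
theorem IsBBR.isMetricGenerator [Finite V] (hG : IsCactus G) (hc : 2 ≤ numCycles G)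
    {S : Finset V} (hS : IsBBR G S) (hABC : ∀ C ∈ cycles G, ¬ ContainsABC S C)
    (hinc : ∀ C D : G.Subgraph, ¬ VertexCriticallyIncident S C D) : IsMetricGenerator G S := by
  classical
  intro x x' hne
  by_contra! heq
  -- Only the existence of some cycle is wanted here; ⊥ is a dummy.
  obtain ⟨C₀, hC₀, -⟩ := exists_ne_cycle hc ⊥
  obtain ⟨p, hp⟩ := hG.1.exists_walk_length_eq_dist x x'
  have hpos := hG.1.pos_dist_of_ne hne
  rcases Nat.even_or_odd' (G.dist x x') with ⟨h, hm | hm⟩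
  · set c := p.getVert h with hcdef
    set y := p.getVert (h - 1) with hydef
    set z := p.getVert (h + 1) with hzdef
    obtain ⟨dc, dc'⟩ := dist_getVert_of_geodesic hG.1 hp (i := h) (by omega)
    obtain ⟨dy, dy'⟩ := dist_getVert_of_geodesic hG.1 hp (i := h - 1) (by omega)
    obtain ⟨dz, dz'⟩ := dist_getVert_of_geodesic hG.1 hp (i := h + 1) (by omega)
    rw [← hcdef] at dc dc'
    rw [← hydef] at dy dy'
    rw [← hzdef] at dz dz'
    have hcz : G.Adj c z := p.adj_getVert_succ (by omega)
    have hcy : G.Adj c y := by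
      have := p.adj_getVert_succ (i := h - 1) (by omega)
      rw [show h - 1 + 1 = h by omega] at this
      exact this.symm
    have hyz : y ≠ z := by
      intro h'
      rw [h'] at dy
      omega
    rw [dist_comm] at dc dy dz
    by_cases hboth : ∃ C ∈ cycles G, s(c, y) ∈ C.edgeSet ∧ s(c, z) ∈ C.edgeSet
    · obtain ⟨C, hC, hyC, hzC⟩ := hboth
      obtain ⟨a, ha, hxa⟩ := exists_gate hG.1 hC x
      obtain ⟨b, hb, hxb⟩ := exists_gate hG.1 hC x'
      have hcC := (mem_verts_of_edge_mem hyC).1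
      have hyC' := (mem_verts_of_edge_mem hyC).2
      have hzC' := (mem_verts_of_edge_mem hzC).2
      have e1 := hG.dist_gate hC ha hxa hcC
      have e2 := hG.dist_gate hC ha hxa hyC'
      have e3 := hG.dist_gate hC ha hxa hzC'
      have e4 := hG.dist_gate hC hb hxb hcC
      have e5 := hG.dist_gate hC hb hxb hyC'
      have e6 := hG.dist_gate hC hb hxb hzC'
      rw [dist_comm (u := x)] at e1 e2 e3
      rw [dist_comm (u := x')] at e4 e5 e6
      have hab : a ≠ b := by
        rintro rfl
        omega
      have e7 := hG.dist_gates hC ha hb hxa hxb hab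
      rw [dist_comm (u := b) (v := x')] at e7
      exact hG.false_of_gates hc hS hC (hABC C hC) heq ha hb hxa hxb (by omega) (by omega)
    push Not at hboth
    have hboth' : ∀ C ∈ cycles G, s(c, z) ∈ C.edgeSet → s(c, y) ∉ C.edgeSet :=
      fun C hC h1 h2 => hboth C hC h2 h1
    have heq' : ∀ s ∈ S, G.dist s x' = G.dist s x := fun s hs => (heq s hs).symm
    by_cases hy : ∃ C ∈ cycles G, s(c, y) ∈ C.edgeSet
    · obtain ⟨C, hC, hyC⟩ := hy
      obtain ⟨u, q, k, J, hcan, hkJ, hJ, hqJ⟩ := hG.exists_isCanonical_of_mid hS heq hcz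
        (by omega) (by omega) (by omega) hC hyC (hboth C hC hyC)
      by_cases hz : ∃ D ∈ cycles G, s(c, z) ∈ D.edgeSet
      · obtain ⟨D, hD, hzD⟩ := hz
        obtain ⟨u', q', k', J', hcan', hkJ', hJ', hqJ'⟩ := hG.exists_isCanonical_of_mid hS heq' hcy
          (by omega) (by omega) (by omega) hD hzD (hboth' D hD hzD)
        have hCD : C ≠ D := by
          rintro rfl
          exact hboth C hC hyC hzD
        have hcC := (mem_verts_of_edge_mem hyC).1
        have hcD := (mem_verts_of_edge_mem hzD).1
        -- Lying on two cycles, c is branch-active and hence active on both, so its index J cannot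
        -- exceed k: c is the end of both S-paths.
        have h1 := hS.isActive hG hc hC (hG.isBranchActive_of_mem_two hC hD hCD hcC hcD)
        have h2 := hS.isActive hG hc hD (hG.isBranchActive_of_mem_two hD hC hCD.symm hcD hcC)
        rw [← hqJ] at h1
        rw [← hqJ'] at h2
        have g1 := hcan.1.isLabelling.three_le
        have g2 := hcan'.1.isLabelling.three_le
        have k1 := hcan.1.le (by omega) h1
        have k2 := hcan'.1.le (by omega) h2
        obtain rfl : J = k := by omega
        obtain rfl : J' = k' := by omega
        exact hinc C D ⟨hC, hD, hCD, c, ⟨u, q, J, hcan, Or.inr hqJ.symm, hJ⟩,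
          ⟨u', q', J', hcan', Or.inr hqJ'.symm, hJ'⟩⟩
      · push Not at hz
        obtain ⟨T, hcT, hST, hpT⟩ := hG.exists_pendantPath_of_bridge hc hS heq' hcz
          (by omega) (by omega) (by omega) hz
        obtain ⟨a, b, hab, ha, hb, -⟩ := exists_cycle_nbrs hC (mem_verts_of_edge_mem hyC).1
        have h3 : 3 ≤ G.degree c := by
          refine three_le_degree (C.adj_sub ha) (C.adj_sub hb) hcz hab ?_ ?_
          · rintro rfl
            exact hz C hC ha
          · rintro rfl
            exact hz C hC hb
        refine hABC C hC ⟨u, q, k, hcan, Or.inr (Or.inl ⟨by omega, J, Or.inl (Or.inl ⟨hkJ, hJ⟩), T, ?_⟩)⟩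
        rw [hqJ]
        exact ⟨hpT.isThread h3, hST⟩
    · push Not at hy
      obtain ⟨T, hcT, hST, hpT⟩ := hG.exists_pendantPath_of_bridge hc hS heq hcy
        (by omega) (by omega) (by omega) hy
      by_cases hz : ∃ D ∈ cycles G, s(c, z) ∈ D.edgeSet
      · obtain ⟨D, hD, hzD⟩ := hz
        obtain ⟨u', q', k', J', hcan', hkJ', hJ', hqJ'⟩ := hG.exists_isCanonical_of_mid hS heq' hcy
          (by omega) (by omega) (by omega) hD hzD (hboth' D hD hzD)
        obtain ⟨a, b, hab, ha, hb, -⟩ := exists_cycle_nbrs hD (mem_verts_of_edge_mem hzD).1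
        have h3 : 3 ≤ G.degree c := by
          refine three_le_degree (D.adj_sub ha) (D.adj_sub hb) hcy hab ?_ ?_
          · rintro rfl
            exact hy D hD ha
          · rintro rfl
            exact hy D hD hb
        refine hABC D hD ⟨u', q', k', hcan', Or.inr (Or.inl ⟨by omega, J', Or.inl (Or.inl ⟨hkJ', hJ'⟩), T, ?_⟩)⟩
        rw [hqJ']
        exact ⟨hpT.isThread h3, hST⟩
      · push Not at hz
        obtain ⟨T', hcT', hST', hpT'⟩ := hG.exists_pendantPath_of_bridge hc hS heq' hcz
          (by omega) (by omega) (by omega) hz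
        by_cases h3 : 3 ≤ G.degree c
        · exact hyz (hS.2.pendant_unique h3 hpT hpT' hST hST')
        -- When c has degree two, c and the two pendant paths exhaust the graph, leaving no place
        -- for an element of S other than c.
        · obtain ⟨s, hs, hsc⟩ := hS.nonempty hG hC₀ c
          have : s ∈ {v | v = c ∨ v ∈ T ∨ v ∈ T'} := by
            refine mem_of_reachable_of_closed ?_ (hG.1.preconnected c s) (Or.inl rfl)
            rintro v (rfl | hv | hv) w hvw
            · rcases eq_or_eq_of_degree_le_two (by omega) hcy hcz hyz hvw with rfl | rfl
              exacts [Or.inr (Or.inl hpT.mem), Or.inr (Or.inr hpT'.mem)]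
            · rcases hpT.closed hcT hv hvw with h | h
              exacts [Or.inr (Or.inl h), Or.inl h]
            · rcases hpT'.closed hcT' hv hvw with h | h
              exacts [Or.inr (Or.inr h), Or.inl h]
          rcases this with h | h | h
          exacts [hsc h, hST s hs h, hST' s hs h]
  · set y := p.getVert h with hydef
    set z := p.getVert (h + 1) with hzdef
    obtain ⟨dy, dy'⟩ := dist_getVert_of_geodesic hG.1 hp (i := h) (by omega)
    obtain ⟨dz, dz'⟩ := dist_getVert_of_geodesic hG.1 hp (i := h + 1) (by omega)
    rw [← hydef] at dy dy'
    rw [← hzdef] at dz dz'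
    have hyz : G.Adj y z := p.adj_getVert_succ (by omega)
    have h1 := dist_eq_one_iff_adj.2 hyz
    by_cases hcyc : ∃ C ∈ cycles G, s(y, z) ∈ C.edgeSet
    · obtain ⟨C, hC, hyC⟩ := hcyc
      obtain ⟨a, ha, hxa⟩ := exists_gate hG.1 hC x
      obtain ⟨b, hb, hxb⟩ := exists_gate hG.1 hC x'
      have hyC' := (mem_verts_of_edge_mem hyC).1
      have hzC' := (mem_verts_of_edge_mem hyC).2
      have e2 := hG.dist_gate hC ha hxa hyC'
      have e3 := hG.dist_gate hC ha hxa hzC'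
      have e5 := hG.dist_gate hC hb hxb hyC'
      have e6 := hG.dist_gate hC hb hxb hzC'
      rw [dist_comm (u := x')] at e5 e6
      have hab : a ≠ b := by
        rintro rfl
        omega
      have e7 := hG.dist_gates hC ha hb hxa hxb hab
      rw [dist_comm (u := b) (v := x')] at e7
      exact hG.false_of_gates hc hS hC (hABC C hC) heq ha hb hxa hxb (by omega) (by omega)
    · push Not at hcyc
      have hbridge : ¬ (G.deleteEdges {s(y, z)}).Reachable y z := by
        intro h
        obtain ⟨u, p, hp, hmem⟩ := adj_and_reachable_delete_edges_iff_exists_cycle.1 ⟨hyz, h⟩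
        exact hcyc p.toSubgraph ⟨u, p, hp, rfl⟩ (p.mem_edges_toSubgraph.2 hmem)
      set Y : Set V := {v | (G.deleteEdges {s(y, z)}).Reachable y v} with hY
      have hzY : z ∉ Y := hbridge
      have hyY : y ∈ Y := Reachable.refl _
      have hexit : ∀ a ∈ Y, ∀ b ∉ Y, G.Adj a b → a = y ∧ b = z := by
        intro a ha b hb hab
        have he : s(a, b) = s(y, z) := by
          by_contra he
          exact hb (Reachable.trans ha (Adj.reachable (by rw [deleteEdges_adj]; exact ⟨hab, he⟩)))
        rcases Sym2.eq_iff.1 he with h | ⟨rfl, -⟩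
        · exact h
        · exact absurd ha hzY
      have hl := fun a ha b hb hab => Or.inl (b := b = y) (hexit a ha b hb hab).1
      have hr := fun a ha b hb hab => Or.inr (a := a = z) (hexit a ha b hb hab).2
      have hx : x ∈ Y := by
        by_contra hx
        have := dist_eq_of_exit hG.1 hr hyY (Or.inl hx)
        rw [dist_comm (u := y) (v := x), dist_comm (u := z) (v := x)] at this
        omega
      have hx' : x' ∉ Y := by
        intro hx'
        have := dist_eq_of_exit hG.1 hl hx' (Or.inl hzY)
        rw [dist_comm (u := x') (v := z), dist_comm (u := x') (v := y)] at this
        omega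
      obtain ⟨s, hs, -⟩ := hS.nonempty hG hC₀ x
      have e1 := heq s hs
      by_cases hsY : s ∈ Y
      · have e2 := dist_eq_of_exit hG.1 hl hsY (Or.inl hx')
        have e3 := hG.1.dist_triangle (u := s) (v := y) (w := x)
        rw [dist_comm (u := y) (v := x)] at e3
        omega
      · have e2 := dist_eq_of_exit hG.1 hr hx (Or.inl hsY)
        have e3 := hG.1.dist_triangle (u := s) (v := z) (w := x')
        rw [dist_comm (u := x) (v := s), dist_comm (u := z) (v := s)] at e2
        omega

end

/-! ### Minimal BBR sets and their common size -/

section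

variable {V : Type*} {G : SimpleGraph V} [G.LocallyFinite]

/-! ### Minimal biactive branch-resolving sets -/

open Classical in
/-- A biactive branch-resolving set that is minimal under inclusion. -/
def IsMinimalBBR (G : SimpleGraph V) [G.LocallyFinite] (S : Finset V) : Prop :=
  IsBBR G S ∧ ∀ r ∈ S, ¬ IsBBR G (S.erase r)

lemma exists_isMinimalBBR_subset {R : Finset V} (hR : IsBBR G R) :
    ∃ S ⊆ R, IsMinimalBBR G S := by
  classical
  induction R using Finset.strongInduction with
  | H R ih =>
    by_cases h : ∃ r ∈ R, IsBBR G (R.erase r)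
    · obtain ⟨r, hr, hr'⟩ := h
      obtain ⟨S, hS, hS'⟩ := ih _ (Finset.erase_ssubset hr) hr'
      exact ⟨S, hS.trans (Finset.erase_subset _ _), hS'⟩
    · push Not at h
      refine ⟨R, subset_rfl, hR, fun r hr => ?_⟩
      convert h r hr

open Classical in
lemma IsFreeThread.of_erase {S : Finset V} {r v : V} {T : Set V}
    (h : IsFreeThread G (S.erase r) v T) (hr : r ∉ T) : IsFreeThread G S v T := by
  refine ⟨h.1, fun s hs hsT => h.2 s (Finset.mem_erase.2 ⟨?_, hs⟩) hsT⟩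
  rintro rfl
  exact hr hsT

open Classical in
lemma IsBranchResolving.erase_of_notMem {S : Finset V} (hS : IsBranchResolving G S) {r : V}
    (h : ∀ v T T', IsThread G v T → IsThread G v T' → T ≠ T' → r ∉ T) :
    IsBranchResolving G (S.erase r) := by
  intro v T T' hT hT'
  by_contra hne
  exact hne (hS v T T' (hT.of_erase (h v T T' hT.1 hT'.1 hne))
    (hT'.of_erase (h v T' T hT'.1 hT.1 (Ne.symm hne))))

section erase

variable [Finite V]

open Classical in
lemma IsBBR.erase (hG : IsCactus G) (hc : 2 ≤ numCycles G) {S : Finset V} (hS : IsBBR G S) {r : V}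
    (h1 : ∀ C : G.Subgraph, IsEndCycle C → r ∈ periphery C → ∃ s ∈ S, s ≠ r ∧ s ∈ periphery C)
    (h2 : IsBranchResolving G (S.erase r)) : IsBBR G (S.erase r) := by
  refine (hG.isBBR_iff hc).2 ⟨fun C hC => ?_, h2⟩
  by_cases hr : r ∈ periphery C
  · obtain ⟨s, hs, hsr, hsC⟩ := h1 C hC hr
    exact ⟨s, Finset.mem_erase.2 ⟨hsr, hs⟩, hsC⟩
  · obtain ⟨s, hs, hsC⟩ := ((hG.isBBR_iff hc).1 hS).1 C hC
    exact ⟨s, Finset.mem_erase.2 ⟨fun h => hr (h ▸ hsC), hs⟩, hsC⟩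

/-- An element serving neither an end-cycle nor a choice between rival threads could be erased. -/
lemma IsMinimalBBR.mem_cases (hG : IsCactus G) (hc : 2 ≤ numCycles G) {S : Finset V}
    (hS : IsMinimalBBR G S) {r : V} (hr : r ∈ S) :
    (∃ C : G.Subgraph, IsEndCycle C ∧ r ∈ periphery C) ∨
      ∃ v T T', IsThread G v T ∧ IsThread G v T' ∧ T ≠ T' ∧ r ∈ T := by
  by_contra! h
  exact hS.2 r hr (hS.1.erase hG hc (fun C hC hrC => absurd hrC (h.1 C hC))
    (hS.1.2.erase_of_notMem h.2))

/-- An element of this periphery lies in no other periphery and in no thread with a rival, so a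
second one is redundant. -/
lemma IsMinimalBBR.eq_of_mem_periphery (hG : IsCactus G) (hc : 2 ≤ numCycles G) {S : Finset V}
    (hS : IsMinimalBBR G S) {C : G.Subgraph} (hC : IsEndCycle C) {r r' : V} (hr : r ∈ S)
    (hr' : r' ∈ S) (hrC : r ∈ periphery C) (hrC' : r' ∈ periphery C) : r = r' := by
  by_contra hne
  refine hS.2 r hr (hS.1.erase hG hc (fun D hD hrD => ?_) (hS.1.2.erase_of_notMem ?_))
  · by_cases hCD : C = D
    · subst hCD
      exact ⟨r', hr', Ne.symm hne, hrC'⟩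
    · exact (hG.periphery_disjoint hC.1 hD.1 hCD hrC hrD).elim
  · intro v T T' hT hT' hTT hrT
    exact hT.notMem_periphery hT' hTT hC.1 hrT hrC

lemma IsMinimalBBR.eq_of_mem_thread (hG : IsCactus G) (hc : 2 ≤ numCycles G) {S : Finset V}
    (hS : IsMinimalBBR G S) {v : V} {T T' : Set V} (hT : IsThread G v T) (hT' : IsThread G v T')
    (hTT : T ≠ T') {r r' : V} (hr : r ∈ S) (hr' : r' ∈ S) (hrT : r ∈ T) (hrT' : r' ∈ T) :
    r = r' := by
  classical
  by_contra hne
  refine hS.2 r hr (hS.1.erase hG hc (fun D hD hrD => ?_) ?_)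
  · exact absurd hrD (hT.notMem_periphery hT' hTT hD.1 hrT)
  · have key : ∀ w U, IsFreeThread G (S.erase r) w U → IsFreeThread G S w U := by
      intro w U hU
      refine hU.of_erase fun hrU => ?_
      obtain ⟨rfl, -⟩ := hU.1.eq_of_mem hT hrU hrT
      exact hU.2 r' (Finset.mem_erase.2 ⟨Ne.symm hne, hr'⟩) hrT'
    exact fun w U U' hU hU' => hS.1.2 w U U' (key w U (by convert hU)) (key w U' (by convert hU'))

/-- If all threads at v were hit, erasing an element of T could free only T, and a single free
thread at v does no harm. -/
lemma IsMinimalBBR.exists_free_of_two (hG : IsCactus G) (hc : 2 ≤ numCycles G) {S : Finset V}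
    (hS : IsMinimalBBR G S) {v : V} {T T' : Set V} (hT : IsThread G v T) (hT' : IsThread G v T')
    (hTT : T ≠ T') : ∃ U, IsFreeThread G S v U := by
  classical
  by_contra! hno
  have hhit : ∀ U, IsThread G v U → ∃ s ∈ S, s ∈ U := by
    intro U hU
    by_contra! h
    exact hno U ⟨hU, h⟩
  obtain ⟨r, hr, hrT⟩ := hhit T hT
  have key : ∀ w U, IsFreeThread G (S.erase r) w U → IsFreeThread G S w U ∨ (w = v ∧ U = T) := by
    intro w U hU
    by_cases hrU : r ∈ U
    · obtain ⟨h1, h2⟩ := hU.1.eq_of_mem hT hrU hrT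
      exact Or.inr ⟨h2, h1⟩
    · exact Or.inl (hU.of_erase hrU)
  refine hS.2 r hr (hS.1.erase hG hc (fun D hD hrD => ?_) ?_)
  · exact absurd hrD (hT.notMem_periphery hT' hTT hD.1 hrT)
  · intro w U U' hU hU'
    rcases key w U (by convert hU) with h | ⟨rfl, rfl⟩ <;>
      rcases key w U' (by convert hU') with h' | ⟨h1, rfl⟩
    · exact hS.1.2 w U U' h h'
    · subst h1
      exact absurd h (hno U)
    · exact absurd h' (hno U')
    · rfl

/-- At a branch-active vertex with a thread, a minimal set leaves a thread free. -/
lemma IsMinimalBBR.exists_free (hG : IsCactus G) (hc : 2 ≤ numCycles G) {S : Finset V}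
    (hS : IsMinimalBBR G S) {C : G.Subgraph} (hC : C ∈ cycles G) {v : V} (hv : IsBranchActive C v)
    {T : Set V} (hT : IsThread G v T) : ∃ U, IsFreeThread G S v U := by
  by_cases htwo : ∃ T', IsThread G v T' ∧ T ≠ T'
  · obtain ⟨T', hT', hTT⟩ := htwo
    exact hS.exists_free_of_two hG hc hT hT' hTT
  · push Not at htwo
    refine ⟨T, hT, fun r hr hrT => ?_⟩
    rcases hS.mem_cases hG hc hr with ⟨D, hD, hrD⟩ | ⟨w, U, U', hU, hU', hUU, hrU⟩
    · obtain ⟨hvD, hvD'⟩ := hT.of_mem_periphery hD.1 hrT hrD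
      by_cases hCD : C = D
      · exact hvD' (hCD ▸ hv)
      · exact hvD' (hG.isBranchActive_of_mem_two hD.1 hC (Ne.symm hCD) hvD hv.1)
    · obtain ⟨rfl, rfl⟩ := hT.eq_of_mem hU hrT hrU
      exact hUU (htwo U' hU')

lemma IsMinimalBBR.notMem_periphery (hG : IsCactus G) (hc : 2 ≤ numCycles G) {S : Finset V}
    (hS : IsMinimalBBR G S) {C : G.Subgraph} (hC : C ∈ cycles G) (hCe : ¬ IsEndCycle C) {r : V}
    (hr : r ∈ S) : r ∉ periphery C := by
  intro hrC
  rcases hS.mem_cases hG hc hr with ⟨D, hD, hrD⟩ | ⟨w, U, U', hU, hU', hUU, hrU⟩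
  · exact hG.periphery_disjoint hC hD.1 (fun h => hCe (h ▸ hD)) hrC hrD
  · exact hU.notMem_periphery hU' hUU hC hrU hrC

end erase

/-! ### The size of a minimal set -/

/-- Sending an element to its thread is a bijection onto the threads at v other than the free one.
-/
lemma IsMinimalBBR.ncard_threads [Finite V] (hG : IsCactus G) (hc : 2 ≤ numCycles G) {S : Finset V}
    (hS : IsMinimalBBR G S) {v : V} (hv : 1 < numThreads G v) :
    {s | s ∈ S ∧ ∃ T, IsThread G v T ∧ s ∈ T}.ncard = numThreads G v - 1 := by
  obtain ⟨T, T', hT, hT', hTT⟩ := (Set.one_lt_ncard_iff (Set.toFinite _)).1 hv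
  obtain ⟨U, hU⟩ := hS.exists_free_of_two hG hc hT hT' hTT
  have hother : ∀ W, IsThread G v W → ∃ W', IsThread G v W' ∧ W ≠ W' := by
    intro W hW
    by_cases h : W = T
    · exact ⟨T', hT', h ▸ hTT⟩
    · exact ⟨T, hT, h⟩
  rw [show numThreads G v - 1 = ({T | IsThread G v T} \ {U}).ncard from
    (Set.ncard_sdiff_singleton_of_mem (show U ∈ {T | IsThread G v T} from hU.1)).symm]
  refine Set.ncard_congr (fun s hs => hs.2.choose) ?_ ?_ ?_
  · intro s hs
    refine ⟨hs.2.choose_spec.1, fun h => ?_⟩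
    have := hs.2.choose_spec.2
    rw [Set.mem_singleton_iff.1 h] at this
    exact hU.2 s hs.1 this
  · intro s s' hs hs' heq
    obtain ⟨h1, h2⟩ := hs.2.choose_spec
    obtain ⟨h1', h2'⟩ := hs'.2.choose_spec
    obtain ⟨W', hW', hne⟩ := hother _ h1
    exact hS.eq_of_mem_thread hG hc h1 hW' hne hs.1 hs'.1 h2 (heq ▸ h2')
  · rintro W ⟨hW, hWU⟩
    have : ∃ s ∈ S, s ∈ W := by
      by_contra! h
      exact hWU (hS.1.2 v W U ⟨hW, h⟩ hU)
    obtain ⟨s, hs, hsW⟩ := this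
    have hs' : s ∈ {s | s ∈ S ∧ ∃ T, IsThread G v T ∧ s ∈ T} := ⟨hs, W, hW, hsW⟩
    refine ⟨s, hs', ?_⟩
    exact (hs'.2.choose_spec.1.eq_of_mem hW hs'.2.choose_spec.2 hsW).1

lemma IsMinimalBBR.ncard_peripheries [Finite V] (hG : IsCactus G) (hc : 2 ≤ numCycles G)
    {S : Finset V} (hS : IsMinimalBBR G S) :
    {s | s ∈ S ∧ ∃ C : G.Subgraph, IsEndCycle C ∧ s ∈ periphery C}.ncard =
      {C : G.Subgraph | IsEndCycle C}.ncard := by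
  refine Set.ncard_congr (fun s hs => hs.2.choose) ?_ ?_ ?_
  · intro s hs
    exact hs.2.choose_spec.1
  · intro s s' hs hs' heq
    obtain ⟨h1, h2⟩ := hs.2.choose_spec
    obtain ⟨h1', h2'⟩ := hs'.2.choose_spec
    exact hS.eq_of_mem_periphery hG hc h1 hs.1 hs'.1 h2 (heq ▸ h2')
  · intro C hC
    obtain ⟨s, hs, hsC⟩ := ((hG.isBBR_iff hc).1 hS.1).1 C hC
    have hs' : s ∈ {s | s ∈ S ∧ ∃ C : G.Subgraph, IsEndCycle C ∧ s ∈ periphery C} :=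
      ⟨hs, C, hC, hsC⟩
    refine ⟨s, hs', ?_⟩
    by_contra hne
    exact hG.periphery_disjoint hs'.2.choose_spec.1.1 hC.1 hne hs'.2.choose_spec.2 hsC

/-- The elements split into those in peripheries, one per end-cycle, and those in rival threads,
ℓ(v) - 1 per vertex. The value does not depend on S, which is why minimal and smallest sets coincide
below. -/
lemma IsMinimalBBR.card_eq [Fintype V] (hG : IsCactus G) (hc : 2 ≤ numCycles G) {S : Finset V}
    (hS : IsMinimalBBR G S) :
    S.card = leafNumber G + {C : G.Subgraph | IsEndCycle C}.ncard := by
  classical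
  set A := S.filter fun s => ∃ C : G.Subgraph, IsEndCycle C ∧ s ∈ periphery C with hA
  set I := (Finset.univ : Finset V).filter fun v => 1 < numThreads G v with hI
  set F : V → Finset V := fun v => S.filter fun s => ∃ T, IsThread G v T ∧ s ∈ T with hF
  have hAcard : A.card = {C : G.Subgraph | IsEndCycle C}.ncard := by
    rw [← hS.ncard_peripheries hG hc, ← Set.ncard_coe_finset]
    congr 1
    ext s
    simp [hA]
  have hFcard : ∀ v ∈ I, (F v).card = numThreads G v - 1 := by
    intro v hv
    rw [← hS.ncard_threads hG hc (Finset.mem_filter.1 hv).2, ← Set.ncard_coe_finset]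
    congr 1
    ext s
    simp [hF]
  have hdisjF : (I : Set V).PairwiseDisjoint F := by
    intro v hv w hw hvw
    refine Finset.disjoint_left.2 fun s hsv hsw => hvw ?_
    obtain ⟨-, T, hT, hsT⟩ := Finset.mem_filter.1 hsv
    obtain ⟨-, T', hT', hsT'⟩ := Finset.mem_filter.1 hsw
    exact (hT.eq_of_mem hT' hsT hsT').2
  have htwo : ∀ v ∈ I, ∀ T, IsThread G v T → ∃ T', IsThread G v T' ∧ T ≠ T' := by
    intro v hv T hT
    obtain ⟨T', hT', hne⟩ := Set.exists_ne_of_one_lt_ncard (s := {T | IsThread G v T})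
      (Finset.mem_filter.1 hv).2 T
    exact ⟨T', hT', hne.symm⟩
  have hdisj : Disjoint A (I.biUnion F) := by
    refine Finset.disjoint_left.2 fun s hsA hsF => ?_
    obtain ⟨-, C, hC, hsC⟩ := Finset.mem_filter.1 hsA
    obtain ⟨v, hv, hsv⟩ := Finset.mem_biUnion.1 hsF
    obtain ⟨-, T, hT, hsT⟩ := Finset.mem_filter.1 hsv
    obtain ⟨T', hT', hne⟩ := htwo v hv T hT
    exact hT.notMem_periphery hT' hne hC.1 hsT hsC
  have hunion : S = A ∪ I.biUnion F := by
    ext s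
    constructor
    · intro hs
      rcases hS.mem_cases hG hc hs with h | ⟨v, T, T', hT, hT', hne, hsT⟩
      · exact Finset.mem_union_left _ (Finset.mem_filter.2 ⟨hs, h⟩)
      · refine Finset.mem_union_right _ (Finset.mem_biUnion.2 ⟨v, ?_, ?_⟩)
        · exact Finset.mem_filter.2 ⟨Finset.mem_univ _,
            (Set.one_lt_ncard_iff (Set.toFinite _)).2 ⟨T, T', hT, hT', hne⟩⟩
        · exact Finset.mem_filter.2 ⟨hs, T, hT, hsT⟩
    · intro hs
      rcases Finset.mem_union.1 hs with h | h
      · exact (Finset.mem_filter.1 h).1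
      · obtain ⟨v, -, hsv⟩ := Finset.mem_biUnion.1 h
        exact (Finset.mem_filter.1 hsv).1
  rw [hunion, Finset.card_union_of_disjoint hdisj, Finset.card_biUnion hdisjF,
    Finset.sum_congr rfl hFcard, hAcard, add_comm]
  rfl

lemma IsCactus.isSmallestBBR_iff [Fintype V] (hG : IsCactus G) (hc : 2 ≤ numCycles G)
    {S : Finset V} : IsSmallestBBR G S ↔ IsMinimalBBR G S := by
  classical
  constructor
  · rintro ⟨hS, hmin⟩
    refine ⟨hS, fun r hr h => ?_⟩
    have h1 := hmin _ h
    have h2 := Finset.card_erase_lt_of_mem hr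
    convert absurd h1 (not_le.2 ?_) using 1
    convert h2
  · intro hS
    refine ⟨hS.1, fun R hR => ?_⟩
    obtain ⟨S', hS'R, hS'⟩ := exists_isMinimalBBR_subset hR
    rw [hS.card_eq hG hc, ← hS'.card_eq hG hc]
    exact Finset.card_le_card hS'R

lemma IsEndCycle.exists_mem_periphery {C : G.Subgraph} (hC : IsEndCycle C) :
    ∃ w, w ∈ periphery C := by
  obtain ⟨r, hr⟩ := Set.ncard_eq_one.1 hC.2
  have hrC : IsBranchActive C r := by
    have : r ∈ {v | IsBranchActive C v} := hr ▸ rfl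
    exact this
  obtain ⟨a, b, hab, ha, hb, -⟩ := exists_cycle_nbrs hC.1 hrC.1
  refine ⟨a, a, (mem_verts_of_edge_mem ha).2, fun h => ?_, self_mem_branch C a⟩
  have : a ∈ {v | IsBranchActive C v} := h
  rw [hr] at this
  exact (C.adj_sub ha).ne this.symm

lemma IsCactus.exists_isSmallestBBR [Fintype V] (hG : IsCactus G) (hc : 2 ≤ numCycles G) :
    ∃ S : Finset V, IsSmallestBBR G S := by
  have huniv : IsBBR G (Finset.univ : Finset V) := by
    refine (hG.isBBR_iff hc).2 ⟨fun C hC => ?_, fun v T T' hT _ => ?_⟩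
    · obtain ⟨w, hw⟩ := hC.exists_mem_periphery
      exact ⟨w, Finset.mem_univ _, hw⟩
    · obtain ⟨t, ht⟩ := hT.1.nonempty
      exact absurd ht (hT.2 t (Finset.mem_univ _))
  obtain ⟨S, -, hS⟩ := exists_isMinimalBBR_subset huniv
  exact ⟨S, (hG.isSmallestBBR_iff hc).2 hS⟩

end

/-! ### Exchange, nice sets, and the two general bounds -/

section

variable {V : Type*} {G : SimpleGraph V}

/-! ### Sets with the same active vertices on a cycle -/

section congr

variable {S R : Finset V} {C : G.Subgraph}

lemma hasSpan_congr (h : ∀ v, IsActive S C v ↔ IsActive R C v) {u : V} {p : G.Walk u u} {k : ℕ} :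
    HasSpan S C p k ↔ HasSpan R C p k := by
  simp only [HasSpan, h]

lemma isCanonical_congr (h : ∀ v, IsActive S C v ↔ IsActive R C v) {u : V} {p : G.Walk u u}
    {k : ℕ} : IsCanonical S C p k ↔ IsCanonical R C p k := by
  simp only [IsCanonical, hasSpan_congr h]

lemma isVertexCritical_congr (h : ∀ v, IsActive S C v ↔ IsActive R C v) {v : V} :
    IsVertexCritical S C v ↔ IsVertexCritical R C v := by
  simp only [IsVertexCritical, isCanonical_congr h]

lemma numActive_congr (h : ∀ v, IsActive S C v ↔ IsActive R C v) :
    numActive S C = numActive R C := by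
  simp only [numActive, h]

variable [G.LocallyFinite]

lemma IsFreeThread.mono (hSR : S ⊆ R) {v : V} {T : Set V} (h : IsFreeThread G R v T) :
    IsFreeThread G S v T :=
  ⟨h.1, fun s hs => h.2 s (hSR hs)⟩

lemma ContainsABC.mono (h : ∀ v, IsActive S C v ↔ IsActive R C v) (hSR : S ⊆ R)
    (hR : ContainsABC R C) : ContainsABC S C := by
  obtain ⟨u, p, k, hcan, hABC⟩ := hR
  refine ⟨u, p, k, (isCanonical_congr h).2 hcan, ?_⟩
  rcases hABC with ⟨h1, h2⟩ | ⟨hk, i, hi, T, hT⟩ | ⟨h1, h2, h3, i, hi, T, hT, hl⟩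
  · exact Or.inl ⟨(numActive_congr h).trans h1, h2⟩
  · exact Or.inr (Or.inl ⟨hk, i, hi, T, hT.mono hSR⟩)
  · exact Or.inr (Or.inr ⟨(numActive_congr h).trans h1, h2, h3, i, hi, T, hT.mono hSR, hl⟩)

lemma IsBBR.isActive_congr [Finite V] (hG : IsCactus G) (hc : 2 ≤ numCycles G) (hS : IsBBR G S)
    (hR : IsBBR G R) (hC : C ∈ cycles G) (htr : ∀ w ∈ periphery C, w ∈ S ↔ w ∈ R) (v : V) :
    IsActive S C v ↔ IsActive R C v := by
  by_cases hv : IsBranchActive C v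
  · exact ⟨fun _ => hR.isActive hG hc hC hv, fun _ => hS.isActive hG hc hC hv⟩
  · constructor <;> rintro ⟨hvC, s, hs, hsv⟩
    · exact ⟨hvC, s, (htr s ⟨v, hvC, hv, hsv⟩).1 hs, hsv⟩
    · exact ⟨hvC, s, (htr s ⟨v, hvC, hv, hsv⟩).2 hs, hsv⟩

/-- If two sets agree on the periphery of `C` but only one of them has a configuration on `C`, then
the difference is due to the threads at a vertex-critical branch-active vertex. -/
lemma IsBBR.exists_isVertexCritical [Finite V] (hG : IsCactus G) (hc : 2 ≤ numCycles G)
    (hS : IsBBR G S) (hR : IsBBR G R) (hC : C ∈ cycles G)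
    (htr : ∀ w ∈ periphery C, w ∈ S ↔ w ∈ R) (hSC : ContainsABC S C) (hRC : ¬ ContainsABC R C) :
    ∃ v, IsBranchActive C v ∧ IsVertexCritical S C v ∧ IsVertexCritical R C v ∧
      (∃ T, IsFreeThread G S v T) ∧ ∀ T, ¬ IsFreeThread G R v T := by
  have hact := hS.isActive_congr hG hc hR hC htr
  obtain ⟨u, p, k, hcan, hABC⟩ := hSC
  have hcanR := (isCanonical_congr hact).1 hcan
  have hspan := hcan.1
  have hl := hspan.isLabelling
  have h3 := hl.three_le
  have hnum := numActive_congr hact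
  -- At a vertex that is not branch-active the thread lies in the periphery, where S and R agree.
  have hbranch : ∀ v ∈ C.verts, ∀ T, IsFreeThread G S v T → ¬ IsFreeThread G R v T →
      IsBranchActive C v := by
    intro v hv T hT hTR
    by_contra hva
    refine hTR ⟨hT.1, fun r hr hrT => ?_⟩
    exact hT.2 r ((htr r ⟨v, hv, hva, hT.1.subset_branch hC hrT⟩).2 hr) hrT
  have hnoA : ¬ ConfigA R C p k := fun h => hRC ⟨u, p, k, hcanR, Or.inl h⟩
  have hnoB : ¬ ConfigB R p k := fun h => hRC ⟨u, p, k, hcanR, Or.inr (Or.inl h)⟩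
  have hnoC : ¬ ConfigC R C p k := fun h => hRC ⟨u, p, k, hcanR, Or.inr (Or.inr h)⟩
  have fin : ∀ i, i = 0 ∨ i = k → k ≤ p.length / 2 - 1 → IsBranchActive C (p.getVert i) →
      (∃ T, IsFreeThread G S (p.getVert i) T) →
      ∃ v, IsBranchActive C v ∧ IsVertexCritical S C v ∧ IsVertexCritical R C v ∧
        (∃ T, IsFreeThread G S v T) ∧ ∀ T, ¬ IsFreeThread G R v T := by
    intro i hi hk hba hT
    have hv : p.getVert i = p.getVert 0 ∨ p.getVert i = p.getVert k := by
      rcases hi with rfl | rfl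
      exacts [Or.inl rfl, Or.inr rfl]
    refine ⟨p.getVert i, hba, ⟨u, p, k, hcan, hv, hk⟩, ⟨u, p, k, hcanR, hv, hk⟩, hT,
      fun T' hT' => hnoB ⟨hk, i, ?_, T', hT'⟩⟩
    rcases hi with rfl | rfl
    · exact Or.inr rfl
    · exact Or.inl (Or.inl ⟨le_rfl, hk⟩)
  rcases hABC with ⟨h1, h2⟩ | ⟨hk, i, hi, T, hT⟩ | ⟨h1, h2, hk, i, hi, T, hT, hlen⟩
  · exact absurd ⟨hnum.symm.trans h1, h2⟩ hnoA
  · have hig := (exists_shift h3 hk hi).1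
    have hba := hbranch _ (hl.getVert_mem i) T hT fun h => hnoB ⟨hk, i, hi, T, h⟩
    -- An active index is at most k, so the index set of ℬ leaves only 0 and k.
    have hik := hspan.le hig (hS.isActive hG hc hC hba)
    refine fin i ?_ hk hba ⟨T, hT⟩
    rcases hi with (hi | hi) | hi
    · exact Or.inr (le_antisymm hik hi.1)
    · have := hi.1
      omega
    · exact Or.inl hi
  · have hkA : k ≠ p.length / 2 := fun h => hnoA ⟨hnum.symm.trans h1, h2, h⟩
    have hba := hbranch _ (hl.getVert_mem i) T hT
      fun h => hnoC ⟨hnum.symm.trans h1, h2, hk, i, hi, T, h, hlen⟩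
    have hig : i < p.length := by
      have := hi.2
      have := hspan.lt
      omega
    exact fin i (hspan.eq_or_eq h1 hig (hS.isActive hG hc hC hba)) (by omega) hba ⟨T, hT⟩

/-- For minimal sets, the configurations on `C` depend only on the trace on the periphery. -/
lemma IsMinimalBBR.containsABC [Finite V] (hG : IsCactus G) (hc : 2 ≤ numCycles G)
    (hS : IsMinimalBBR G S) (hR : IsMinimalBBR G R) (hC : C ∈ cycles G)
    (htr : ∀ w ∈ periphery C, w ∈ S ↔ w ∈ R) (hSC : ContainsABC S C) : ContainsABC R C := by
  by_contra hRC
  obtain ⟨v, hv, -, -, ⟨T, hT⟩, hno⟩ := hS.1.exists_isVertexCritical hG hc hR.1 hC htr hSC hRC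
  obtain ⟨U, hU⟩ := hR.exists_free hG hc hC hv hT.1
  exact hno U hU

end congr

/-! ### The metric dimension -/

lemma metricDim_le {S : Finset V} (hS : IsMetricGenerator G S) : metricDim G ≤ S.card :=
  Nat.sInf_le ⟨S, hS, rfl⟩

lemma exists_card_eq_metricDim [Fintype V] (hG : G.Connected) :
    ∃ R : Finset V, IsMetricGenerator G R ∧ R.card = metricDim G := by
  have : {n | ∃ S : Finset V, IsMetricGenerator G S ∧ S.card = n}.Nonempty := by
    refine ⟨_, Finset.univ, fun x y hxy => ⟨x, Finset.mem_univ x, ?_⟩, rfl⟩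
    rw [dist_self]
    exact (hG.pos_dist_of_ne hxy).ne
  exact Nat.sInf_mem this

/-! ### Exchanging the vertex in the periphery of an end-cycle -/

variable [G.LocallyFinite]

/-- Replacing the trace on the periphery of C by a does not affect rival threads, which avoid every
periphery, nor the peripheries of other cycles; and the set does not grow. -/
lemma IsMinimalBBR.exists_exchange [Fintype V] (hG : IsCactus G) (hc : 2 ≤ numCycles G)
    {S : Finset V} (hS : IsMinimalBBR G S) {C : G.Subgraph} (hC : IsEndCycle C) {a : V}
    (ha : a ∈ periphery C) : ∃ S' : Finset V, IsMinimalBBR G S' ∧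
      (∀ w ∈ periphery C, w ∈ S' ↔ w = a) ∧
      ∀ D ∈ cycles G, D ≠ C → ∀ w ∈ periphery D, w ∈ S' ↔ w ∈ S := by
  classical
  have hL := (hG.isBBR_iff hc).1 hS.1
  set S' := insert a (S.filter fun w => w ∉ periphery C) with hS'
  have hmem : ∀ w, w ∈ S' ↔ w = a ∨ (w ∈ S ∧ w ∉ periphery C) := by
    intro w
    simp [hS']
  have htr : ∀ D ∈ cycles G, D ≠ C → ∀ w ∈ periphery D, w ∈ S' ↔ w ∈ S := by
    intro D hD hDC w hw
    have hwC : w ∉ periphery C := fun h => hG.periphery_disjoint hD hC.1 hDC hw h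
    rw [hmem]
    constructor
    · rintro (rfl | h)
      exacts [absurd ha hwC, h.1]
    · exact fun h => Or.inr ⟨h, hwC⟩
  have hBBR : IsBBR G S' := by
    refine (hG.isBBR_iff hc).2 ⟨fun D hD => ?_, fun v T T' hT hT' => ?_⟩
    · by_cases hDC : D = C
      · subst hDC
        exact ⟨a, (hmem a).2 (Or.inl rfl), ha⟩
      · obtain ⟨s, hs, hsD⟩ := hL.1 D hD
        exact ⟨s, (htr D hD.1 hDC s hsD).2 hs, hsD⟩
    · by_contra hne
      have key : ∀ U U', IsFreeThread G S' v U → IsThread G v U' → U ≠ U' →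
          IsFreeThread G S v U := by
        intro U U' hU hU' hUU
        refine ⟨hU.1, fun s hs hsU => hU.2 s ((hmem s).2 (Or.inr ⟨hs, ?_⟩)) hsU⟩
        exact hU.1.notMem_periphery hU' hUU hC.1 hsU
      exact hne (hL.2 v T T' (key T T' hT hT'.1 hne) (key T' T hT' hT.1 (Ne.symm hne)))
  have hcard : S'.card ≤ S.card := by
    obtain ⟨s, hs, hsC⟩ := hL.1 C hC
    have hlt : (S.filter fun w => w ∉ periphery C).card < S.card :=
      Finset.card_lt_card (Finset.filter_ssubset.2 ⟨s, hs, fun h => h hsC⟩)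
    exact (Finset.card_insert_le _ _).trans hlt
  refine ⟨S', ?_, ?_, htr⟩
  · rw [← hG.isSmallestBBR_iff hc] at hS ⊢
    exact ⟨hBBR, fun R hR => hcard.trans (hS.2 R hR)⟩
  · intro w hw
    rw [hmem]
    exact ⟨fun h => h.resolve_right fun h' => h'.2 hw, Or.inl⟩

/-- Take a smallest set with fewest bad negative cycles. At a bad end-cycle the trace of a good set
can be copied in by an exchange, and other cycles stay good if they were. On a cycle that is not an
end-cycle all minimal sets have empty trace, so a negative one is never bad. -/
lemma IsCactus.exists_isABCAdmissible [Fintype V] (hG : IsCactus G) (hc : 2 ≤ numCycles G) :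
    ∃ S : Finset V, IsABCAdmissible G S := by
  obtain ⟨S, hS, hmin⟩ := Set.exists_min_image {S : Finset V | IsSmallestBBR G S}
    (fun S => {C : G.Subgraph | IsABCNegative C ∧ ContainsABC S C}.ncard) (Set.toFinite _)
    (hG.exists_isSmallestBBR hc)
  refine ⟨S, hS, fun C hC hSC => ?_⟩
  have hSm := (hG.isSmallestBBR_iff hc).1 hS
  obtain ⟨hCc, R, hR, hRC⟩ := id hC
  have hRm := (hG.isSmallestBBR_iff hc).1 hR
  by_cases hCe : IsEndCycle C
  · obtain ⟨a, haR, ha⟩ := ((hG.isBBR_iff hc).1 hR.1).1 C hCe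
    obtain ⟨S', hS', htrC, htr⟩ := hSm.exists_exchange hG hc hCe ha
    have hle := hmin S' ((hG.isSmallestBBR_iff hc).2 hS')
    have hno : ¬ ContainsABC S' C := by
      intro h
      refine hRC (hS'.containsABC hG hc hRm hCc (fun w hw => ?_) h)
      rw [htrC w hw]
      constructor
      · rintro rfl
        exact haR
      · exact fun hwR => hRm.eq_of_mem_periphery hG hc hCe hwR haR hw ha
    have hlt : {D : G.Subgraph | IsABCNegative D ∧ ContainsABC S' D} ⊂
        {D : G.Subgraph | IsABCNegative D ∧ ContainsABC S D} := by
      refine ⟨fun D hD => ⟨hD.1, ?_⟩, fun h => hno (h (show C ∈ _ from ⟨hC, hSC⟩)).2⟩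
      by_cases hDC : D = C
      · exact hDC ▸ hSC
      · exact hS'.containsABC hG hc hSm hD.1.1 (htr D hD.1.1 hDC) hD.2
    exact absurd (Set.ncard_lt_ncard hlt (Set.toFinite _)) (not_lt.2 hle)
  · refine hRC (hSm.containsABC hG hc hRm hCc (fun w hw => ?_) hSC)
    exact ⟨fun h => absurd hw (hSm.notMem_periphery hG hc hCc hCe h),
      fun h => absurd hw (hRm.notMem_periphery hG hc hCc hCe h)⟩

lemma IsCactus.exists_isNice [Fintype V] (hG : IsCactus G) (hc : 2 ≤ numCycles G) :
    ∃ S : Finset V, IsNice G S := by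
  obtain ⟨S, hS, hmin⟩ := Set.exists_min_image {S : Finset V | IsABCAdmissible G S}
    (numIncidentPairs G) (Set.toFinite _) (hG.exists_isABCAdmissible hc)
  exact ⟨S, hS, hmin⟩

/-! ### An upper bound for the metric dimension -/

/-- Pairwise distances with sum g mean that no arc shorter than g/2 contains the three positions. -/
lemma exists_third_position {g j : ℕ} (hg : 3 ≤ g) (h0 : 0 < j) (hj : j < g) :
    ∃ i < g, i ≠ 0 ∧ i ≠ j ∧ cycDist g 0 i + cycDist g i j + cycDist g 0 j = g := by
  unfold cycDist
  by_cases h : 2 * j ≤ g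
  · exact ⟨g / 2 + 1, by omega, by omega, by omega, by omega⟩
  · exact ⟨g / 2, by omega, by omega, by omega, by omega⟩

/-- Every cycle has a vertex whose addition to `S` destroys all configurations and critical
vertices of the cycle. -/
lemma IsCactus.exists_third [Finite V] (hG : IsCactus G) {S : Finset V} {C : G.Subgraph}
    (hC : C ∈ cycles G) (h2 : 2 ≤ numActive S C) :
    ∃ x ∈ C.verts, ∀ R : Finset V, S ⊆ R → x ∈ R →
      ¬ ContainsABC R C ∧ ∀ v, ¬ IsVertexCritical R C v := by
  obtain ⟨v, w, hv, hw, hne⟩ := (Set.one_lt_ncard_iff (Set.toFinite _)).1 h2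
  have hva : IsActive S C v := hv
  have hwa : IsActive S C w := hw
  obtain ⟨p, hp⟩ := exists_labelling hC hva.1
  obtain ⟨j, hj, rfl⟩ := hp.exists_index hwa.1
  have h3 := hp.three_le
  have hj0 : 0 < j := by
    rcases Nat.eq_zero_or_pos j with rfl | h
    · simp at hne
    · exact h
  obtain ⟨i, hi, hi0, hij, hsum⟩ := exists_third_position h3 hj0 hj
  refine ⟨p.getVert i, hp.getVert_mem i, fun R hSR hxR => ?_⟩
  have hmono : ∀ y, IsActive S C y → IsActive R C y :=
    fun y ⟨hy, s, hs, hsy⟩ => ⟨hy, s, hSR hs, hsy⟩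
  have a0 : IsActive R C (p.getVert 0) := by
    rw [Walk.getVert_zero]
    exact hmono _ hva
  have ai : IsActive R C (p.getVert i) := ⟨hp.getVert_mem i, _, hxR, self_mem_branch C _⟩
  have aj : IsActive R C (p.getVert j) := hmono _ hwa
  have hnum : 2 < numActive R C := by
    unfold numActive
    rw [Set.two_lt_ncard_iff (Set.toFinite _)]
    refine ⟨p.getVert 0, p.getVert i, p.getVert j, a0, ai, aj, fun h => ?_, fun h => ?_, fun h => ?_⟩
    · exact hi0 (hp.inj (by omega) hi h).symm
    · have := hp.inj (by omega) hj h
      omega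
    · exact hij (hp.inj hi hj h)
  -- On an arc of length k the three pairwise distances sum to at most 2k, which is less than g.
  have hlong : ∀ (u : V) (q : G.Walk u u) (k : ℕ), HasSpan R C q k → ¬ k ≤ q.length / 2 - 1 := by
    intro u q k hq hk
    obtain ⟨b0, hb0, hb0', e0⟩ := hq.exists_index_le a0
    obtain ⟨bi, hbi, hbi', ei⟩ := hq.exists_index_le ai
    obtain ⟨bj, hbj, hbj', ej⟩ := hq.exists_index_le aj
    have hg : q.length = p.length := hq.isLabelling.length_eq.trans hp.length_eq.symm
    rw [← hG.dist_getVert hp (by omega) hi, ← hG.dist_getVert hp hi hj,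
      ← hG.dist_getVert hp (by omega) hj, ← e0, ← ei, ← ej,
      hG.dist_getVert hq.isLabelling hb0' hbi', hG.dist_getVert hq.isLabelling hbi' hbj',
      hG.dist_getVert hq.isLabelling hb0' hbj'] at hsum
    unfold cycDist at hsum
    omega
  constructor
  · rintro ⟨u, q, k, hcan, ⟨h, -⟩ | ⟨h, -⟩ | ⟨h, -⟩⟩
    · omega
    · exact hlong u q k hcan.1 h
    · omega
  · rintro y ⟨u, q, k, hcan, -, hk⟩
    exact hlong u q k hcan.1 hk

/-- Add to S the vertex of `IsCactus.exists_third` for each cycle outside A. From a cycle in A such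
a vertex is seen through a branch-active gate, which was active already; so S-paths there are
unchanged, while free threads only become fewer. -/
theorem IsBBR.metricDim_add_le [Fintype V] (hG : IsCactus G) (hc : 2 ≤ numCycles G)
    {S : Finset V} (hS : IsBBR G S) {A : Set G.Subgraph} (hA : A ⊆ cycles G)
    (hABC : ∀ C ∈ A, ¬ ContainsABC S C)
    (hinc : ∀ C ∈ A, ∀ D ∈ A, ¬ VertexCriticallyIncident S C D) :
    metricDim G + A.ncard ≤ S.card + numCycles G := by
  classical
  have hex : ∀ C : G.Subgraph, ∃ x, C ∈ cycles G → x ∈ C.verts ∧ ∀ R : Finset V, S ⊆ R → x ∈ R →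
      ¬ ContainsABC R C ∧ ∀ v, ¬ IsVertexCritical R C v := by
    intro C
    by_cases hC : C ∈ cycles G
    · obtain ⟨x, hx, h⟩ := hG.exists_third hC (hS.1 C hC)
      exact ⟨x, fun _ => ⟨hx, h⟩⟩
    · obtain ⟨v⟩ := hG.1.nonempty
      exact ⟨v, fun h => absurd h hC⟩
  choose x hx using hex
  set X : Finset V := (Set.toFinite (x '' (cycles G \ A))).toFinset with hX
  set R := S ∪ X with hR
  have hSR : S ⊆ R := Finset.subset_union_left
  have hxR : ∀ C ∈ cycles G, C ∉ A → x C ∈ R := by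
    intro C hC hCA
    refine Finset.mem_union_right _ ?_
    rw [hX, Set.Finite.mem_toFinset]
    exact ⟨C, ⟨hC, hCA⟩, rfl⟩
  have hact : ∀ C ∈ A, ∀ v, IsActive S C v ↔ IsActive R C v := by
    intro C hCA v
    have hC := hA hCA
    constructor
    · rintro ⟨hv, s, hs, hsv⟩
      exact ⟨hv, s, hSR hs, hsv⟩
    · rintro ⟨hv, s, hs, hsv⟩
      rcases Finset.mem_union.1 hs with h | h
      · exact ⟨hv, s, h, hsv⟩
      · rw [hX, Set.Finite.mem_toFinset] at h
        obtain ⟨D, ⟨hD, hDA⟩, rfl⟩ := h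
        have hne : C ≠ D := by
          rintro rfl
          exact hDA hCA
        have hsub := hG.cycle_subset_branch hC hD hne (hx D hD).1 hsv
        exact hS.isActive hG hc hC (hG.isBranchActive_of_cycle_subset hC hD hne hv hsub)
  have hRBBR : IsBBR G R := by
    refine ⟨fun C hC => (hS.1 C hC).trans (Set.ncard_le_ncard ?_ (Set.toFinite _)),
      fun v T T' hT hT' => hS.2 v T T' (hT.mono hSR) (hT'.mono hSR)⟩
    rintro v ⟨hv, s, hs, hsv⟩
    exact ⟨hv, s, hSR hs, hsv⟩
  have hgen : IsMetricGenerator G R := by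
    refine hRBBR.isMetricGenerator hG hc (fun C hC h => ?_) ?_
    · by_cases hCA : C ∈ A
      · exact hABC C hCA (h.mono (hact C hCA) hSR)
      · exact ((hx C hC).2 R hSR (hxR C hC hCA)).1 h
    · rintro C D ⟨hC, hD, hne, v, hvC, hvD⟩
      by_cases hCA : C ∈ A
      · by_cases hDA : D ∈ A
        · exact hinc C hCA D hDA ⟨hC, hD, hne, v, (isVertexCritical_congr (hact C hCA)).2 hvC,
            (isVertexCritical_congr (hact D hDA)).2 hvD⟩
        · exact ((hx D hD).2 R hSR (hxR D hD hDA)).2 v hvD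
      · exact ((hx C hC).2 R hSR (hxR C hC hCA)).2 v hvC
  have h1 := metricDim_le hgen
  have h2 : R.card ≤ S.card + X.card := Finset.card_union_le _ _
  have h3 : X.card ≤ (cycles G \ A).ncard := by
    rw [hX, ← Set.ncard_eq_toFinset_card _]
    exact Set.ncard_image_le (Set.toFinite _)
  have h4 := Set.ncard_sdiff_add_ncard_of_subset hA (Set.toFinite _)
  unfold numCycles
  omega

/-! ### Lower bounds for the metric dimension -/

/-- Each C in A is assigned an element of R \ S, either in its periphery or in a thread at a
branch-active vertex that is critical on C. Peripheries are disjoint from each other, and a thread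
meeting one hangs at a vertex on no other cycle. Two cycles sharing a thread element would be
vertex-critically incident for R. -/
theorem IsMetricGenerator.card_add_le [Finite V] (hG : IsCactus G) (hc : 2 ≤ numCycles G)
    {S R : Finset V} (hS : IsMinimalBBR G S) (hSR : S ⊆ R) (hR : IsMetricGenerator G R)
    {A : Set G.Subgraph} (hA : A ⊆ cycles G)
    (hex : ∀ C ∈ A, ContainsABC S C ∨ ∃ r ∈ R, r ∉ S ∧ r ∈ periphery C) :
    S.card + A.ncard ≤ R.card := by
  classical
  have : Nonempty V := hG.1.nonempty
  have hRB : IsBBR G R := ⟨hR.isBiactive hG, hR.isBranchResolving hG⟩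
  have key : ∀ C ∈ A, ∃ r ∈ R, r ∉ S ∧ (r ∈ periphery C ∨ ∃ v T, IsBranchActive C v ∧
      IsVertexCritical R C v ∧ IsThread G v T ∧ r ∈ T) := by
    intro C hCA
    by_cases h : ∃ r ∈ R, r ∉ S ∧ r ∈ periphery C
    · obtain ⟨r, h1, h2, h3⟩ := h
      exact ⟨r, h1, h2, Or.inl h3⟩
    · have hC := hA hCA
      have hSC := (hex C hCA).resolve_right h
      push Not at h
      obtain ⟨v, hv, -, hcrit, ⟨T, hT⟩, hno⟩ := hS.1.exists_isVertexCritical hG hc hRB hC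
        (fun w hw => ⟨fun hwS => hSR hwS, fun hwR => by
          by_contra hwS
          exact h w hwR hwS hw⟩) hSC (hR.not_containsABC hG C)
      have : ∃ r ∈ R, r ∈ T := by
        by_contra! h'
        exact hno T ⟨hT.1, h'⟩
      obtain ⟨r, hr, hrT⟩ := this
      exact ⟨r, hr, fun hrS => hT.2 r hrS hrT, Or.inr ⟨v, T, hv, hcrit, hT.1, hrT⟩⟩
  choose! f hfR hfS hf using key
  have hmix : ∀ C ∈ A, ∀ D ∈ A, C ≠ D → ∀ r, r ∈ periphery C → ¬ ∃ v T, IsBranchActive D v ∧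
      IsVertexCritical R D v ∧ IsThread G v T ∧ r ∈ T := by
    rintro C hC D hD hne r hr ⟨v, T, hv, -, hT, hrT⟩
    obtain ⟨hvC, hvC'⟩ := hT.of_mem_periphery (hA hC) hrT hr
    exact hvC' (hG.isBranchActive_of_mem_two (hA hC) (hA hD) hne hvC hv.1)
  have hinj : Set.InjOn f A := by
    intro C hC D hD heq
    by_contra hne
    rcases hf C hC with h1 | h1 <;> rcases hf D hD with h2 | h2
    · exact hG.periphery_disjoint (hA hC) (hA hD) hne h1 (heq ▸ h2)
    · exact hmix C hC D hD hne _ h1 (heq ▸ h2)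
    · exact hmix D hD C hC (Ne.symm hne) _ h2 (heq ▸ h1)
    · obtain ⟨v, T, -, hv, hT, hr⟩ := h1
      obtain ⟨w, U, -, hw, hU, hr'⟩ := h2
      obtain ⟨-, rfl⟩ := hT.eq_of_mem hU hr (heq ▸ hr')
      exact hR.not_incident hG C D ⟨hA hC, hA hD, hne, v, hv, hw⟩
  have h1 : A.ncard ≤ ((R \ S : Finset V) : Set V).ncard :=
    Set.ncard_le_ncard_of_injOn f (fun C hC => by
      simpa using ⟨hfR C hC, hfS C hC⟩) hinj (Set.toFinite _)
  rw [Set.ncard_coe_finset] at h1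
  have h2 := Finset.card_sdiff_add_card_eq_card hSR
  omega

/-- In a nice set, two incident `𝒜ℬ𝒞`-negative end-cycles cannot both be repaired by choosing
other vertices in their peripheries. -/
lemma IsNice.isVertexCritical [Fintype V] (hG : IsCactus G) (hc : 2 ≤ numCycles G)
    {S R : Finset V} (hS : IsNice G S) (hR : IsBBR G R) {C D : G.Subgraph}
    (hCe : IsEndCycle C) (hCR : ¬ ContainsABC R C) {v : V}
    (hinc : VertexCriticallyIncident S C D) (hvC : v ∈ C.verts) (hvD : v ∈ D.verts) {a : V}
    (ha : a ∈ periphery C) (hRa : ∀ w ∈ periphery C, w ∈ R ↔ w = a) : IsVertexCritical R C v := by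
  by_contra hcrit
  obtain ⟨hC, hD, hne, v₀, hv₀C, hv₀D⟩ := id hinc
  have hSm := (hG.isSmallestBBR_iff hc).1 hS.1.1
  obtain ⟨S', hS', htrC, htr⟩ := hSm.exists_exchange hG hc hCe ha
  -- An end-cycle has only one branch-active vertex, and v is one because it also lies on D.
  have hroot : ∀ w, IsBranchActive C w → w = v := by
    intro w hw
    obtain ⟨r, hr⟩ := Set.ncard_eq_one.1 hCe.2
    have h1 : w ∈ {v | IsBranchActive C v} := hw
    have h2 : v ∈ {v | IsBranchActive C v} := hG.isBranchActive_of_mem_two hC hD hne hvC hvD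
    rw [hr] at h1 h2
    exact h1.trans h2.symm
  have htrR : ∀ w ∈ periphery C, w ∈ S' ↔ w ∈ R := fun w hw => (htrC w hw).trans (hRa w hw).symm
  have hactR := hS'.1.isActive_congr hG hc hR hC htrR
  have hcrit' : ¬ IsVertexCritical S' C v := fun h => hcrit ((isVertexCritical_congr hactR).1 h)
  -- A configuration on C for S' but not for R would require R to be critical at the root v; on
  -- other cycles S' has the same trace as S.
  have hadm : IsABCAdmissible G S' := by
    refine ⟨(hG.isSmallestBBR_iff hc).2 hS', fun E hE hSE => ?_⟩
    by_cases hEC : E = C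
    · subst hEC
      obtain ⟨w, hw, -, hwR, -⟩ := hS'.1.exists_isVertexCritical hG hc hR hC htrR hSE hCR
      exact hcrit (hroot w hw ▸ hwR)
    · exact hS.1.2 E hE (hS'.containsABC hG hc hSm hE.1 (htr E hE.1 hEC) hSE)
  have hle := hS.2 S' hadm
  have hnoC : ∀ E, ¬ VertexCriticallyIncident S' C E := by
    rintro E ⟨-, hE, hCE, w, hwC, hwE⟩
    have := hroot w (hG.isBranchActive_of_mem_two hC hE hCE hwC.mem_verts.1 hwE.mem_verts.1)
    exact hcrit' (this ▸ hwC)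
  have hsymm : ∀ {E F : G.Subgraph} {Q : Finset V}, VertexCriticallyIncident Q E F →
      VertexCriticallyIncident Q F E :=
    fun ⟨h1, h2, h3, w, h4, h5⟩ => ⟨h2, h1, Ne.symm h3, w, h5, h4⟩
  -- C can meet other cycles only at v, where it is no longer critical; incidences among the other
  -- cycles are unchanged, so the pair of C and D is lost and none is gained.
  have hlt : numIncidentPairs G S' < numIncidentPairs G S := by
    refine Set.ncard_lt_ncard ⟨?_, fun h => ?_⟩ (Set.toFinite _)
    · rintro e ⟨E, F, rfl, hEF⟩
      refine ⟨E, F, rfl, ?_⟩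
      have hE : E ≠ C := by
        rintro rfl
        exact hnoC F hEF
      have hF : F ≠ C := by
        rintro rfl
        exact hnoC E (hsymm hEF)
      obtain ⟨hEc, hFc, hne', w, hwE, hwF⟩ := hEF
      have cE := hS'.1.isActive_congr hG hc hSm.1 hEc (htr E hEc hE)
      have cF := hS'.1.isActive_congr hG hc hSm.1 hFc (htr F hFc hF)
      exact ⟨hEc, hFc, hne', w, (isVertexCritical_congr cE).1 hwE, (isVertexCritical_congr cF).1 hwF⟩
    · obtain ⟨E, F, he, hEF⟩ := h (show s(C, D) ∈ _ from ⟨C, D, rfl, hinc⟩)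
      rcases Sym2.eq_iff.1 he with ⟨rfl, rfl⟩ | ⟨rfl, rfl⟩
      · exact hnoC D hEF
      · exact hnoC D (hsymm hEF)
  omega

end

/-! ### Lower bounds through positive and negative cycles -/

section

variable {V : Type*} {G : SimpleGraph V} [G.LocallyFinite]

/-! ### Lower bounds in terms of positive and negative cycles -/

lemma IsCactus.card_add_ncard_le_metricDim [Fintype V] (hG : IsCactus G) (hc : 2 ≤ numCycles G) :
    leafNumber G + {C : G.Subgraph | IsEndCycle C}.ncard +
      {C : G.Subgraph | IsABCPositive C}.ncard ≤ metricDim G := by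
  obtain ⟨R, hR, hcard⟩ := exists_card_eq_metricDim hG.1
  obtain ⟨S, hSR, hS⟩ := exists_isMinimalBBR_subset
    (show IsBBR G R from ⟨hR.isBiactive hG, hR.isBranchResolving hG⟩)
  rw [← hcard, ← hS.card_eq hG hc]
  refine hR.card_add_le hG hc hS hSR (fun C hC => hC.1) fun C hC => Or.inl ?_
  by_contra h
  exact hC.2 ⟨hC.1, S, (hG.isSmallestBBR_iff hc).2 hS, h⟩

/-- A generator R can save its extra element on at most one cycle. Were it to save on two, its
traces on their peripheries would be single vertices, so niceness makes both cycles critical for R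
at the vertex they share. -/
lemma IsNice.card_add_numCycles_le [Fintype V] (hG : IsCactus G) (hc : 2 ≤ numCycles G)
    {S : Finset V} (hS : IsNice G S) (hend : ∀ C ∈ cycles G, IsEndCycle C)
    (hinc : ∀ C ∈ cycles G, ∀ D ∈ cycles G, C ≠ D → ¬ IsABCPositive C → ¬ IsABCPositive D →
      VertexCriticallyIncident S C D) :
    S.card + numCycles G ≤ metricDim G + 1 := by
  obtain ⟨R, hR, hcard⟩ := exists_card_eq_metricDim hG.1
  have hRB : IsBBR G R := ⟨hR.isBiactive hG, hR.isBranchResolving hG⟩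
  obtain ⟨S₀, hSR, hS₀⟩ := exists_isMinimalBBR_subset hRB
  have hSm := (hG.isSmallestBBR_iff hc).1 hS.1.1
  -- The cycles on which R saves: not positive, and with no element of R beyond S₀ in the periphery.
  set N : Set G.Subgraph := {C | C ∈ cycles G ∧ ¬ IsABCPositive C ∧
    ∀ r ∈ R, r ∈ periphery C → r ∈ S₀} with hN
  have htrace : ∀ C ∈ N, ∃ a ∈ periphery C, ∀ w ∈ periphery C, w ∈ R ↔ w = a := by
    rintro C ⟨hC, -, hCR⟩
    obtain ⟨a, haS, ha⟩ := ((hG.isBBR_iff hc).1 hS₀.1).1 C (hend C hC)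
    refine ⟨a, ha, fun w hw => ⟨fun hwR => ?_, ?_⟩⟩
    · exact hS₀.eq_of_mem_periphery hG hc (hend C hC) (hCR w hwR hw) haS hw ha
    · rintro rfl
      exact hSR haS
  have hsub : N.ncard ≤ 1 := by
    rw [Set.ncard_le_one_iff (Set.toFinite _)]
    intro C D hCN hDN
    by_contra hne
    have hCD := hinc C hCN.1 D hDN.1 hne hCN.2.1 hDN.2.1
    have hDC := hinc D hDN.1 C hCN.1 (Ne.symm hne) hDN.2.1 hCN.2.1
    obtain ⟨v, hvC, hvD⟩ := hCD.2.2.2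
    obtain ⟨a, ha, hRa⟩ := htrace C hCN
    obtain ⟨b, hb, hRb⟩ := htrace D hDN
    have h1 := hS.isVertexCritical hG hc hRB (hend C hCN.1) (hR.not_containsABC hG C) hCD
      hvC.mem_verts.1 hvD.mem_verts.1 ha hRa
    have h2 := hS.isVertexCritical hG hc hRB (hend D hDN.1) (hR.not_containsABC hG D) hDC
      hvD.mem_verts.1 hvC.mem_verts.1 hb hRb
    exact hR.not_incident hG C D ⟨hCN.1, hDN.1, hne, v, h1, h2⟩
  have h1 := hR.card_add_le hG hc hS₀ hSR (A := cycles G \ N) Set.sdiff_subset (by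
    rintro C ⟨hC, hCN⟩
    by_cases hCp : IsABCPositive C
    · left
      by_contra h
      exact hCp.2 ⟨hC, S₀, (hG.isSmallestBBR_iff hc).2 hS₀, h⟩
    · right
      by_contra! h
      refine hCN ⟨hC, hCp, fun r hr hrC => ?_⟩
      by_contra hrS
      exact h r hr hrS hrC)
  have h2 := Set.ncard_sdiff_add_ncard_of_subset (s := N) (t := cycles G) (fun C hC => hC.1)
    (Set.toFinite _)
  rw [hS₀.card_eq hG hc, ← hSm.card_eq hG hc] at h1
  unfold numCycles
  omega

end

end CactusDim

theorem mainTheorem5 {V : Type*} [Fintype V] (G : SimpleGraph V) [G.LocallyFinite]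
    (hG : CactusDim.IsCactus G) (hc : 2 ≤ CactusDim.numCycles G) :
    (∃ S : Finset V, CactusDim.IsNice G S) ∧
    ∀ S : Finset V, CactusDim.IsNice G S →
      (CactusDim.metricDim G = CactusDim.leafNumber G + 2 * CactusDim.numCycles G - 1 ↔
        ((∀ C ∈ CactusDim.cycles G, CactusDim.IsEndCycle C) ∧
          {C : G.Subgraph | CactusDim.IsABCPositive C}.ncard ≤ CactusDim.numCycles G - 1 ∧
          ∀ C ∈ CactusDim.cycles G, ∀ D ∈ CactusDim.cycles G, C ≠ D →
            ¬ CactusDim.IsABCPositive C → ¬ CactusDim.IsABCPositive D →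
            CactusDim.VertexCriticallyIncident S C D) ∨
        ({C : G.Subgraph | CactusDim.IsEndCycle C}.ncard = CactusDim.numCycles G - 1 ∧
          ∀ C ∈ CactusDim.cycles G, CactusDim.IsABCPositive C)) := by
  refine ⟨hG.exists_isNice hc, fun S hS => ?_⟩
  have hSm := (hG.isSmallestBBR_iff hc).1 hS.1.1
  have hcard := hSm.card_eq hG hc
  have hendsub : {C : G.Subgraph | CactusDim.IsEndCycle C} ⊆ CactusDim.cycles G := fun C hC => hC.1
  have hneg : ∀ C ∈ CactusDim.cycles G, ¬ CactusDim.IsABCPositive C → CactusDim.IsABCNegative C :=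
    fun C hC h => by
      by_contra h'
      exact h ⟨hC, h'⟩
  have hpos := CactusDim.IsCactus.card_add_ncard_le_metricDim hG hc
  -- With every cycle positive, the lower bound meets the upper bound for A = ∅.
  have hallpos : (∀ C ∈ CactusDim.cycles G, CactusDim.IsABCPositive C) →
      CactusDim.metricDim G = S.card + CactusDim.numCycles G := by
    intro h
    have h1 : {C : G.Subgraph | CactusDim.IsABCPositive C} = CactusDim.cycles G :=
      Set.Subset.antisymm (fun C hC => hC.1) h
    have h2 := hSm.1.metricDim_add_le hG hc (Set.empty_subset _)
      (fun C hC => absurd hC (Set.notMem_empty C)) (fun C hC => absurd hC (Set.notMem_empty C))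
    rw [h1, ← hcard] at hpos
    rw [Set.ncard_empty] at h2
    unfold CactusDim.numCycles at *
    omega
  -- Admissibility of S lets a single negative cycle serve as A; incidence requires distinct cycles.
  have hone : ∀ C ∈ CactusDim.cycles G, ¬ CactusDim.IsABCPositive C →
      CactusDim.metricDim G + 1 ≤ S.card + CactusDim.numCycles G := by
    intro C hC hCp
    have := hSm.1.metricDim_add_le hG hc (A := {C}) (Set.singleton_subset_iff.2 hC)
      (fun D hD => by
        rw [Set.mem_singleton_iff.1 hD]
        exact hS.1.2 C (hneg C hC hCp))
      (fun D hD E hE h => h.2.2.1 (hD.trans hE.symm))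
    rwa [Set.ncard_singleton] at this
  constructor
  · intro hdim
    by_cases hall : ∀ C ∈ CactusDim.cycles G, CactusDim.IsABCPositive C
    · right
      have := hallpos hall
      exact ⟨by omega, hall⟩
    · left
      push Not at hall
      obtain ⟨C, hC, hCp⟩ := hall
      have h1 := hone C hC hCp
      -- One vertex is saved already, so the given value forces the number of end-cycles up to c.
      have hend : {C : G.Subgraph | CactusDim.IsEndCycle C} = CactusDim.cycles G := by
        refine Set.eq_of_subset_of_ncard_le hendsub ?_ (Set.toFinite _)
        change CactusDim.numCycles G ≤ _
        omega
      have hendcard : {C : G.Subgraph | CactusDim.IsEndCycle C}.ncard = CactusDim.numCycles G := by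
        rw [hend]
        rfl
      refine ⟨fun D hD => ?_, ?_, fun D hD E hE hne hDp hEp => ?_⟩
      · rw [← hend] at hD
        exact hD
      · have : {C : G.Subgraph | CactusDim.IsABCPositive C} ⊂ CactusDim.cycles G :=
          ⟨fun D hD => hD.1, fun h => hCp (h hC)⟩
        have := Set.ncard_lt_ncard this (Set.toFinite _)
        unfold CactusDim.numCycles
        omega
      · by_contra hnot
        have hnot' : ¬ CactusDim.VertexCriticallyIncident S E D :=
          fun ⟨h1, h2, h3, w, h4, h5⟩ => hnot ⟨h2, h1, Ne.symm h3, w, h5, h4⟩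
        -- Two non-incident negative cycles would save two vertices and push the dimension down to
        -- L(G) + 2c - 2.
        have := hSm.1.metricDim_add_le hG hc (A := {D, E}) (Set.pair_subset hD hE)
          (by
            rintro F (rfl | rfl)
            exacts [hS.1.2 _ (hneg _ hD hDp), hS.1.2 _ (hneg _ hE hEp)])
          (by
            rintro F (rfl | rfl) F' (rfl | rfl)
            exacts [fun h => h.2.2.1 rfl, hnot, hnot', fun h => h.2.2.1 rfl])
        rw [Set.ncard_pair hne] at this
        omega
  · rintro (⟨hend, hle, hinc⟩ | ⟨hend, hall⟩)
    · have hendcard : {C : G.Subgraph | CactusDim.IsEndCycle C}.ncard = CactusDim.numCycles G := by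
        rw [Set.Subset.antisymm hendsub hend]
        rfl
      have hex : ∃ C ∈ CactusDim.cycles G, ¬ CactusDim.IsABCPositive C := by
        by_contra! h
        have : {C : G.Subgraph | CactusDim.IsABCPositive C} = CactusDim.cycles G :=
          Set.Subset.antisymm (fun C hC => hC.1) h
        rw [this] at hle
        unfold CactusDim.numCycles at hle hc
        omega
      obtain ⟨C, hC, hCp⟩ := hex
      have h1 := hone C hC hCp
      have h2 := hS.card_add_numCycles_le hG hc hend hinc
      omega
    · have := hallpos hall
      omega
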